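/- All algebras are associative algebras over $\mathbb C$, possibly without unit, with non-degenerate product; $M(X)$ is the multiplier algebra of $X$ and $\iota$ denotes identity maps. A multiplier Hopf $^*$-algebra is a $^*$-algebra $A$ with a $^*$-homomorphism $\Delta:A\to M(A\otimes A)$ such that $a\otimes a'\mapsto\Delta(a)(1\otimes a')$ and $a\otimes a'\mapsto(a\otimes 1)\Delta(a')$ are bijections of $A\otimes A$ and $\Delta$ is coassociative: $(a\otimes1\otimes1)(\Delta\otimes\iota)(\Delta(b)(1\otimes c))=(\iota\otimes\Delta)((a\otimes1)\Delta(b))(1\otimes1\otimes c)$. Its antipode is denoted by $S:A\to A$, and $\Delta(a)=\sum a_{(1)}\otimes a_{(2)}$. Let $A$ and $B$ be multiplier Hopf $^*$-algebras. Let $B$ be a right $A$-module algebra: there is a right action $b\otimes a\mapsto b\triangleleft a$ of $A$ on $B$ such that the elements $b\triangleleft a$ span $B$ and $(bb')\triangleleft a=\sum(b\triangleleft a_{(1)})(b'\triangleleft a_{(2)})$. Assume that $$(b\triangleleft a)^*=b^*\triangleleft S_A(a)^*\qquad(a\in A,\ b\in B).$$ Put $R(b\otimes a)=\sum a_{(1)}\otimes(b\triangleleft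 a_{(2)})$ and $R^{op}(b\otimes a)=\sum a_{(2)}\otimes(b\triangleleft a_{(1)})$, as linear maps $B\otimes A\to A\otimes B$. The smash product $AB$ is the vector space $A\otimes B$, with $ab$ written for $a\otimes b$ and $ba:=R(b\otimes a)$, and with the product $(ab)(a'b')=\sum aa'_{(1)}(b\triangleleft a'_{(2)})b'$. **(i)** $AB$ is a $^*$-algebra (associative, with non-degenerate product) for the conjugate linear involution given by $(ab)^*=b^*a^*$. Let $M_0(B\otimes A)$ be the space of elements $y$ for which $y(b\otimes1)$ and $(b\otimes1)y$ are in $B\otimes A$ for all $b\in B$ (the completion of the $B$-bimodule $B\otimes A$), and let $\Gamma:A\to M_0(B\otimes A)$ be a left coaction, that is, an injective linear map with $(\iota_B\otimes\Gamma)\Gamma=(\Delta_B\otimes\iota_A)\Gamma$. Put $T(a\otimes b)=\Gamma(a)(b\otimes1)$ and $T^{op}(a\otimes b)=(b\otimes1)\Gamma(a)$, as linear maps $A\otimes B\to B\otimes A$. Assume that $A$ is a left $B$-comodule coalgebra: the elements $((\iota_A\otimes T)(\Delta_A(a)\otimes b))(1\otimes1\otimes a')$ and $(1\otimes1\otimes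 a')((\iota_A\otimes T)(\Delta_A(a)\otimes b))$ are in $A\otimes B\otimes A$ for all $a,a'\in A$, $b\in B$, and $$(\iota_B\otimes\Delta_A)T=(T\otimes\iota_A)(\iota_A\otimes T)(\Delta_A\otimes\iota_B)\quad\text{on }A\otimes B .$$ Assume that $\Gamma(S_A(a)^*)=((\iota_B\otimes S_A)\Gamma(a))^*$ for all $a\in A$. Finally, with $P=T^{op}\circ R^{op}:B\otimes A\to B\otimes A$ and $m_A$ the product of $A$, assume that $$P(\iota_B\otimes m_A)=(\iota_B\otimes m_A)P_{13}P_{12}\ \text{ on }B\otimes A\otimes A,\qquad(\Delta_B\otimes\iota_A)P=P_{23}P_{13}(\Delta_B\otimes\iota_A)\ \text{ on }B\otimes A,\qquad T\circ R=T^{op}\circ R^{op}\ \text{ on }B\otimes A .$$ **(ii)** Then there is a unique linear map $\Delta_\#:AB\to M(AB\otimes AB)$ given by $\Delta_\#(ab)=\sum(a_{(1)}\otimes1)\Gamma(a_{(2)})\Delta_B(b)$, that is, $$(b'a'\otimes y)\,\Delta_\#(ab)=(1\otimes y)\sum(b'a'a_{(1)}\otimes1)\,\Gamma(a_{(2)})\,\Delta_B(b)\qquad(a,a'\in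 A,\ b,b'\in B,\ y\in AB),$$ and $\Delta_\#$ is a $^*$-homomorphism: $\Delta_\#(xy)=\Delta_\#(x)\Delta_\#(y)$ and $\Delta_\#(x^*)=\Delta_\#(x)^*$ for all $x,y\in AB$. -/

import Mathlib

/-!
Multiplier Hopf `*`-algebras, module algebras, comodule coalgebras, the smash product `AB` and the
smash coproduct.  All algebras are (possibly non-unital) algebras over `ℂ`, all tensor products are
algebraic.  Threefold tensor products are bracketed to the right: `X ⊗ (Y ⊗ Z)`.
-/

open scoped TensorProduct ComplexConjugate

noncomputable section

namespace Bicross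

/-! ### Leg numbering -/

section Legs

variable {X Y Z W V : Type*}
  [AddCommGroup X] [Module ℂ X] [AddCommGroup Y] [Module ℂ Y] [AddCommGroup Z] [Module ℂ Z]
  [AddCommGroup W] [Module ℂ W] [AddCommGroup V] [Module ℂ V]

/-- `f ⊗ ι` on `X ⊗ (Y ⊗ V)`, the map `f` acting in the first two legs. -/
def leg12 (V : Type*) [AddCommGroup V] [Module ℂ V]
    (f : X ⊗[ℂ] Y →ₗ[ℂ] Z ⊗[ℂ] W) : X ⊗[ℂ] (Y ⊗[ℂ] V) →ₗ[ℂ] Z ⊗[ℂ] (W ⊗[ℂ] V) :=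
  (TensorProduct.assoc ℂ Z W V).toLinearMap ∘ₗ f.rTensor V ∘ₗ
    (TensorProduct.assoc ℂ X Y V).symm.toLinearMap

/-- `ι ⊗ f` on `V ⊗ (X ⊗ Y)`, the map `f` acting in the last two legs. -/
def leg23 (V : Type*) [AddCommGroup V] [Module ℂ V]
    (f : X ⊗[ℂ] Y →ₗ[ℂ] Z ⊗[ℂ] W) : V ⊗[ℂ] (X ⊗[ℂ] Y) →ₗ[ℂ] V ⊗[ℂ] (Z ⊗[ℂ] W) :=
  f.lTensor V

/-- The map `f` acting in the first and third legs of `X ⊗ (V ⊗ Y)`. -/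
def leg13 (V : Type*) [AddCommGroup V] [Module ℂ V]
    (f : X ⊗[ℂ] Y →ₗ[ℂ] Z ⊗[ℂ] W) : X ⊗[ℂ] (V ⊗[ℂ] Y) →ₗ[ℂ] Z ⊗[ℂ] (V ⊗[ℂ] W) :=
  (TensorProduct.comm ℂ W V).toLinearMap.lTensor Z ∘ₗ leg12 V f ∘ₗ
    (TensorProduct.comm ℂ V Y).toLinearMap.lTensor X

end Legs

/-! ### Multiplier algebras -/

section Multipliers

variable {X : Type*} [NonUnitalNonAssocSemiring X] [Module ℂ X] [IsScalarTower ℂ X X]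
  [SMulCommClass ℂ X X]

variable (X) in
/-- The space underlying the multiplier algebra `M(X)`: pairs `(λ, ρ)` of linear maps with
`ρ(x) y = x λ(y)`, where `λ(y) = m y` and `ρ(x) = x m` for the multiplier `m = (λ, ρ)`.
(If the product of `X` is associative and non-degenerate, `λ(xy) = λ(x)y` and `ρ(xy) = xρ(y)`
follow.) -/
def multiplierSubmodule : Submodule ℂ ((X →ₗ[ℂ] X) × (X →ₗ[ℂ] X)) where
  carrier := {p | ∀ x y : X, p.2 x * y = x * p.1 y}
  add_mem' := by
    intro p q hp hq x y
    simp only [Set.mem_ofPred_eq] at hp hq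
    simp [add_mul, mul_add, hp x y, hq x y]
  zero_mem' := by intro x y; simp
  smul_mem' := by
    intro c p hp x y
    simp only [Set.mem_ofPred_eq] at hp
    simp [smul_mul_assoc, mul_smul_comm, hp x y]

variable (X) in
/-- The multiplier algebra `M(X)`. -/
abbrev Mult : Type _ := multiplierSubmodule X

/-- `m.L x = m x`. -/
def Mult.L (m : Mult X) : X →ₗ[ℂ] X := m.1.1

/-- `m.R x = x m`. -/
def Mult.R (m : Mult X) : X →ₗ[ℂ] X := m.1.2

/-- The product of `M(X)`: `(m n) x = m (n x)` and `x (m n) = (x m) n`. -/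
instance : Mul (Mult X) where
  mul m n := ⟨(m.L ∘ₗ n.L, n.R ∘ₗ m.R), by
    intro x y
    have h1 := m.2 x (n.L y)
    have h2 := n.2 (m.R x) y
    exact h2.trans h1⟩

/-- `m' = m^*` in `M(X)`, where `τ` is the involution of `X`: `m^* x = (x^* m)^*` and
`x m^* = (m x^*)^*`. -/
def Mult.IsAdjoint (τ : X → X) (m m' : Mult X) : Prop :=
  ∀ x, m'.L x = τ (m.R (τ x)) ∧ m'.R x = τ (m.L (τ x))

end Multipliers

/-! ### Multiplier Hopf `*`-algebras -/

section MultiplierHopf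

variable {A : Type*} [NonUnitalRing A] [Module ℂ A] [IsScalarTower ℂ A A] [SMulCommClass ℂ A A]
  [StarRing A] [StarModule ℂ A]

variable (A) in
/-- The structure of a multiplier Hopf `*`-algebra on the `*`-algebra `A`.  The maps `T₁`, `T₂` are
determined by the coproduct `Δ`; having them here says that `Δ(a)(1 ⊗ b)` and `(a ⊗ 1)Δ(b)` lie in
`A ⊗ A` and that the two canonical maps are bijective. -/
structure MultiplierHopfStarAlgebra where
  nondegenerate_left : ∀ a : A, (∀ b, a * b = 0) → a = 0
  nondegenerate_right : ∀ a : A, (∀ b, b * a = 0) → a = 0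
  /-- the coproduct `Δ : A → M(A ⊗ A)` -/
  Δ : A →ₗ[ℂ] Mult (A ⊗[ℂ] A)
  Δ_mul : ∀ a b, Δ (a * b) = Δ a * Δ b
  Δ_star : ∀ a, Mult.IsAdjoint star (Δ a) (Δ (star a))
  /-- `T₁ (a ⊗ b) = Δ(a)(1 ⊗ b)` -/
  T₁ : A ⊗[ℂ] A ≃ₗ[ℂ] A ⊗[ℂ] A
  T₁_spec : ∀ (a b : A) (x : A ⊗[ℂ] A),
    T₁ (a ⊗ₜ b) * x = (Δ a).L ((LinearMap.mulLeft ℂ b).lTensor A x)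
  /-- `T₂ (a ⊗ b) = (a ⊗ 1)Δ(b)` -/
  T₂ : A ⊗[ℂ] A ≃ₗ[ℂ] A ⊗[ℂ] A
  T₂_spec : ∀ (a b : A) (x : A ⊗[ℂ] A),
    x * T₂ (a ⊗ₜ b) = (Δ b).R ((LinearMap.mulRight ℂ a).rTensor A x)
  /-- `(a ⊗ 1 ⊗ 1)(Δ ⊗ ι)(Δ(b)(1 ⊗ c)) = (ι ⊗ Δ)((a ⊗ 1)Δ(b))(1 ⊗ 1 ⊗ c)` -/
  coassoc : leg12 A T₂.toLinearMap ∘ₗ leg23 A T₁.toLinearMap =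
    leg23 A T₁.toLinearMap ∘ₗ leg12 A T₂.toLinearMap

namespace MultiplierHopfStarAlgebra

variable (H : MultiplierHopfStarAlgebra A)

/-- `ε` is a counit: `(ε ⊗ ι)(Δ(a)(1 ⊗ b)) = ab` and `(ι ⊗ ε)((a ⊗ 1)Δ(b)) = ab`. -/
def IsCounit (ε : A →ₗ[ℂ] ℂ) : Prop :=
  ∀ a b : A, TensorProduct.lid ℂ A (ε.rTensor A (H.T₁ (a ⊗ₜ b))) = a * b ∧
    TensorProduct.rid ℂ A (ε.lTensor A (H.T₂ (a ⊗ₜ b))) = a * b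

/-- The counit of `A` (the unique linear functional with the defining property). -/
def counit : A →ₗ[ℂ] ℂ := Classical.epsilon H.IsCounit

/-- `S` is an antipode: `m(S ⊗ ι)(Δ(a)(1 ⊗ b)) = ε(a)b` and `m(ι ⊗ S)((a ⊗ 1)Δ(b)) = ε(b)a`. -/
def IsAntipode (S : A →ₗ[ℂ] A) : Prop :=
  ∀ a b : A, LinearMap.mul' ℂ A (S.rTensor A (H.T₁ (a ⊗ₜ b))) = H.counit a • b ∧
    LinearMap.mul' ℂ A (S.lTensor A (H.T₂ (a ⊗ₜ b))) = H.counit b • a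

/-- The antipode of `A` (the unique linear map with the defining property; a multiplier Hopf
`*`-algebra is regular, so that its antipode maps `A` to `A`). -/
def antipode : A →ₗ[ℂ] A := Classical.epsilon H.IsAntipode

end MultiplierHopfStarAlgebra

end MultiplierHopf

/-! ### Actions, twist maps and the smash product -/

section Action

variable {A : Type*} [NonUnitalRing A] [Module ℂ A] [IsScalarTower ℂ A A] [SMulCommClass ℂ A A]
  [StarRing A] [StarModule ℂ A]
  {B : Type*} [NonUnitalRing B] [Module ℂ B] [IsScalarTower ℂ B B] [SMulCommClass ℂ B B]

/-- `B` is a right `A`-module algebra for the action `b ◁ a = act b a`. -/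
structure IsModuleAlgebra (H : MultiplierHopfStarAlgebra A) (act : B →ₗ[ℂ] A →ₗ[ℂ] B) : Prop where
  act_mul : ∀ b a a', act b (a * a') = act (act b a) a'
  unital : Submodule.span ℂ {x : B | ∃ b a, x = act b a} = ⊤
  /-- `(b b') ◁ a = ∑ (b ◁ a₍₁₎)(b' ◁ a₍₂₎)` for `b = c ◁ e`, where `a₍₁₎` is covered by `e`. -/
  mul_act : ∀ c e b' a, act (act c e * b') a =
    LinearMap.mul' ℂ B (TensorProduct.map (act c) (act b') (H.T₂ (e ⊗ₜ a)))

/-- The defining property of the twist map `R (b ⊗ a) = ∑ a₍₁₎ ⊗ (b ◁ a₍₂₎)`: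
`(a' ⊗ 1) R (b ⊗ a) = ∑ a' a₍₁₎ ⊗ (b ◁ a₍₂₎)` for all `a'`. -/
def IsTwist (H : MultiplierHopfStarAlgebra A) (act : B →ₗ[ℂ] A →ₗ[ℂ] B)
    (R : B ⊗[ℂ] A →ₗ[ℂ] A ⊗[ℂ] B) : Prop :=
  ∀ b a a', (LinearMap.mulLeft ℂ a').rTensor B (R (b ⊗ₜ a)) = (act b).lTensor A (H.T₂ (a' ⊗ₜ a))

/-- The twist map `R (b ⊗ a) = ∑ a₍₁₎ ⊗ (b ◁ a₍₂₎)`. -/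
def twist (H : MultiplierHopfStarAlgebra A) (act : B →ₗ[ℂ] A →ₗ[ℂ] B) :
    B ⊗[ℂ] A →ₗ[ℂ] A ⊗[ℂ] B :=
  Classical.epsilon (IsTwist H act)

/-- The defining property of the map `R^op (b ⊗ a) = ∑ a₍₂₎ ⊗ (b ◁ a₍₁₎)`:
`R^op (b ⊗ a) (a' ⊗ 1) = ∑ a₍₂₎ a' ⊗ (b ◁ a₍₁₎)` for all `a'`. -/
def IsTwistOp (H : MultiplierHopfStarAlgebra A) (act : B →ₗ[ℂ] A →ₗ[ℂ] B)
    (R' : B ⊗[ℂ] A →ₗ[ℂ] A ⊗[ℂ] B) : Prop :=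
  ∀ b a a', (LinearMap.mulRight ℂ a').rTensor B (R' (b ⊗ₜ a)) =
    TensorProduct.comm ℂ B A ((act b).rTensor A (H.T₁ (a ⊗ₜ a')))

/-- The map `R^op (b ⊗ a) = ∑ a₍₂₎ ⊗ (b ◁ a₍₁₎)`. -/
def twistOp (H : MultiplierHopfStarAlgebra A) (act : B →ₗ[ℂ] A →ₗ[ℂ] B) :
    B ⊗[ℂ] A →ₗ[ℂ] A ⊗[ℂ] B :=
  Classical.epsilon (IsTwistOp H act)

/-- The space underlying the smash product `AB = A # B`. -/
def Smash (_H : MultiplierHopfStarAlgebra A) (_act : B →ₗ[ℂ] A →ₗ[ℂ] B) : Type _ := A ⊗[ℂ] B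

namespace Smash

variable (H : MultiplierHopfStarAlgebra A) (act : B →ₗ[ℂ] A →ₗ[ℂ] B)

instance : AddCommGroup (Smash H act) := inferInstanceAs (AddCommGroup (A ⊗[ℂ] B))
instance : Module ℂ (Smash H act) := inferInstanceAs (Module ℂ (A ⊗[ℂ] B))

/-- The identification of `A ⊗ B` with `AB`. -/
def equiv : A ⊗[ℂ] B ≃ₗ[ℂ] Smash H act := LinearEquiv.refl ℂ (A ⊗[ℂ] B)

/-- The element `ab = a # b` of `AB`. -/
def ab (a : A) (b : B) : Smash H act := equiv H act (a ⊗ₜ b)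

/-- The element `ba = ∑ a₍₁₎ (b ◁ a₍₂₎)` of `AB`. -/
def ba (b : B) (a : A) : Smash H act := equiv H act (twist H act (b ⊗ₜ a))

/-- The product `m = (m_A ⊗ m_B)(ι_A ⊗ R ⊗ ι_B)` as a linear map on `(A ⊗ B) ⊗ (A ⊗ B)`. -/
def mulAux : (A ⊗[ℂ] B) ⊗[ℂ] (A ⊗[ℂ] B) →ₗ[ℂ] A ⊗[ℂ] B :=
  TensorProduct.map (LinearMap.mul' ℂ A) (LinearMap.mul' ℂ B) ∘ₗ
    (TensorProduct.assoc ℂ A A (B ⊗[ℂ] B)).symm.toLinearMap ∘ₗ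
    (leg12 B (twist H act)).lTensor A ∘ₗ
    (TensorProduct.assoc ℂ A B (A ⊗[ℂ] B)).toLinearMap

/-- The product of `AB`, as a bilinear map. -/
def mulBilin : Smash H act →ₗ[ℂ] Smash H act →ₗ[ℂ] Smash H act :=
  TensorProduct.curry (mulAux H act)

/-- `AB` with its product `(ab)(a'b') = ∑ a a'₍₁₎ (b ◁ a'₍₂₎) b'`. -/
instance : NonUnitalNonAssocRing (Smash H act) where
  mul x y := mulBilin H act x y
  left_distrib x y z := map_add (mulBilin H act x) y z
  right_distrib x y z := LinearMap.map_add₂ (mulBilin H act) x y z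
  zero_mul x := LinearMap.map_zero₂ (mulBilin H act) x
  mul_zero x := map_zero (mulBilin H act x)

instance : IsScalarTower ℂ (Smash H act) (Smash H act) :=
  ⟨fun c x y => LinearMap.map_smul₂ (mulBilin H act) c x y⟩

instance : SMulCommClass ℂ (Smash H act) (Smash H act) :=
  ⟨fun c x y => ((mulBilin H act x).map_smul c y).symm⟩

variable [StarRing B] [StarModule ℂ B]

/-- The conjugate linear map on `AB` given by `(ab)^* = b^* a^*`. -/
def involution : Smash H act →ₛₗ[starRingEnd ℂ] Smash H act :=
  ((equiv H act).toLinearMap ∘ₗ twist H act ∘ₗ (TensorProduct.comm ℂ A B).toLinearMap).comp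
    (starLinearEquiv ℂ (A := A ⊗[ℂ] B)).toLinearMap

theorem involution_ab (a : A) (b : B) :
    involution H act (ab H act a b) = ba H act (star b) (star a) := rfl

/-- The induced conjugate linear map `(x ⊗ y)^* = x^* ⊗ y^*` on `AB ⊗ AB`. -/
def involution₂ : Smash H act ⊗[ℂ] Smash H act →ₛₗ[starRingEnd ℂ] Smash H act ⊗[ℂ] Smash H act :=
  TensorProduct.map (involution H act) (involution H act)

end Smash

end Action

/-! ### Coactions and cotwist maps -/

section Coaction

section CompletedModule

variable {B : Type*} [NonUnitalRing B] [Module ℂ B] [IsScalarTower ℂ B B] [SMulCommClass ℂ B B]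
  {V : Type*} [AddCommGroup V] [Module ℂ V]

variable (B V) in
/-- The completion `M₀(B ⊗ V)` of the `B`-bimodule `B ⊗ V`: its elements `y` are pairs of linear
maps `b ↦ y(b ⊗ 1)` and `b ↦ (b ⊗ 1)y` from `B` to `B ⊗ V` with
`(b' ⊗ 1)(y(b ⊗ 1)) = ((b' ⊗ 1)y)(b ⊗ 1)`. -/
def completedModule : Submodule ℂ ((B →ₗ[ℂ] B ⊗[ℂ] V) × (B →ₗ[ℂ] B ⊗[ℂ] V)) where
  carrier := {p | ∀ b b' : B, (LinearMap.mulLeft ℂ b').rTensor V (p.1 b) =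
    (LinearMap.mulRight ℂ b).rTensor V (p.2 b')}
  add_mem' := by
    intro p q hp hq b b'
    simp only [Set.mem_ofPred_eq] at hp hq
    simp [hp b b', hq b b']
  zero_mem' := by intro b b'; simp
  smul_mem' := by
    intro c p hp b b'
    simp only [Set.mem_ofPred_eq] at hp
    simp [hp b b']

variable (B V) in
/-- `M₀(B ⊗ V)`. -/
abbrev M₀ : Type _ := completedModule B V

/-- `y.right b = y(b ⊗ 1)`. -/
def M₀.right (y : M₀ B V) : B →ₗ[ℂ] B ⊗[ℂ] V := y.1.1

/-- `y.left b = (b ⊗ 1)y`. -/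
def M₀.left (y : M₀ B V) : B →ₗ[ℂ] B ⊗[ℂ] V := y.1.2

/-- The extension of `ι_B ⊗ f` to `M₀(B ⊗ V)`. -/
def M₀.map (f : V →ₗ[ℂ] V) (y : M₀ B V) : M₀ B V :=
  ⟨(f.lTensor B ∘ₗ y.right, f.lTensor B ∘ₗ y.left), by
    intro b b'
    have h : (LinearMap.mulLeft ℂ b').rTensor V (y.right b) =
      (LinearMap.mulRight ℂ b).rTensor V (y.left b') := y.2 b b'
    have key : ∀ (g : B →ₗ[ℂ] B) (x : B ⊗[ℂ] V),
        g.rTensor V (f.lTensor B x) = f.lTensor B (g.rTensor V x) := by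
      intro g x
      induction x with
      | zero => simp
      | tmul x v => simp
      | add x y hx hy => simp [hx, hy]
    simp only [LinearMap.comp_apply]
    rw [key, key, h]⟩

variable [StarRing B] [StarModule ℂ B] [StarAddMonoid V] [StarModule ℂ V]

theorem star_mulLeft_rTensor (b : B) (x : B ⊗[ℂ] V) :
    star ((LinearMap.mulLeft ℂ b).rTensor V x) =
      (LinearMap.mulRight ℂ (star b)).rTensor V (star x) := by
  induction x with
  | zero => simp
  | tmul x v => simp
  | add x y hx hy => simp [hx, hy]

theorem star_mulRight_rTensor (b : B) (x : B ⊗[ℂ] V) :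
    star ((LinearMap.mulRight ℂ b).rTensor V x) =
      (LinearMap.mulLeft ℂ (star b)).rTensor V (star x) := by
  induction x with
  | zero => simp
  | tmul x v => simp
  | add x y hx hy => simp [hx, hy]

/-- `b ↦ f(b^*)^*`. -/
def conjMap (f : B →ₗ[ℂ] B ⊗[ℂ] V) : B →ₗ[ℂ] B ⊗[ℂ] V where
  toFun b := star (f (star b))
  map_add' x y := by simp
  map_smul' c x := by simp

/-- The involution of `M₀(B ⊗ V)`: `y^*(b ⊗ 1) = ((b^* ⊗ 1)y)^*` and
`(b ⊗ 1)y^* = (y(b^* ⊗ 1))^*`. -/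
def M₀.adjoint (y : M₀ B V) : M₀ B V :=
  ⟨(conjMap y.left, conjMap y.right), by
    intro b b'
    have h : (LinearMap.mulLeft ℂ (star b)).rTensor V (y.right (star b')) =
      (LinearMap.mulRight ℂ (star b')).rTensor V (y.left (star b)) := y.2 (star b') (star b)
    have h' := congrArg star h
    rw [star_mulLeft_rTensor, star_mulRight_rTensor, star_star, star_star] at h'
    exact h'.symm⟩

end CompletedModule

variable {A : Type*} [NonUnitalRing A] [Module ℂ A]
  {B : Type*} [NonUnitalRing B] [Module ℂ B] [IsScalarTower ℂ B B] [SMulCommClass ℂ B B]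

/-- The cotwist map `T (a ⊗ b) = Γ(a)(b ⊗ 1)`. -/
def cotwist (Γ : A →ₗ[ℂ] M₀ B A) : A ⊗[ℂ] B →ₗ[ℂ] B ⊗[ℂ] A :=
  TensorProduct.lift (LinearMap.fst ℂ _ _ ∘ₗ (completedModule B A).subtype ∘ₗ Γ)

/-- The map `T^op (a ⊗ b) = (b ⊗ 1)Γ(a)`. -/
def cotwistOp (Γ : A →ₗ[ℂ] M₀ B A) : A ⊗[ℂ] B →ₗ[ℂ] B ⊗[ℂ] A :=
  TensorProduct.lift (LinearMap.snd ℂ _ _ ∘ₗ (completedModule B A).subtype ∘ₗ Γ)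

theorem cotwist_tmul (Γ : A →ₗ[ℂ] M₀ B A) (a : A) (b : B) :
    cotwist Γ (a ⊗ₜ b) = (Γ a).right b := rfl

theorem cotwistOp_tmul (Γ : A →ₗ[ℂ] M₀ B A) (a : A) (b : B) :
    cotwistOp Γ (a ⊗ₜ b) = (Γ a).left b := rfl

variable [StarRing B] [StarModule ℂ B]

/-- `Γ : A → M₀(B ⊗ A)` is a left coaction of `B` on `A`.  The identity
`(ι ⊗ Γ)Γ(a) = (Δ_B ⊗ ι)Γ(a)` in `M₀(B ⊗ B ⊗ A)` is expressed by multiplying it from the right by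
the elements `Δ_B(p)(1 ⊗ q)`, which span `B ⊗ B`:
`((ι ⊗ Γ)Γ(a)) (Δ_B(p)(1 ⊗ q) ⊗ 1) = (Δ_B ⊗ ι)(Γ(a)(p ⊗ 1)) (1 ⊗ q ⊗ 1)`. -/
structure IsCoaction (HB : MultiplierHopfStarAlgebra B) (Γ : A →ₗ[ℂ] M₀ B A) : Prop where
  injective : Function.Injective Γ
  coassoc : ∀ (a : A) (p q : B),
    leg23 B (cotwist Γ) (leg12 B (cotwist Γ) (a ⊗ₜ HB.T₁ (p ⊗ₜ q))) =
      leg12 A HB.T₁.toLinearMap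
        ((TensorProduct.mk ℂ B A q).lTensor B (cotwist Γ (a ⊗ₜ p)))

variable [IsScalarTower ℂ A A] [SMulCommClass ℂ A A] [StarRing A] [StarModule ℂ A]

/-- `w = ((ι_A ⊗ T)(Δ_A(a) ⊗ b))(1 ⊗ 1 ⊗ a')` with `w ∈ A ⊗ B ⊗ A`: this is tested by multiplying
from the left by the elements `c ⊗ 1 ⊗ 1`. -/
def IsCotwistRight (HA : MultiplierHopfStarAlgebra A) (Γ : A →ₗ[ℂ] M₀ B A) (a : A) (b : B) (a' : A)
    (w : A ⊗[ℂ] (B ⊗[ℂ] A)) : Prop :=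
  ∀ c : A, (LinearMap.mulLeft ℂ c).rTensor (B ⊗[ℂ] A) w =
    ((LinearMap.mulRight ℂ a').lTensor B).lTensor A
      (leg23 A (cotwist Γ) (TensorProduct.assoc ℂ A A B (HA.T₂ (c ⊗ₜ a) ⊗ₜ b)))

/-- `w = (1 ⊗ 1 ⊗ a')((ι_A ⊗ T)(Δ_A(a) ⊗ b))` with `w ∈ A ⊗ B ⊗ A`. -/
def IsCotwistLeft (HA : MultiplierHopfStarAlgebra A) (Γ : A →ₗ[ℂ] M₀ B A) (a : A) (b : B) (a' : A)
    (w : A ⊗[ℂ] (B ⊗[ℂ] A)) : Prop :=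
  ∀ c : A, (LinearMap.mulLeft ℂ c).rTensor (B ⊗[ℂ] A) w =
    ((LinearMap.mulLeft ℂ a').lTensor B).lTensor A
      (leg23 A (cotwist Γ) (TensorProduct.assoc ℂ A A B (HA.T₂ (c ⊗ₜ a) ⊗ₜ b)))

/-- `A` is a left `B`-comodule coalgebra for `Γ`: `Γ` is a left coaction, the elements
`((ι ⊗ T)(Δ_A(a) ⊗ b))(1 ⊗ 1 ⊗ a')` and `(1 ⊗ 1 ⊗ a')((ι ⊗ T)(Δ_A(a) ⊗ b))` are in `A ⊗ B ⊗ A`, and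
`(ι_B ⊗ Δ_A)T = (T ⊗ ι_A)(ι_A ⊗ T)(Δ_A ⊗ ι_B)`.  The last identity is multiplied from the right by
`1 ⊗ 1 ⊗ a'`, after which both sides are in `B ⊗ A ⊗ A`. -/
structure IsComoduleCoalgebra (HA : MultiplierHopfStarAlgebra A) (HB : MultiplierHopfStarAlgebra B)
    (Γ : A →ₗ[ℂ] M₀ B A) : Prop where
  coaction : IsCoaction HB Γ
  covered_right : ∀ a b a', ∃ w, IsCotwistRight HA Γ a b a' w
  covered_left : ∀ a b a', ∃ w, IsCotwistLeft HA Γ a b a' w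
  comul : ∀ a b a' w, IsCotwistRight HA Γ a b a' w →
    leg12 A (cotwist Γ) w =
      leg23 B HA.T₁.toLinearMap (TensorProduct.assoc ℂ B A A (cotwist Γ (a ⊗ₜ b) ⊗ₜ a'))

end Coaction

/-! ### Compatibility conditions and the smash coproduct -/

section Compat

variable {A : Type*} [NonUnitalRing A] [Module ℂ A] [IsScalarTower ℂ A A] [SMulCommClass ℂ A A]
  [StarRing A] [StarModule ℂ A]
  {B : Type*} [NonUnitalRing B] [Module ℂ B] [IsScalarTower ℂ B B] [SMulCommClass ℂ B B]
  [StarRing B] [StarModule ℂ B]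

/-- The map `P (b ⊗ a) = ∑ ((b ◁ a₍₁₎) ⊗ 1)Γ(a₍₂₎)`, i.e. `P = T^op ∘ R^op`. -/
def mapP (HA : MultiplierHopfStarAlgebra A) (act : B →ₗ[ℂ] A →ₗ[ℂ] B) (Γ : A →ₗ[ℂ] M₀ B A) :
    B ⊗[ℂ] A →ₗ[ℂ] B ⊗[ℂ] A :=
  cotwistOp Γ ∘ₗ twistOp HA act

/-- The compatibility conditions between the action and the coaction. -/
structure IsCompatible (HA : MultiplierHopfStarAlgebra A) (HB : MultiplierHopfStarAlgebra B)
    (act : B →ₗ[ℂ] A →ₗ[ℂ] B) (Γ : A →ₗ[ℂ] M₀ B A) : Prop where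
  /-- `P(ι_B ⊗ m_A) = (ι_B ⊗ m_A)P₁₃P₁₂` on `B ⊗ A ⊗ A` -/
  mul : mapP HA act Γ ∘ₗ (LinearMap.mul' ℂ A).lTensor B =
    (LinearMap.mul' ℂ A).lTensor B ∘ₗ leg13 A (mapP HA act Γ) ∘ₗ leg12 A (mapP HA act Γ)
  /-- `(Δ_B ⊗ ι_A)P = P₂₃P₁₃(Δ_B ⊗ ι_A)` on `B ⊗ A`.  Applied to `q ⊗ a` and multiplied from the
  left by `b ⊗ 1 ⊗ 1`, this reads `((b ⊗ 1)Δ_B ⊗ ι_A)P(q ⊗ a) = P₂₃ w` with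
  `w = (b ⊗ 1 ⊗ 1)P₁₃(Δ_B(q) ⊗ a)` in `B ⊗ B ⊗ A`, which is the element such that
  `w(1 ⊗ c ⊗ 1) = (b ⊗ 1 ⊗ 1)P₁₃(Δ_B(q)(1 ⊗ c) ⊗ a)` for all `c`. -/
  comul : ∀ (b q : B) (a : A), ∃ w : B ⊗[ℂ] (B ⊗[ℂ] A),
    (∀ c : B, ((LinearMap.mulRight ℂ c).rTensor A).lTensor B w =
      (LinearMap.mulLeft ℂ b).rTensor (B ⊗[ℂ] A)
        (leg13 B (mapP HA act Γ) (TensorProduct.assoc ℂ B B A (HB.T₁ (q ⊗ₜ c) ⊗ₜ a)))) ∧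
    leg12 A HB.T₂.toLinearMap (b ⊗ₜ mapP HA act Γ (q ⊗ₜ a)) = leg23 B (mapP HA act Γ) w
  /-- `T ∘ R = T^op ∘ R^op` on `B ⊗ A` -/
  twist_cotwist : cotwist Γ ∘ₗ twist HA act = cotwistOp Γ ∘ₗ twistOp HA act

/-- The element `(b'a' ⊗ 1)∑ (a₍₁₎ ⊗ 1)Γ(a₍₂₎)` of `AB ⊗ A`, as an element of `A ⊗ B ⊗ A`: take
`∑ a'a₍₁₎ ⊗ a₍₂₎` in `A ⊗ A`, move `b'` to the right of `a'a₍₁₎` with `R`, and let it cover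
`Γ(a₍₂₎)`. -/
def coveredΔA (HA : MultiplierHopfStarAlgebra A) (act : B →ₗ[ℂ] A →ₗ[ℂ] B) (Γ : A →ₗ[ℂ] M₀ B A)
    (b' : B) (a' a : A) : A ⊗[ℂ] (B ⊗[ℂ] A) :=
  leg23 A (cotwistOp Γ ∘ₗ (TensorProduct.comm ℂ B A).toLinearMap)
    (leg12 A (twist HA act) (b' ⊗ₜ HA.T₂ (a' ⊗ₜ a)))

/-- The map `c ⊗ p ⊗ d ↦ (cp ⊗ d)Δ_B(b) = ∑ c(p b₍₁₎) ⊗ d b₍₂₎` from `A ⊗ B ⊗ A` to `AB ⊗ AB`. -/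
def mulΔB (HA : MultiplierHopfStarAlgebra A) (HB : MultiplierHopfStarAlgebra B)
    (act : B →ₗ[ℂ] A →ₗ[ℂ] B) (b : B) :
    A ⊗[ℂ] (B ⊗[ℂ] A) →ₗ[ℂ] Smash HA act ⊗[ℂ] Smash HA act :=
  TensorProduct.map (Smash.equiv HA act).toLinearMap (Smash.equiv HA act).toLinearMap ∘ₗ
    (TensorProduct.assoc ℂ A B (A ⊗[ℂ] B)).symm.toLinearMap ∘ₗ
    LinearMap.lTensor A
      ((TensorProduct.comm ℂ B A).toLinearMap.lTensor B ∘ₗ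
        leg12 A HB.T₂.toLinearMap ∘ₗ
        (TensorProduct.mk ℂ B A b).lTensor B)

/-- `D` is the smash coproduct `Δ_# : AB → M(AB ⊗ AB)`,
`Δ_#(ab) = ∑ (a₍₁₎ ⊗ 1)Γ(a₍₂₎)Δ_B(b)`: multiplying this formula from the left by `b'a' ⊗ y`, where
the elements `b'a'` span `AB`, it reads
`(b'a' ⊗ y)Δ_#(ab) = (1 ⊗ y)((b'a' ⊗ 1)∑ (a₍₁₎ ⊗ 1)Γ(a₍₂₎)Δ_B(b))`. -/
def IsSmashCoproduct (HA : MultiplierHopfStarAlgebra A) (HB : MultiplierHopfStarAlgebra B)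
    (act : B →ₗ[ℂ] A →ₗ[ℂ] B) (Γ : A →ₗ[ℂ] M₀ B A)
    (D : Smash HA act →ₗ[ℂ] Mult (Smash HA act ⊗[ℂ] Smash HA act)) : Prop :=
  ∀ (a a' : A) (b b' : B) (y : Smash HA act),
    (D (Smash.ab HA act a b)).R (Smash.ba HA act b' a' ⊗ₜ y) =
      (LinearMap.mulLeft ℂ y).lTensor (Smash HA act)
        (mulΔB HA HB act b (coveredΔA HA act Γ b' a' a))

end Compat

end Bicross

end

set_option linter.unusedSectionVars false

noncomputable section

namespace Bicross

/-! ### Linear algebra -/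

section LinearAlgebra

variable {X Y Z V W : Type*}
  [AddCommGroup X] [Module ℂ X] [AddCommGroup Y] [Module ℂ Y] [AddCommGroup Z] [Module ℂ Z]
  [AddCommGroup V] [Module ℂ V] [AddCommGroup W] [Module ℂ W]

/-! Coproducts are only ever used in covered form: `(e ⊗ 1)Δ(a)`, `Δ(a)(1 ⊗ c)` and their adjoints
lie in `A ⊗ A`, and identities are tested after multiplying by elements which non-degeneracy allows
one to cancel. An element `c ◁ e` of `B` brings its own covering `e`, and such elements span `B`.
The counit and the antipode are chosen by their defining properties, so their existence is proved as
well: coassociativity in terms of `T₁`, `T₂` produces both, and the involution makes `S` a bijection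
of `A`.

(i) The map `R` is bijective, since conjugating it by the flip and the involutions gives its inverse
(`twist_star_twist`); this combines the `*`-condition on the action with `∑ Δ(a₍₁₎)(1 ⊗ S(ea₍₂₎)) =
a ⊗ S(e)`. The rules `R(b ⊗ aa') = R(b ⊗ a)a'` and `R(bb' ⊗ a) = bR(b' ⊗ a)` let `A` and `B` act on
both sides of `AB`, with `x(ab) = (xa)b` and `x(ba) = (xb)a`. Associativity and `(xy)^* = y^*x^*`
follow by moving one factor at a time; non-degeneracy follows from that of `A` and `B` and the
injectivity of `R`.

(ii) Right multiplication by `Δ_#(ab)` is `rhoB b ∘ rhoA a`. Multiplicativity splits into that of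
`rhoA` (first compatibility condition), that of `rhoB`, and the exchange rule `rho_ba`. The latter
is the operator identity `leg23_twist`, obtained from the second condition by cancelling the
injective map `T`.

Left multiplication is defined by `λ(x)u = (ρ(x^*)u^*)^*`, so compatibility with `*` is built in,
and what must be shown is `(uΔ_#(x))v = u(Δ_#(x)v)`. For `x` in `B` this is a property of `Δ_B`. For
`x` in `A` it rests on expressing `P(b' ⊗ g)P(b^* ⊗ h^*)^*` through `Δ(g)(1 ⊗ h)` (`bP_mul_bPt`).
The `*`-condition on `Γ` gives `P(b^* ⊗ S(c)^*)^* = (ι ⊗ S)P(b ⊗ c)`, which turns this into an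
antipode computation (`bP_mul_antipode_bP`). Its inputs are `leg12_cotwist_bP`, where the comodule
coalgebra axiom meets the first and third compatibility conditions, and `(ι ⊗ ε)P(b ⊗ a) = b ◁ a`.

Uniqueness holds because a multiplier of a non-degenerate algebra is determined by its right
multiplication, and the elements `b'a'` span `AB`. -/

/-- In a basis of `V` an element of `X ⊗ V` is a family of coordinates in `X`, and `f i ⊗ ι` acts on
each coordinate separately. -/
theorem rTensor_jointly_injective {ι : Type*} (f : ι → X →ₗ[ℂ] Y)
    (hf : ∀ x, (∀ i, f i x = 0) → x = 0) (z : X ⊗[ℂ] V)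
    (hz : ∀ i, (f i).rTensor V z = 0) : z = 0 := by
  classical
  let b := Module.Basis.ofVectorSpace ℂ V
  have key : ∀ (g : X →ₗ[ℂ] Y) (z : X ⊗[ℂ] V) k,
      g (TensorProduct.equivFinsuppOfBasisRight b z k) =
        TensorProduct.equivFinsuppOfBasisRight b (g.rTensor V z) k := by
    intro g z k
    induction z with
    | zero => simp
    | tmul x v => simp
    | add x y hx hy => simp [hx, hy]
  apply (TensorProduct.equivFinsuppOfBasisRight b (M := X)).injective
  ext k
  rw [map_zero, Finsupp.zero_apply]
  refine hf _ fun i => ?_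
  rw [key, hz, map_zero, Finsupp.zero_apply]

theorem lTensor_jointly_injective {ι : Type*} (f : ι → X →ₗ[ℂ] Y)
    (hf : ∀ x, (∀ i, f i x = 0) → x = 0) (z : V ⊗[ℂ] X)
    (hz : ∀ i, (f i).lTensor V z = 0) : z = 0 := by
  apply (TensorProduct.comm ℂ V X).injective
  rw [map_zero]
  refine rTensor_jointly_injective f hf _ fun i => ?_
  have h : ∀ z : V ⊗[ℂ] X, (f i).rTensor V (TensorProduct.comm ℂ V X z) =
      TensorProduct.comm ℂ V Y ((f i).lTensor V z) := by
    intro z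
    induction z with
    | zero => simp
    | tmul x v => simp
    | add x y hx hy => simp [hx, hy]
  rw [h, hz, map_zero]

/-- A total relation `Φ w = Ψ v` with `Φ` injective is the graph of a linear map. -/
theorem exists_linearMap_of_injective (Φ : W →ₗ[ℂ] Z) (Ψ : V →ₗ[ℂ] Z)
    (hΦ : Function.Injective Φ) (h : ∀ v, ∃ w, Φ w = Ψ v) :
    ∃ f : V →ₗ[ℂ] W, ∀ v, Φ (f v) = Ψ v := by
  choose f hf using h
  refine ⟨⟨⟨f, fun x y => hΦ ?_⟩, fun c x => hΦ ?_⟩, hf⟩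
  · rw [map_add, hf, hf, hf, map_add]
  · simp [hf]

/-- `f ↦ (x ↦ f(x^*)^*)`. -/
def starConj [StarAddMonoid X] [StarModule ℂ X] [StarAddMonoid Y] [StarModule ℂ Y]
    (f : X →ₗ[ℂ] Y) : X →ₗ[ℂ] Y where
  toFun x := star (f (star x))
  map_add' x y := by simp
  map_smul' c x := by simp

theorem starConj_apply [StarAddMonoid X] [StarModule ℂ X] [StarAddMonoid Y] [StarModule ℂ Y]
    (f : X →ₗ[ℂ] Y) (x : X) : starConj f x = star (f (star x)) := rfl

theorem star_rTensor [StarAddMonoid X] [StarModule ℂ X] [StarAddMonoid Y] [StarModule ℂ Y]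
    [StarAddMonoid V] [StarModule ℂ V] (f : X →ₗ[ℂ] Y) (z : X ⊗[ℂ] V) :
    star (f.rTensor V z) = (starConj f).rTensor V (star z) := by
  induction z with
  | zero => simp
  | tmul x v => simp [starConj_apply]
  | add x y hx hy => simp [hx, hy]

theorem star_lTensor [StarAddMonoid X] [StarModule ℂ X] [StarAddMonoid Y] [StarModule ℂ Y]
    [StarAddMonoid V] [StarModule ℂ V] (f : X →ₗ[ℂ] Y) (z : V ⊗[ℂ] X) :
    star (f.lTensor V z) = (starConj f).lTensor V (star z) := by
  induction z with
  | zero => simp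
  | tmul x v => simp [starConj_apply]
  | add x y hx hy => simp [hx, hy]

theorem leg12_tmul (f : X ⊗[ℂ] Y →ₗ[ℂ] Z ⊗[ℂ] W) (x : X) (y : Y) (v : V) :
    leg12 V f (x ⊗ₜ (y ⊗ₜ v)) = TensorProduct.assoc ℂ Z W V (f (x ⊗ₜ y) ⊗ₜ v) := by
  simp [leg12]

theorem leg23_tmul (f : X ⊗[ℂ] Y →ₗ[ℂ] Z ⊗[ℂ] W) (v : V) (z : X ⊗[ℂ] Y) :
    leg23 V f (v ⊗ₜ z) = v ⊗ₜ f z := by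
  simp [leg23]

theorem leg12_tmul' (f : X ⊗[ℂ] Y →ₗ[ℂ] Z ⊗[ℂ] W) (x : X) (z : Y ⊗[ℂ] V) :
    leg12 V f (x ⊗ₜ z) =
      TensorProduct.assoc ℂ Z W V ((TensorProduct.curry f x).rTensor V z) := by
  induction z with
  | zero => simp
  | tmul y v => simp [leg12_tmul]
  | add x y hx hy => simp only [TensorProduct.tmul_add, map_add, hx, hy]

theorem leg12_assoc_tmul (f : X ⊗[ℂ] Y →ₗ[ℂ] Z ⊗[ℂ] W) (z : X ⊗[ℂ] Y) (v : V) :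
    leg12 V f (TensorProduct.assoc ℂ X Y V (z ⊗ₜ v)) =
      TensorProduct.assoc ℂ Z W V (f z ⊗ₜ v) := by
  simp [leg12]

theorem leg23_assoc_tmul (f : X ⊗[ℂ] Y →ₗ[ℂ] Z ⊗[ℂ] W) (z : V ⊗[ℂ] X) (y : Y) :
    leg23 V f (TensorProduct.assoc ℂ V X Y (z ⊗ₜ y)) =
      ((TensorProduct.curry f).flip y).lTensor V z := by
  induction z with
  | zero => simp
  | tmul v x => simp [leg23_tmul]
  | add x y hx hy => simp only [TensorProduct.add_tmul, map_add, hx, hy]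

theorem rTensor_lTensor (f : X →ₗ[ℂ] Z) (g : Y →ₗ[ℂ] W) (z : X ⊗[ℂ] Y) :
    f.rTensor W (g.lTensor X z) = g.lTensor Z (f.rTensor Y z) := by
  induction z with
  | zero => simp
  | tmul x y => simp
  | add x y hx hy => simp only [map_add, hx, hy]

theorem lTensor_lTensor_assoc (g : V →ₗ[ℂ] W) (z : (X ⊗[ℂ] Y) ⊗[ℂ] V) :
    (g.lTensor Y).lTensor X (TensorProduct.assoc ℂ X Y V z) =
      TensorProduct.assoc ℂ X Y W (g.lTensor (X ⊗[ℂ] Y) z) := by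
  induction z with
  | zero => simp
  | add x y hx hy => simp only [map_add, hx, hy]
  | tmul z v =>
    induction z with
    | zero => simp
    | tmul x y => simp
    | add x y hx hy => simp only [TensorProduct.add_tmul, map_add, hx, hy]

theorem rTensor_lTensor_assoc (g : Y →ₗ[ℂ] W) (z : (X ⊗[ℂ] Y) ⊗[ℂ] V) :
    (g.rTensor V).lTensor X (TensorProduct.assoc ℂ X Y V z) =
      TensorProduct.assoc ℂ X W V ((g.lTensor X).rTensor V z) := by
  induction z with
  | zero => simp
  | add x y hx hy => simp only [map_add, hx, hy]
  | tmul z v =>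
    induction z with
    | zero => simp
    | tmul x y => simp
    | add x y hx hy => simp only [TensorProduct.add_tmul, map_add, hx, hy]

theorem rTensor_assoc (g : X →ₗ[ℂ] W) (z : (X ⊗[ℂ] Y) ⊗[ℂ] V) :
    g.rTensor (Y ⊗[ℂ] V) (TensorProduct.assoc ℂ X Y V z) =
      TensorProduct.assoc ℂ W Y V ((g.rTensor Y).rTensor V z) := by
  induction z with
  | zero => simp
  | add x y hx hy => simp only [map_add, hx, hy]
  | tmul z v =>
    induction z with
    | zero => simp
    | tmul x y => simp
    | add x y hx hy => simp only [TensorProduct.add_tmul, map_add, hx, hy]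

end LinearAlgebra

/-! ### Non-degeneracy -/

section Nondegenerate

variable {A : Type*} [NonUnitalRing A] [Module ℂ A] [IsScalarTower ℂ A A] [SMulCommClass ℂ A A]
  [StarRing A] [StarModule ℂ A]

theorem starConj_mulLeft (a : A) :
    starConj (LinearMap.mulLeft ℂ a) = LinearMap.mulRight ℂ (star a) := by
  ext x; simp [starConj_apply]

theorem starConj_mulRight (a : A) :
    starConj (LinearMap.mulRight ℂ a) = LinearMap.mulLeft ℂ (star a) := by
  ext x; simp [starConj_apply]

namespace MultiplierHopfStarAlgebra

variable {V W : Type*} [AddCommGroup V] [Module ℂ V] [AddCommGroup W] [Module ℂ W]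

theorem ext_mulLeft_rTensor (H : MultiplierHopfStarAlgebra A) {z z' : A ⊗[ℂ] V}
    (h : ∀ a : A, (LinearMap.mulLeft ℂ a).rTensor V z = (LinearMap.mulLeft ℂ a).rTensor V z') :
    z = z' :=
  sub_eq_zero.1 (rTensor_jointly_injective (fun a : A => LinearMap.mulLeft ℂ a)
    (fun x hx => H.nondegenerate_right x hx) _ fun a => by rw [map_sub, h, sub_self])

theorem ext_mulRight_rTensor (H : MultiplierHopfStarAlgebra A) {z z' : A ⊗[ℂ] V}
    (h : ∀ a : A, (LinearMap.mulRight ℂ a).rTensor V z = (LinearMap.mulRight ℂ a).rTensor V z') :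
    z = z' :=
  sub_eq_zero.1 (rTensor_jointly_injective (fun a : A => LinearMap.mulRight ℂ a)
    (fun x hx => H.nondegenerate_left x hx) _ fun a => by rw [map_sub, h, sub_self])

theorem ext_mulLeft_lTensor (H : MultiplierHopfStarAlgebra A) {z z' : V ⊗[ℂ] A}
    (h : ∀ a : A, (LinearMap.mulLeft ℂ a).lTensor V z = (LinearMap.mulLeft ℂ a).lTensor V z') :
    z = z' :=
  sub_eq_zero.1 (lTensor_jointly_injective (fun a : A => LinearMap.mulLeft ℂ a)
    (fun x hx => H.nondegenerate_right x hx) _ fun a => by rw [map_sub, h, sub_self])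

theorem ext_mulRight_lTensor (H : MultiplierHopfStarAlgebra A) {z z' : V ⊗[ℂ] A}
    (h : ∀ a : A, (LinearMap.mulRight ℂ a).lTensor V z = (LinearMap.mulRight ℂ a).lTensor V z') :
    z = z' :=
  sub_eq_zero.1 (lTensor_jointly_injective (fun a : A => LinearMap.mulRight ℂ a)
    (fun x hx => H.nondegenerate_left x hx) _ fun a => by rw [map_sub, h, sub_self])

/-- Equality in `V ⊗ (W ⊗ A)` is tested by multiplication from the right in the last leg. -/
theorem ext_mulRight_lTensor_lTensor (H : MultiplierHopfStarAlgebra A) {z z' : V ⊗[ℂ] (W ⊗[ℂ] A)}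
    (h : ∀ a : A, ((LinearMap.mulRight ℂ a).lTensor W).lTensor V z =
      ((LinearMap.mulRight ℂ a).lTensor W).lTensor V z') : z = z' :=
  sub_eq_zero.1 (lTensor_jointly_injective (fun a : A => (LinearMap.mulRight ℂ a).lTensor W)
    (fun x hx => H.ext_mulRight_lTensor (by simpa using hx)) _ fun a => by
      rw [map_sub, h, sub_self])

/-- Equality in `V ⊗ (A ⊗ W)` is tested by multiplication from the right in the middle leg. -/
theorem ext_mulRight_rTensor_lTensor (H : MultiplierHopfStarAlgebra A) {z z' : V ⊗[ℂ] (A ⊗[ℂ] W)}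
    (h : ∀ a : A, ((LinearMap.mulRight ℂ a).rTensor W).lTensor V z =
      ((LinearMap.mulRight ℂ a).rTensor W).lTensor V z') : z = z' :=
  sub_eq_zero.1 (lTensor_jointly_injective (fun a : A => (LinearMap.mulRight ℂ a).rTensor W)
    (fun x hx => H.ext_mulRight_rTensor (by simpa using hx)) _ fun a => by
      rw [map_sub, h, sub_self])

theorem tmul_mul (a b : A) (z : A ⊗[ℂ] A) : (a ⊗ₜ b) * z =
    (LinearMap.mulLeft ℂ a).rTensor A ((LinearMap.mulLeft ℂ b).lTensor A z) := by
  induction z with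
  | zero => simp
  | tmul x y => simp
  | add x y hx hy => simp only [mul_add, map_add, hx, hy]

theorem mul_tmul (a b : A) (z : A ⊗[ℂ] A) : z * (a ⊗ₜ b) =
    (LinearMap.mulRight ℂ a).rTensor A ((LinearMap.mulRight ℂ b).lTensor A z) := by
  induction z with
  | zero => simp
  | tmul x y => simp
  | add x y hx hy => simp only [add_mul, map_add, hx, hy]

theorem ext_mul_left (H : MultiplierHopfStarAlgebra A) {z z' : A ⊗[ℂ] A}
    (h : ∀ x : A ⊗[ℂ] A, x * z = x * z') : z = z' :=
  H.ext_mulLeft_lTensor fun b => H.ext_mulLeft_rTensor fun a => by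
    rw [← tmul_mul, ← tmul_mul, h]

theorem ext_mul_right (H : MultiplierHopfStarAlgebra A) {z z' : A ⊗[ℂ] A}
    (h : ∀ x : A ⊗[ℂ] A, z * x = z' * x) : z = z' :=
  H.ext_mulRight_lTensor fun b => H.ext_mulRight_rTensor fun a => by
    rw [← mul_tmul, ← mul_tmul, h]

/-! ### Covered coproducts -/

variable (H : MultiplierHopfStarAlgebra A)

/-- `l₁ e a = (e ⊗ 1)Δ(a)`. -/
def l₁ : A →ₗ[ℂ] A →ₗ[ℂ] A ⊗[ℂ] A := TensorProduct.curry H.T₂.toLinearMap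

/-- `r₂ c a = Δ(a)(1 ⊗ c)`. -/
def r₂ : A →ₗ[ℂ] A →ₗ[ℂ] A ⊗[ℂ] A := (TensorProduct.curry H.T₁.toLinearMap).flip

/-- `l₂ f a = (1 ⊗ f)Δ(a)`. -/
def l₂ : A →ₗ[ℂ] A →ₗ[ℂ] A ⊗[ℂ] A := (TensorProduct.curry (starConj H.T₁.toLinearMap)).flip

/-- `r₁ c a = Δ(a)(c ⊗ 1)`. -/
def r₁ : A →ₗ[ℂ] A →ₗ[ℂ] A ⊗[ℂ] A := TensorProduct.curry (starConj H.T₂.toLinearMap)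

theorem l₁_apply (e a : A) : H.l₁ e a = H.T₂ (e ⊗ₜ a) := rfl
theorem r₂_apply (c a : A) : H.r₂ c a = H.T₁ (a ⊗ₜ c) := rfl
theorem l₂_apply (f a : A) : H.l₂ f a = starConj H.T₁.toLinearMap (a ⊗ₜ f) := rfl
theorem r₁_apply (c a : A) : H.r₁ c a = starConj H.T₂.toLinearMap (c ⊗ₜ a) := rfl

theorem star_l₁ (e a : A) : star (H.l₁ e a) = H.r₁ (star e) (star a) := by
  simp [l₁_apply, r₁_apply, starConj_apply]

theorem star_r₁ (e a : A) : star (H.r₁ e a) = H.l₁ (star e) (star a) := by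
  simp [l₁_apply, r₁_apply, starConj_apply]

theorem star_l₂ (e a : A) : star (H.l₂ e a) = H.r₂ (star e) (star a) := by
  simp [l₂_apply, r₂_apply, starConj_apply]

theorem star_r₂ (e a : A) : star (H.r₂ e a) = H.l₂ (star e) (star a) := by
  simp [l₂_apply, r₂_apply, starConj_apply]

theorem Δ_R_mul (a : A) (x y : A ⊗[ℂ] A) : (H.Δ a).R x * y = x * (H.Δ a).L y := (H.Δ a).2 x y

/-- Multipliers are only required to satisfy `ρ(x)y = xλ(y)`; the module property of `ρ` is
recovered by testing against right products. -/
theorem Δ_R_mul_left (a : A) (x y : A ⊗[ℂ] A) : (H.Δ a).R (x * y) = x * (H.Δ a).R y :=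
  H.ext_mul_right fun z => by rw [Δ_R_mul, mul_assoc, mul_assoc, Δ_R_mul]

theorem Δ_L_mul_right (a : A) (x y : A ⊗[ℂ] A) : (H.Δ a).L (x * y) = (H.Δ a).L x * y :=
  H.ext_mul_left fun z => by rw [← Δ_R_mul, ← mul_assoc, ← mul_assoc, Δ_R_mul]

theorem mul_lTensor_mul (q : A) (x y : A ⊗[ℂ] A) :
    (LinearMap.mulRight ℂ q).lTensor A x * y = x * (LinearMap.mulLeft ℂ q).lTensor A y := by
  induction x with
  | zero => simp
  | add x x' hx hx' => simp only [add_mul, map_add, hx, hx']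
  | tmul a b =>
    induction y with
    | zero => simp
    | tmul c d => simp [mul_assoc]
    | add x y hx hy => simp only [mul_add, map_add, hx, hy]

theorem mul_rTensor_mul (q : A) (x y : A ⊗[ℂ] A) :
    (LinearMap.mulRight ℂ q).rTensor A x * y = x * (LinearMap.mulLeft ℂ q).rTensor A y := by
  induction x with
  | zero => simp
  | add x x' hx hx' => simp only [add_mul, map_add, hx, hx']
  | tmul a b =>
    induction y with
    | zero => simp
    | tmul c d => simp [mul_assoc]
    | add x y hx hy => simp only [mul_add, map_add, hx, hy]

/-- `T₂_spec` describes `(p ⊗ 1)Δ(a)` only inside products; non-degeneracy removes the extra factor.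
With this lemma and its three companions below, `Δ` is used almost entirely through `l₁`, `l₂`,
`r₁`, `r₂`. -/
theorem Δ_R_tmul (a p q : A) :
    (H.Δ a).R (p ⊗ₜ q) = (LinearMap.mulLeft ℂ q).lTensor A (H.l₁ p a) :=
  H.ext_mul_left fun x => by
    rw [← Δ_R_mul_left, ← mul_lTensor_mul, l₁_apply, H.T₂_spec, mul_tmul]

theorem Δ_L_tmul (a p q : A) :
    (H.Δ a).L (p ⊗ₜ q) = (LinearMap.mulRight ℂ p).rTensor A (H.r₂ q a) :=
  H.ext_mul_right fun x => by
    rw [← Δ_L_mul_right, mul_rTensor_mul, r₂_apply, H.T₁_spec, tmul_mul, rTensor_lTensor]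

theorem Δ_star_L (a : A) (x : A ⊗[ℂ] A) : (H.Δ (star a)).L x = star ((H.Δ a).R (star x)) :=
  (H.Δ_star a x).1

theorem Δ_star_R (a : A) (x : A ⊗[ℂ] A) : (H.Δ (star a)).R x = star ((H.Δ a).L (star x)) :=
  (H.Δ_star a x).2

/-- The adjoint of `Δ_L_tmul`; here the `*`-structure supplies the coverings `(1 ⊗ q)Δ(a)` that the
axioms do not list. -/
theorem Δ_R_tmul' (a p q : A) :
    (H.Δ a).R (p ⊗ₜ q) = (LinearMap.mulLeft ℂ p).rTensor A (H.l₂ q a) := by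
  have h := H.Δ_star_R (star a) (p ⊗ₜ q)
  rwa [star_star, TensorProduct.star_tmul, Δ_L_tmul, star_rTensor, starConj_mulRight, star_r₂,
    star_star, star_star, star_star] at h

theorem Δ_L_tmul' (a p q : A) :
    (H.Δ a).L (p ⊗ₜ q) = (LinearMap.mulRight ℂ q).lTensor A (H.r₁ p a) := by
  have h := H.Δ_star_L (star a) (p ⊗ₜ q)
  rwa [star_star, TensorProduct.star_tmul, Δ_R_tmul, star_lTensor, starConj_mulLeft, star_l₁,
    star_star, star_star, star_star] at h

/-- `(1 ⊗ q)((p ⊗ 1)Δ(a)) = (p ⊗ 1)((1 ⊗ q)Δ(a))` -/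
theorem mulLeft_l₁ (p q a : A) : (LinearMap.mulLeft ℂ q).lTensor A (H.l₁ p a) =
    (LinearMap.mulLeft ℂ p).rTensor A (H.l₂ q a) := by
  rw [← Δ_R_tmul, Δ_R_tmul']

theorem mulRight_r₁ (p q a : A) : (LinearMap.mulRight ℂ q).lTensor A (H.r₁ p a) =
    (LinearMap.mulRight ℂ p).rTensor A (H.r₂ q a) := by
  rw [← Δ_L_tmul, Δ_L_tmul']

/-- Both sides are `(p ⊗ 1)Δ(a)(1 ⊗ q)`; the equality is the defining relation of the multiplier
`Δ(a)`, tested on both sides. -/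
theorem mulLeft_r₂ (p q a : A) : (LinearMap.mulLeft ℂ p).rTensor A (H.r₂ q a) =
    (LinearMap.mulRight ℂ q).lTensor A (H.l₁ p a) := by
  refine H.ext_mul_left fun x => H.ext_mul_right fun y => ?_
  rw [← mul_rTensor_mul, mul_assoc, r₂_apply, T₁_spec, mul_assoc, mul_lTensor_mul, l₁_apply,
    ← mul_assoc, T₂_spec, Δ_R_mul]

theorem mulLeft_r₂' (q c a : A) : (LinearMap.mulLeft ℂ q).lTensor A (H.r₂ c a) =
    (LinearMap.mulRight ℂ c).lTensor A (H.l₂ q a) := by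
  refine H.ext_mulLeft_rTensor fun p => ?_
  rw [rTensor_lTensor, mulLeft_r₂, rTensor_lTensor, ← mulLeft_l₁,
    ← LinearMap.lTensor_comp_apply, ← LinearMap.lTensor_comp_apply]
  congr 2
  ext x
  simp [mul_assoc]

theorem mulLeft_r₁' (p c a : A) : (LinearMap.mulLeft ℂ p).rTensor A (H.r₁ c a) =
    (LinearMap.mulRight ℂ c).rTensor A (H.l₁ p a) := by
  refine H.ext_mulRight_lTensor fun q => ?_
  rw [← rTensor_lTensor, mulRight_r₁, ← rTensor_lTensor, ← mulLeft_r₂,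
    ← LinearMap.rTensor_comp_apply, ← LinearMap.rTensor_comp_apply]
  congr 2
  ext x
  simp [mul_assoc]

theorem l₁_mul (e a b : A) : H.l₁ e (a * b) = (H.Δ b).R (H.l₁ e a) := by
  refine H.ext_mul_left fun x => ?_
  rw [← Δ_R_mul_left, l₁_apply, l₁_apply, T₂_spec, T₂_spec, H.Δ_mul]
  rfl

theorem r₂_mul (c a b : A) : H.r₂ c (a * b) = (H.Δ a).L (H.r₂ c b) := by
  refine H.ext_mul_right fun x => ?_
  rw [← Δ_L_mul_right, r₂_apply, r₂_apply, T₁_spec, T₁_spec, H.Δ_mul]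
  rfl

theorem l₂_mul (e a b : A) : H.l₂ e (a * b) = (H.Δ b).R (H.l₂ e a) := by
  have h := congrArg star (H.r₂_mul (star e) (star b) (star a))
  rw [Δ_star_L, star_star, star_r₂, star_r₂, star_star, ← star_mul, star_star, star_star] at h
  exact h

/-! ### Coassociativity -/

/-- `(e ⊗ 1 ⊗ 1)(Δ ⊗ ι)(Δ(a)(1 ⊗ c)) = (ι ⊗ Δ)((e ⊗ 1)Δ(a))(1 ⊗ 1 ⊗ c)` -/
theorem coassoc_l₁_r₂ (e c a : A) :
    TensorProduct.assoc ℂ A A A ((H.l₁ e).rTensor A (H.r₂ c a)) =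
      (H.r₂ c).lTensor A (H.l₁ e a) := by
  have h := LinearMap.congr_fun H.coassoc (e ⊗ₜ (a ⊗ₜ c))
  simp only [LinearMap.comp_apply, leg23_tmul, leg12_tmul] at h
  rw [leg12_tmul', leg23_assoc_tmul] at h
  exact h

/-- `(e ⊗ 1 ⊗ 1)(Δ ⊗ ι)((1 ⊗ f)Δ(a)) = (1 ⊗ 1 ⊗ f)(ι ⊗ Δ)((e ⊗ 1)Δ(a))` -/
theorem coassoc_l₁_l₂ (e f a : A) :
    TensorProduct.assoc ℂ A A A ((H.l₁ e).rTensor A (H.l₂ f a)) =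
      (H.l₂ f).lTensor A (H.l₁ e a) := by
  -- A factor `c` in the last leg turns `(1 ⊗ f)Δ` into `(1 ⊗ f)(Δ(·)(1 ⊗ c))`, for which
  -- coassociativity is an axiom.
  refine H.ext_mulRight_lTensor_lTensor fun c => ?_
  rw [lTensor_lTensor_assoc, ← rTensor_lTensor, ← mulLeft_r₂', rTensor_lTensor,
    ← lTensor_lTensor_assoc, coassoc_l₁_r₂, ← LinearMap.lTensor_comp_apply,
    ← LinearMap.lTensor_comp_apply]
  congr 2
  ext x : 1
  simp only [LinearMap.comp_apply]
  rw [mulLeft_r₂']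

end MultiplierHopfStarAlgebra

end Nondegenerate

end Bicross
end

noncomputable section

namespace Bicross

/-! ### Injectivity and surjectivity of leg maps, cancellation of a tensor factor. -/

section Legs

variable {X Y Z V W : Type*}
  [AddCommGroup X] [Module ℂ X] [AddCommGroup Y] [Module ℂ Y] [AddCommGroup Z] [Module ℂ Z]
  [AddCommGroup V] [Module ℂ V] [AddCommGroup W] [Module ℂ W]

theorem leg12_surjective {f : X ⊗[ℂ] Y →ₗ[ℂ] Z ⊗[ℂ] W} (hf : Function.Surjective f) :
    Function.Surjective (leg12 V f) := by
  have h := LinearMap.rTensor_surjective V hf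
  exact ((TensorProduct.assoc ℂ Z W V).surjective.comp h).comp
    (TensorProduct.assoc ℂ X Y V).symm.surjective

theorem leg23_surjective {f : X ⊗[ℂ] Y →ₗ[ℂ] Z ⊗[ℂ] W} (hf : Function.Surjective f) :
    Function.Surjective (leg23 V f) :=
  LinearMap.lTensor_surjective V hf

theorem leg12_injective {f : X ⊗[ℂ] Y →ₗ[ℂ] Z ⊗[ℂ] W} (hf : Function.Injective f) :
    Function.Injective (leg12 V f) := by
  have h := Module.Flat.rTensor_preserves_injective_linearMap (M := V) f hf
  exact ((TensorProduct.assoc ℂ Z W V).injective.comp h).comp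
    (TensorProduct.assoc ℂ X Y V).symm.injective

theorem leg23_injective {f : X ⊗[ℂ] Y →ₗ[ℂ] Z ⊗[ℂ] W} (hf : Function.Injective f) :
    Function.Injective (leg23 V f) :=
  Module.Flat.lTensor_preserves_injective_linearMap (M := V) f hf

theorem tmul_right_cancel {x y : X} {v : V} (hv : v ≠ 0) (h : x ⊗ₜ[ℂ] v = y ⊗ₜ v) : x = y := by
  obtain ⟨f, hf⟩ : ∃ f : Module.Dual ℂ V, f v ≠ 0 := by
    by_contra! hc
    exact hv ((Module.forall_dual_apply_eq_zero_iff ℂ v).1 hc)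
  have h' := congrArg (fun z => TensorProduct.rid ℂ X (f.lTensor X z)) h
  simpa [hf] using h'

theorem tmul_left_cancel {x y : X} {v : V} (hv : v ≠ 0) (h : v ⊗ₜ[ℂ] x = v ⊗ₜ y) : x = y :=
  tmul_right_cancel hv (by simpa using congrArg (TensorProduct.comm ℂ V X) h)

end Legs

namespace MultiplierHopfStarAlgebra

variable {A : Type*} [NonUnitalRing A] [Module ℂ A] [IsScalarTower ℂ A A] [SMulCommClass ℂ A A]
  [StarRing A] [StarModule ℂ A] (H : MultiplierHopfStarAlgebra A)

/-! ### The counit -/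

/-- For `z = T₂(a ⊗ b)` and `b ⊗ c = T₁ u`, coassociativity rewrites `z ⊗ c` as `T₁` in legs 2, 3
applied to `T₂` in legs 1, 2. Undoing `T₁` and multiplying legs 2 and 3 leaves `(a ⊗ 1)T₁ u = ab ⊗
c`. Comparing the two sides shows that `m T₁⁻¹(b ⊗ c)` is a scalar multiple of `c`, and this scalar
is the counit. -/
theorem mul_T₂_symm_tmul (z : A ⊗[ℂ] A) (c : A) :
    (LinearMap.mul' ℂ A ∘ₗ H.T₁.symm.toLinearMap).lTensor A (TensorProduct.assoc ℂ A A A (z ⊗ₜ c)) =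
      (LinearMap.mul' ℂ A (H.T₂.symm z)) ⊗ₜ c := by
  obtain ⟨u, rfl⟩ := H.T₂.surjective z
  induction u with
  | zero => simp
  | add x y hx hy => simp only [map_add, TensorProduct.add_tmul, hx, hy]
  | tmul a b =>
    obtain ⟨u, hu⟩ := H.T₁.surjective (b ⊗ₜ c)
    have h := LinearMap.congr_fun H.coassoc (a ⊗ₜ u)
    simp only [LinearMap.comp_apply, leg23_tmul, LinearEquiv.coe_coe, hu, leg12_tmul] at h
    have h1 : H.T₁.symm.toLinearMap ∘ₗ H.T₁.toLinearMap = LinearMap.id := by ext x <;> simp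
    rw [h, leg23, ← LinearMap.lTensor_comp_apply, LinearMap.comp_assoc, h1, LinearMap.comp_id,
      LinearEquiv.symm_apply_apply, LinearMap.mul'_apply]
    have h2 : (LinearMap.mul' ℂ A).lTensor A (leg12 A H.T₂.toLinearMap (a ⊗ₜ u)) =
        (LinearMap.mulLeft ℂ a).rTensor A (H.T₁ u) := by
      clear hu h
      induction u with
      | zero => simp
      | add x y hx hy => simp only [map_add, TensorProduct.tmul_add, hx, hy]
      | tmul p q =>
        have h3 := H.mulLeft_r₂ a q p
        rw [r₂_apply, l₁_apply] at h3
        rw [h3, leg12_tmul]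
        generalize hz : H.T₂ (a ⊗ₜ p) = z
        clear hz h3
        induction z with
        | zero => simp
        | add x y hx hy => simp only [map_add, TensorProduct.add_tmul, hx, hy]
        | tmul x y => simp
    rw [h2, hu]
    simp

/-- The mirror image of `mul_T₂_symm_tmul`; once `m T₂⁻¹(a ⊗ b) = ε(b)a` is known, it becomes the
left counit identity. -/
theorem mul_T₂_symm_T₁ (a b c : A) :
    (LinearMap.mul' ℂ A ∘ₗ H.T₂.symm.toLinearMap).rTensor A
      ((TensorProduct.assoc ℂ A A A).symm (a ⊗ₜ H.T₁ (b ⊗ₜ c))) = a ⊗ₜ (b * c) := by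
  obtain ⟨u, hu⟩ := H.T₂.surjective (a ⊗ₜ b)
  have h := LinearMap.congr_fun H.coassoc (TensorProduct.assoc ℂ A A A (u ⊗ₜ c))
  simp only [LinearMap.comp_apply] at h
  rw [leg12_assoc_tmul, LinearEquiv.coe_coe, hu, TensorProduct.assoc_tmul, leg23_tmul,
    LinearEquiv.coe_coe] at h
  have h1 : H.T₂.symm.toLinearMap ∘ₗ H.T₂.toLinearMap = LinearMap.id := by ext x <;> simp
  rw [← h, leg12, LinearMap.comp_apply, LinearMap.comp_apply, LinearEquiv.coe_coe,
    LinearEquiv.coe_coe, LinearEquiv.symm_apply_apply, ← LinearMap.rTensor_comp_apply,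
    LinearMap.comp_assoc, h1, LinearMap.comp_id]
  have h2 : (LinearMap.mul' ℂ A).rTensor A ((TensorProduct.assoc ℂ A A A).symm
      (leg23 A H.T₁.toLinearMap (TensorProduct.assoc ℂ A A A (u ⊗ₜ c)))) =
      (LinearMap.mulRight ℂ c).lTensor A (H.T₂ u) := by
    clear hu h
    induction u with
    | zero => simp
    | add x y hx hy => simp only [map_add, TensorProduct.add_tmul, hx, hy]
    | tmul p q =>
      have h3 := H.mulLeft_r₂ p c q
      rw [r₂_apply, l₁_apply] at h3
      rw [← h3, TensorProduct.assoc_tmul, leg23_tmul, LinearEquiv.coe_coe]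
      generalize H.T₁ (q ⊗ₜ c) = z
      induction z with
      | zero => simp
      | add x y hx hy => simp only [map_add, TensorProduct.tmul_add, hx, hy]
      | tmul x y => simp
  rw [h2, hu]
  simp

theorem exists_isCounit : ∃ ε, H.IsCounit ε := by
  have key : ∀ a b c : A, a ⊗ₜ[ℂ] (LinearMap.mul' ℂ A (H.T₁.symm (b ⊗ₜ c))) =
      (LinearMap.mul' ℂ A (H.T₂.symm (a ⊗ₜ b))) ⊗ₜ c := by
    intro a b c
    rw [← mul_T₂_symm_tmul]
    simp
  by_cases hA : ∀ a : A, a = 0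
  · exact ⟨0, fun a b => ⟨(hA _).trans (hA _).symm, (hA _).trans (hA _).symm⟩⟩
  push Not at hA
  obtain ⟨a₀, ha₀⟩ := hA
  obtain ⟨f, hf⟩ : ∃ f : Module.Dual ℂ A, f a₀ ≠ 0 := by
    by_contra! hc
    exact ha₀ ((Module.forall_dual_apply_eq_zero_iff ℂ a₀).1 hc)
  -- In `a₀ ⊗ m T₁⁻¹(b ⊗ c) = m T₂⁻¹(a₀ ⊗ b) ⊗ c` the functional `f` strips off the first factor;
  -- dividing by `f a₀` normalises. The zero algebra has no such `a₀` and was treated apart.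
  let ε : A →ₗ[ℂ] ℂ := (f a₀)⁻¹ • (f ∘ₗ LinearMap.mul' ℂ A ∘ₗ H.T₂.symm.toLinearMap ∘ₗ
    TensorProduct.mk ℂ A A a₀)
  have hE : ∀ b c, LinearMap.mul' ℂ A (H.T₁.symm (b ⊗ₜ c)) = ε b • c := by
    intro b c
    have h := congrArg (fun z => TensorProduct.lid ℂ A (f.rTensor A z)) (key a₀ b c)
    simp only [LinearMap.rTensor_tmul, TensorProduct.lid_tmul] at h
    simp only [ε, LinearMap.smul_apply, LinearMap.comp_apply, LinearEquiv.coe_coe,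
      TensorProduct.mk_apply, smul_eq_mul, mul_smul]
    rw [← h, smul_smul, inv_mul_cancel₀ hf, one_smul]
  have hF : ∀ a b, LinearMap.mul' ℂ A (H.T₂.symm (a ⊗ₜ b)) = ε b • a := by
    intro a b
    refine tmul_right_cancel ha₀ ?_
    rw [← key, hE, TensorProduct.tmul_smul, TensorProduct.smul_tmul']
  refine ⟨ε, fun a b => ⟨?_, ?_⟩⟩
  · refine tmul_left_cancel ha₀ ?_
    rw [← mul_T₂_symm_T₁]
    generalize H.T₁ (a ⊗ₜ b) = z
    induction z with
    | zero => simp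
    | add x y hx hy => simp only [map_add, TensorProduct.tmul_add, hx, hy]
    | tmul x y => simp [hF, TensorProduct.smul_tmul]
  · refine tmul_right_cancel ha₀ ?_
    have h := H.mul_T₂_symm_tmul (H.T₂ (a ⊗ₜ b)) a₀
    rw [LinearEquiv.symm_apply_apply, LinearMap.mul'_apply] at h
    rw [← h]
    generalize H.T₂ (a ⊗ₜ b) = z
    induction z with
    | zero => simp
    | add x y hx hy => simp only [map_add, TensorProduct.add_tmul, hx, hy]
    | tmul x y => simp [hE, TensorProduct.smul_tmul]

theorem isCounit_counit : H.IsCounit H.counit := Classical.epsilon_spec H.exists_isCounit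

/-- `ε ⊗ ι` -/
def counit₁ (V : Type*) [AddCommGroup V] [Module ℂ V] : A ⊗[ℂ] V →ₗ[ℂ] V :=
  (TensorProduct.lid ℂ V).toLinearMap ∘ₗ H.counit.rTensor V

/-- `ι ⊗ ε` -/
def counit₂ (V : Type*) [AddCommGroup V] [Module ℂ V] : V ⊗[ℂ] A →ₗ[ℂ] V :=
  (TensorProduct.rid ℂ V).toLinearMap ∘ₗ H.counit.lTensor V

section

variable {V W : Type*} [AddCommGroup V] [Module ℂ V] [AddCommGroup W] [Module ℂ W]

@[simp] theorem counit₁_tmul (a : A) (v : V) : H.counit₁ V (a ⊗ₜ v) = H.counit a • v := by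
  simp [counit₁]

@[simp] theorem counit₂_tmul (a : A) (v : V) : H.counit₂ V (v ⊗ₜ a) = H.counit a • v := by
  simp [counit₂]

theorem counit₁_lTensor (f : V →ₗ[ℂ] W) (z : A ⊗[ℂ] V) :
    H.counit₁ W (f.lTensor A z) = f (H.counit₁ V z) := by
  induction z with
  | zero => simp
  | tmul x y => simp
  | add x y hx hy => simp only [map_add, hx, hy]

end

theorem counit₁_r₂ (c a : A) : H.counit₁ A (H.r₂ c a) = a * c := (H.isCounit_counit a c).1

theorem counit₂_l₁ (e a : A) : H.counit₂ A (H.l₁ e a) = e * a := (H.isCounit_counit e a).2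

theorem counit₁_T₁ (z : A ⊗[ℂ] A) : H.counit₁ A (H.T₁ z) = LinearMap.mul' ℂ A z := by
  induction z with
  | zero => simp
  | tmul x y => exact H.counit₁_r₂ y x
  | add x y hx hy => simp only [map_add, hx, hy]

theorem counit₂_T₂ (z : A ⊗[ℂ] A) : H.counit₂ A (H.T₂ z) = LinearMap.mul' ℂ A z := by
  induction z with
  | zero => simp
  | tmul x y => exact H.counit₂_l₁ x y
  | add x y hx hy => simp only [map_add, hx, hy]

theorem counit₁_l₂ (f a : A) : H.counit₁ A (H.l₂ f a) = f * a := by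
  have h : ∀ c, H.counit₁ A (H.l₂ f a) * c = f * a * c := by
    intro c
    have h1 := H.counit₁_lTensor (LinearMap.mulRight ℂ c) (H.l₂ f a)
    rw [← mulLeft_r₂', counit₁_lTensor, counit₁_r₂] at h1
    simpa [mul_assoc] using h1.symm
  exact sub_eq_zero.1 (H.nondegenerate_left _ fun c => by rw [sub_mul, h, sub_self])

/-- If `ε` vanished, then `xb = (ε ⊗ ι)(Δ(x)(1 ⊗ b))` would vanish for all `b`. The nonzero `x` only
rules out the zero algebra. -/
theorem exists_counit_eq_one (x : A) (hx : x ≠ 0) : ∃ a, H.counit a = 1 := by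
  by_contra! hc
  have h0 : ∀ a, H.counit a = 0 := by
    intro a
    by_contra ha
    exact hc ((H.counit a)⁻¹ • a) (by rw [map_smul, smul_eq_mul, inv_mul_cancel₀ ha])
  refine hx (H.nondegenerate_left x fun b => ?_)
  rw [← counit₁_r₂]
  generalize H.r₂ b x = z
  induction z with
  | zero => simp
  | tmul x y => simp [h0]
  | add x y hx hy => simp only [map_add, hx, hy, add_zero]

theorem counit₁_surjective (b : A) : ∃ z, H.counit₁ A z = b := by
  by_cases hb : b = 0
  · exact ⟨0, by simp [hb]⟩
  · obtain ⟨a, ha⟩ := H.exists_counit_eq_one b hb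
    exact ⟨a ⊗ₜ b, by simp [ha]⟩

theorem counit₂_surjective (b : A) : ∃ z, H.counit₂ A z = b := by
  by_cases hb : b = 0
  · exact ⟨0, by simp [hb]⟩
  · obtain ⟨a, ha⟩ := H.exists_counit_eq_one b hb
    exact ⟨b ⊗ₜ a, by simp [ha]⟩

/-- `A` is spanned by products. -/
theorem mul'_surjective (H : MultiplierHopfStarAlgebra A) (b : A) : ∃ z, LinearMap.mul' ℂ A z = b := by
  obtain ⟨z, hz⟩ := H.counit₁_surjective b
  exact ⟨H.T₁.symm z, by rw [← counit₁_T₁, LinearEquiv.apply_symm_apply, hz]⟩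

theorem counit₁_Δ_L (a : A) (w : A ⊗[ℂ] A) :
    H.counit₁ A ((H.Δ a).L w) = a * H.counit₁ A w := by
  obtain ⟨u, rfl⟩ := H.T₁.surjective w
  induction u with
  | zero => simp
  | add x y hx hy => simp only [map_add, mul_add, hx, hy]
  | tmul b c =>
    rw [← r₂_apply, ← r₂_mul, counit₁_r₂, counit₁_r₂, mul_assoc]

/-- Applied to `T₁(x ⊗ y)(b ⊗ 1) = Δ(x)(b ⊗ y)`, `ε ⊗ ι` gives `ε(b)xy`, and the elements `T₁(x ⊗
y)` span `A ⊗ A`. -/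
theorem counit_mul (a b : A) : H.counit (a * b) = H.counit a * H.counit b := by
  have h : ∀ z : A ⊗[ℂ] A, H.counit₁ A ((LinearMap.mulRight ℂ b).rTensor A z) =
      H.counit b • H.counit₁ A z := by
    intro z
    obtain ⟨u, rfl⟩ := H.T₁.surjective z
    induction u with
    | zero => simp
    | add x y hx hy => simp only [map_add, smul_add, hx, hy]
    | tmul x y =>
      rw [← r₂_apply, ← Δ_L_tmul, counit₁_Δ_L, counit₁_r₂]
      simp [mul_smul_comm]
  by_cases ha : a = 0
  · simp [ha]
  · have h1 := h (a ⊗ₜ a)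
    simp only [LinearMap.rTensor_tmul, counit₁_tmul, LinearMap.mulRight_apply, smul_smul] at h1
    rw [smul_left_injective ℂ ha h1, mul_comm]

theorem starConj_T₁_surjective : Function.Surjective (starConj H.T₁.toLinearMap) := fun z =>
  ⟨star (H.T₁.symm (star z)), by simp [starConj_apply]⟩

/-- Both `ε` and `x ↦ ε(x^*)^*` send `(1 ⊗ f)Δ(a)` to `fa` in the first leg, and these elements span
`A ⊗ A`. -/
theorem counit_star (a : A) : H.counit (star a) = star (H.counit a) := by
  have hs : ∀ z : A ⊗[ℂ] A, star (H.counit₁ A (star z)) =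
      TensorProduct.lid ℂ A ((starConj H.counit).rTensor A z) := by
    intro z
    induction z with
    | zero => simp
    | tmul x y => simp [starConj_apply]
    | add x y hx hy => simp only [map_add, star_add, hx, hy]
  have h : ∀ z : A ⊗[ℂ] A, star (H.counit₁ A (star z)) = H.counit₁ A z := by
    intro z
    obtain ⟨u, rfl⟩ := H.starConj_T₁_surjective z
    induction u with
    | zero => simp
    | add x y hx hy => simp only [map_add, star_add, hx, hy]
    | tmul x y =>
      rw [← l₂_apply, star_l₂, counit₁_r₂, counit₁_l₂]
      simp
  by_cases ha : a = 0
  · simp [ha]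
  · have h1 := h (a ⊗ₜ a)
    simp only [TensorProduct.star_tmul, counit₁_tmul, star_smul, star_star] at h1
    rw [← smul_left_injective ℂ ha h1, star_star]

theorem star_counit₁ (z : A ⊗[ℂ] A) : star (H.counit₁ A z) = H.counit₁ A (star z) := by
  induction z with
  | zero => simp
  | tmul x y => simp [counit_star]
  | add x y hx hy => simp only [map_add, star_add, hx, hy]

/-! ### The antipode -/

/-- `a ⊗ c ↦ S(a)c` -/
def antipodeMul : A ⊗[ℂ] A →ₗ[ℂ] A := H.counit₁ A ∘ₗ H.T₁.symm.toLinearMap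

/-- `c ⊗ a ↦ cS(a)` -/
def mulAntipode : A ⊗[ℂ] A →ₗ[ℂ] A := H.counit₂ A ∘ₗ H.T₂.symm.toLinearMap

theorem antipodeMul_T₁ (z : A ⊗[ℂ] A) : H.antipodeMul (H.T₁ z) = H.counit₁ A z := by
  simp [antipodeMul]

theorem mulAntipode_T₂ (z : A ⊗[ℂ] A) : H.mulAntipode (H.T₂ z) = H.counit₂ A z := by
  simp [mulAntipode]

/-- The two expressions for `aS(b)c` agree, so that `S(b)` is a multiplier. Any threefold tensor is
`T₂` in legs 1, 2 after `T₁` in legs 2, 3 of some `p ⊗ q ⊗ r`; by coassociativity either map may be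
cancelled first, and both results are `pqr`. -/
theorem mul_antipodeMul (a b c : A) :
    a * H.antipodeMul (b ⊗ₜ c) = H.mulAntipode (a ⊗ₜ b) * c := by
  have h : ∀ X : A ⊗[ℂ] (A ⊗[ℂ] A), LinearMap.mul' ℂ A (H.antipodeMul.lTensor A X) =
      LinearMap.mul' ℂ A (H.mulAntipode.rTensor A ((TensorProduct.assoc ℂ A A A).symm X)) := by
    intro X
    obtain ⟨X, rfl⟩ := leg12_surjective (V := A) (f := H.T₂.toLinearMap) H.T₂.surjective X
    obtain ⟨Y, rfl⟩ := leg23_surjective (V := A) (f := H.T₁.toLinearMap) H.T₁.surjective X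
    have h1 := LinearMap.congr_fun H.coassoc Y
    simp only [LinearMap.comp_apply] at h1
    have h2 : H.antipodeMul ∘ₗ H.T₁.toLinearMap = H.counit₁ A :=
      LinearMap.ext fun z => H.antipodeMul_T₁ z
    have h3 : H.mulAntipode ∘ₗ H.T₂.toLinearMap = H.counit₂ A :=
      LinearMap.ext fun z => H.mulAntipode_T₂ z
    nth_rewrite 1 [h1]
    rw [leg23, ← LinearMap.lTensor_comp_apply, h2, leg12]
    simp only [LinearMap.comp_apply, LinearEquiv.coe_coe, LinearEquiv.symm_apply_apply]
    rw [← LinearMap.rTensor_comp_apply, h3]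
    clear h1
    induction Y with
    | zero => simp
    | add x y hx hy => simp only [map_add, hx, hy]
    | tmul p Y =>
      induction Y with
      | zero => simp
      | add x y hx hy => simp only [map_add, TensorProduct.tmul_add, hx, hy]
      | tmul q r =>
        have h4 : ∀ z : A ⊗[ℂ] A, LinearMap.mul' ℂ A ((H.counit₁ A).lTensor A
            (TensorProduct.assoc ℂ A A A (z ⊗ₜ r))) = H.counit₂ A z * r := by
          intro z
          induction z with
          | zero => simp
          | tmul x y => simp [smul_mul_assoc]
          | add x y hx hy => simp only [map_add, TensorProduct.add_tmul, add_mul, hx, hy]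
        have h5 : ∀ z : A ⊗[ℂ] A, LinearMap.mul' ℂ A ((H.counit₂ A).rTensor A
            ((TensorProduct.assoc ℂ A A A).symm (p ⊗ₜ z))) = p * H.counit₁ A z := by
          intro z
          induction z with
          | zero => simp
          | tmul x y => simp [smul_mul_assoc, mul_smul_comm]
          | add x y hx hy => simp only [map_add, TensorProduct.tmul_add, mul_add, hx, hy]
        simp only [TensorProduct.assoc_symm_tmul, LinearMap.rTensor_tmul, LinearEquiv.coe_coe,
          LinearMap.lTensor_tmul, h4, h5, counit₂_T₂, counit₁_T₁, LinearMap.mul'_apply, mul_assoc]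
  simpa using h (a ⊗ₜ (b ⊗ₜ c))

theorem antipodeMul_Δ_L (a : A) (w : A ⊗[ℂ] A) :
    H.antipodeMul ((H.Δ a).L w) = H.counit a • H.antipodeMul w := by
  obtain ⟨u, rfl⟩ := H.T₁.surjective w
  induction u with
  | zero => simp
  | add x y hx hy => simp only [map_add, smul_add, hx, hy]
  | tmul b c =>
    rw [← r₂_apply, ← r₂_mul, r₂_apply, r₂_apply, antipodeMul_T₁, antipodeMul_T₁]
    simp [counit_mul, mul_smul]

/-- This is `S(pu)v = S(u)(S(p)v)`, the antimultiplicativity of `S` before `S` is known to take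
values in `A`. For `z = Δ(a)(1 ⊗ v)` one has `z(u ⊗ 1) = Δ(a)(u ⊗ v)`, and the factor `Δ(a)`
contributes only `ε(a)`. -/
theorem antipodeMul_mulRight (u : A) (z : A ⊗[ℂ] A) :
    H.antipodeMul ((LinearMap.mulRight ℂ u).rTensor A z) =
      H.antipodeMul (u ⊗ₜ H.antipodeMul z) := by
  obtain ⟨y, rfl⟩ := H.T₁.surjective z
  induction y with
  | zero => simp
  | add x y hx hy => simp only [map_add, TensorProduct.tmul_add, hx, hy]
  | tmul a v =>
    rw [← r₂_apply, ← Δ_L_tmul, antipodeMul_Δ_L, r₂_apply, antipodeMul_T₁, counit₁_tmul,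
      TensorProduct.tmul_smul, map_smul]

/-- For `y = r ⊗ s` this is `ε(r)S(s) = ∑ r₍₁₎S(s r₍₂₎)`. Since `(1 ⊗ s)Δ(r)` lies in `A ⊗ A`, the
multiplier `S(s)` is exhibited as an element of `A`. -/
theorem antipodeMul_counit₁ (y : A ⊗[ℂ] A) (w : A) :
    H.antipodeMul (H.counit₁ A y ⊗ₜ w) =
      H.mulAntipode (starConj H.T₁.toLinearMap y) * w := by
  -- Reading `Ω(x ⊗ c)` both as `(xS(c))w` and as `x(S(c)w)` lets factors be pulled out of either
  -- leg.
  let Ω : A ⊗[ℂ] A →ₗ[ℂ] A := LinearMap.mulRight ℂ w ∘ₗ H.mulAntipode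
  have hΩ : ∀ x c, Ω (x ⊗ₜ c) = x * H.antipodeMul (c ⊗ₜ w) := by
    intro x c
    simp [Ω, mul_antipodeMul]
  have hΩl : ∀ (d : A) (z : A ⊗[ℂ] A), Ω ((LinearMap.mulLeft ℂ d).rTensor A z) = d * Ω z := by
    intro d z
    induction z with
    | zero => simp
    | add x y hx hy => simp only [map_add, mul_add, hx, hy]
    | tmul x y => simp [hΩ, mul_assoc]
  have hΩr : ∀ (s : A) (z : A ⊗[ℂ] A), Ω ((LinearMap.mulLeft ℂ s).lTensor A z) =
      H.mulAntipode z * H.antipodeMul (s ⊗ₜ w) := by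
    intro s z
    induction z with
    | zero => simp
    | add x y hx hy => simp only [map_add, add_mul, hx, hy]
    | tmul x y =>
      have h := H.antipodeMul_mulRight y (s ⊗ₜ w)
      simp only [LinearMap.rTensor_tmul, LinearMap.mulRight_apply] at h
      simp [hΩ, h, mul_antipodeMul]
  change _ = Ω _
  induction y with
  | zero => simp
  | add x y hx hy => simp only [map_add, TensorProduct.add_tmul, hx, hy]
  | tmul r s =>
    refine sub_eq_zero.1 (H.nondegenerate_right _ fun d => ?_)
    rw [mul_sub, sub_eq_zero, ← l₂_apply, ← hΩl, ← mulLeft_l₁, hΩr, l₁_apply, mulAntipode_T₂,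
      counit₁_tmul, counit₂_tmul, ← TensorProduct.smul_tmul', map_smul, mul_smul_comm,
      smul_mul_assoc]

theorem exists_isAntipode : ∃ S, H.IsAntipode S := by
  obtain ⟨S, hS⟩ := exists_linearMap_of_injective (LinearMap.mul ℂ A)
    (TensorProduct.curry H.antipodeMul)
    (by
      refine (injective_iff_map_eq_zero _).2 fun a ha => H.nondegenerate_left a fun b => ?_
      simpa using LinearMap.congr_fun ha b)
    (fun b => by
      obtain ⟨y, rfl⟩ := H.counit₁_surjective b
      refine ⟨H.mulAntipode (starConj H.T₁.toLinearMap y), ?_⟩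
      ext w
      simp [antipodeMul_counit₁])
  have h1 : ∀ b w, S b * w = H.antipodeMul (b ⊗ₜ w) := fun b w => by
    simpa using LinearMap.congr_fun (hS b) w
  have h2 : ∀ a b, a * S b = H.mulAntipode (a ⊗ₜ b) := fun a b =>
    sub_eq_zero.1 (H.nondegenerate_left _ fun c => by
      rw [sub_mul, mul_assoc, h1, mul_antipodeMul, sub_self])
  have h1' : ∀ z, LinearMap.mul' ℂ A (S.rTensor A z) = H.antipodeMul z := by
    intro z
    induction z with
    | zero => simp
    | add x y hx hy => simp only [map_add, hx, hy]
    | tmul x y => simp [h1]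
  have h2' : ∀ z, LinearMap.mul' ℂ A (S.lTensor A z) = H.mulAntipode z := by
    intro z
    induction z with
    | zero => simp
    | add x y hx hy => simp only [map_add, hx, hy]
    | tmul x y => simp [h2]
  exact ⟨S, fun a b => ⟨by simp [h1', antipodeMul_T₁], by simp [h2', mulAntipode_T₂]⟩⟩

theorem isAntipode_antipode : H.IsAntipode H.antipode :=
  Classical.epsilon_spec H.exists_isAntipode

theorem antipode_r₂ (c a : A) :
    LinearMap.mul' ℂ A (H.antipode.rTensor A (H.r₂ c a)) = H.counit a • c :=
  (H.isAntipode_antipode a c).1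

theorem antipode_l₁ (e a : A) :
    LinearMap.mul' ℂ A (H.antipode.lTensor A (H.l₁ e a)) = H.counit a • e :=
  (H.isAntipode_antipode e a).2

theorem mul'_antipode_rTensor (z : A ⊗[ℂ] A) :
    LinearMap.mul' ℂ A (H.antipode.rTensor A z) = H.antipodeMul z := by
  obtain ⟨u, rfl⟩ := H.T₁.surjective z
  rw [antipodeMul_T₁]
  induction u with
  | zero => simp
  | add x y hx hy => simp only [map_add, hx, hy]
  | tmul x y => exact (H.antipode_r₂ y x).trans (by simp)

theorem antipode_mul_eq (a c : A) : H.antipode a * c = H.antipodeMul (a ⊗ₜ c) := by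
  simpa using H.mul'_antipode_rTensor (a ⊗ₜ c)

theorem mul_antipode_eq (c a : A) : c * H.antipode a = H.mulAntipode (c ⊗ₜ a) :=
  sub_eq_zero.1 (H.nondegenerate_left _ fun d => by
    rw [sub_mul, mul_assoc, antipode_mul_eq, mul_antipodeMul, sub_self])

theorem antipode_mul (a b : A) : H.antipode (a * b) = H.antipode b * H.antipode a :=
  sub_eq_zero.1 (H.nondegenerate_left _ fun d => by
    have h := H.antipodeMul_mulRight b (a ⊗ₜ d)
    simp only [LinearMap.rTensor_tmul, LinearMap.mulRight_apply] at h
    rw [sub_mul, mul_assoc, antipode_mul_eq, antipode_mul_eq, antipode_mul_eq, h, sub_self])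

theorem antipode_counit₁ (y : A ⊗[ℂ] A) :
    H.antipode (H.counit₁ A y) = H.mulAntipode (starConj H.T₁.toLinearMap y) :=
  sub_eq_zero.1 (H.nondegenerate_left _ fun d => by
    rw [sub_mul, antipode_mul_eq, antipodeMul_counit₁, sub_self])

/-- Any `b` is `(ι ⊗ ε)z`, which is `x ⊗ c ↦ xS(c)` applied to `T₂ z`. Writing `T₂ z` in the form
required by `antipode_counit₁` makes it a value of `S`. -/
theorem antipode_surjective : Function.Surjective H.antipode := by
  intro b
  obtain ⟨z, hz⟩ := H.counit₂_surjective b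
  obtain ⟨y, hy⟩ := H.starConj_T₁_surjective (H.T₂ z)
  exact ⟨H.counit₁ A y, by rw [antipode_counit₁, hy, mulAntipode_T₂, hz]⟩

/-- `S(S(x^*)^*) = x` -/
theorem antipode_star_antipode_star (x : A) :
    H.antipode (star (H.antipode (star x))) = x := by
  refine sub_eq_zero.1 (H.nondegenerate_left _ fun d => ?_)
  obtain ⟨c, rfl⟩ := H.antipode_surjective d
  -- With `d = S(c)` the product is `S(S(x^*)^*)S(c) = S(cS(x^*)^*)`. This `y` satisfies `(ε ⊗ ι)y =
  -- cS(x^*)^*`, so `antipode_counit₁` evaluates it to `xS(c)`.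
  obtain ⟨y, hy⟩ := H.starConj_T₁_surjective (x ⊗ₜ c)
  have h := H.antipode_counit₁ y
  have h1 : H.counit₁ A y = c * star (H.antipode (star x)) := by
    have h2 : star y = H.T₁.symm (star x ⊗ₜ star c) := by
      rw [LinearEquiv.eq_symm_apply, ← TensorProduct.star_tmul, ← hy]
      simp [starConj_apply]
    have h3 : H.counit₁ A (star y) = H.antipode (star x) * star c := by
      rw [h2, antipode_mul_eq, antipodeMul]
      rfl
    rw [← star_star (H.counit₁ A y), star_counit₁, h3, star_mul, star_star]
  rw [h1, antipode_mul, hy, ← mul_antipode_eq] at h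
  rw [sub_mul, h, sub_self]

/-- At `x = a^*`, the identity `S(S(x^*)^*) = x` recovers `a^*` from `S(a)`. -/
theorem antipode_injective : Function.Injective H.antipode := by
  refine (injective_iff_map_eq_zero _).2 fun a ha => ?_
  obtain ⟨b, rfl⟩ := H.antipode_surjective a
  have h1 := H.antipode_star_antipode_star (star (H.antipode b))
  rw [star_star, ha] at h1
  simp only [star_zero, map_zero] at h1
  exact star_eq_zero.1 h1.symm

/-- `∑ a₍₁₎S(ka₍₂₎) = ε(a)S(k)` -/
theorem antipode_l₂ (k a : A) :
    LinearMap.mul' ℂ A (H.antipode.lTensor A (H.l₂ k a)) = H.counit a • H.antipode k := by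
  refine sub_eq_zero.1 (H.nondegenerate_right _ fun c => ?_)
  have h1 : ∀ z : A ⊗[ℂ] A, c * LinearMap.mul' ℂ A (H.antipode.lTensor A z) =
      LinearMap.mul' ℂ A (H.antipode.lTensor A ((LinearMap.mulLeft ℂ c).rTensor A z)) := by
    intro z
    induction z with
    | zero => simp
    | add x y hx hy => simp only [map_add, mul_add, hx, hy]
    | tmul x y => simp [mul_assoc]
  have h2 : ∀ z : A ⊗[ℂ] A, LinearMap.mul' ℂ A (H.antipode.lTensor A
      ((LinearMap.mulLeft ℂ k).lTensor A z)) =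
      LinearMap.mul' ℂ A (H.antipode.lTensor A z) * H.antipode k := by
    intro z
    induction z with
    | zero => simp
    | add x y hx hy => simp only [map_add, add_mul, hx, hy]
    | tmul x y => simp [mul_assoc, antipode_mul]
  rw [mul_sub, sub_eq_zero, h1, ← mulLeft_l₁, h2, antipode_l₁, smul_mul_assoc, mul_smul_comm]

/-- `∑ S(a₍₁₎c)a₍₂₎ = ε(a)S(c)` -/
theorem antipode_r₁ (c a : A) :
    LinearMap.mul' ℂ A (H.antipode.rTensor A (H.r₁ c a)) = H.counit a • H.antipode c := by
  refine sub_eq_zero.1 (H.nondegenerate_left _ fun d => ?_)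
  have h1 : ∀ z : A ⊗[ℂ] A, LinearMap.mul' ℂ A (H.antipode.rTensor A z) * d =
      LinearMap.mul' ℂ A (H.antipode.rTensor A ((LinearMap.mulRight ℂ d).lTensor A z)) := by
    intro z
    induction z with
    | zero => simp
    | add x y hx hy => simp only [map_add, add_mul, hx, hy]
    | tmul x y => simp [mul_assoc]
  have h2 : ∀ z : A ⊗[ℂ] A, LinearMap.mul' ℂ A (H.antipode.rTensor A
      ((LinearMap.mulRight ℂ c).rTensor A z)) =
      H.antipode c * LinearMap.mul' ℂ A (H.antipode.rTensor A z) := by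
    intro z
    induction z with
    | zero => simp
    | add x y hx hy => simp only [map_add, mul_add, hx, hy]
    | tmul x y => simp [mul_assoc, antipode_mul]
  rw [sub_mul, sub_eq_zero, h1, mulRight_r₁, h2, antipode_r₂, smul_mul_assoc, mul_smul_comm]

/-- `∑ Δ(a₍₁₎)(1 ⊗ S(ea₍₂₎)) = a ⊗ S(e)` -/
theorem T₁_antipode_l₂ (e a : A) :
    H.T₁ (H.antipode.lTensor A (H.l₂ e a)) = a ⊗ₜ H.antipode e := by
  refine H.ext_mulLeft_rTensor fun c => ?_
  have h1 : ∀ z : A ⊗[ℂ] A, (LinearMap.mulLeft ℂ c).rTensor A (H.T₁ (H.antipode.lTensor A z)) =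
      (LinearMap.mul' ℂ A ∘ₗ H.antipode.lTensor A).lTensor A
        (TensorProduct.assoc ℂ A A A ((H.l₁ c).rTensor A z)) := by
    intro z
    induction z with
    | zero => simp
    | add x y hx hy => simp only [map_add, hx, hy]
    | tmul x y =>
      rw [LinearMap.lTensor_tmul, ← r₂_apply, mulLeft_r₂, LinearMap.rTensor_tmul]
      generalize H.l₁ c x = w
      induction w with
      | zero => simp
      | add x y hx hy => simp only [map_add, TensorProduct.add_tmul, hx, hy]
      | tmul p q => simp
  have h2 : (LinearMap.mul' ℂ A ∘ₗ H.antipode.lTensor A) ∘ₗ H.l₂ e =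
      H.counit.smulRight (H.antipode e) :=
    LinearMap.ext fun x => by simp [antipode_l₂]
  -- Coassociativity collects `∑ x₍₁₎S(e x₍₂₎) = ε(x)S(e)` in legs 2 and 3; the counit then
  -- recombines `(c ⊗ 1)Δ(a)` into `ca`.
  rw [h1, coassoc_l₁_l₂, ← LinearMap.lTensor_comp_apply, h2, LinearMap.rTensor_tmul,
    LinearMap.mulLeft_apply, ← counit₂_l₁]
  generalize H.l₁ c a = w
  induction w with
  | zero => simp
  | add x y hx hy => simp only [map_add, TensorProduct.add_tmul, hx, hy]
  | tmul p q => simp [TensorProduct.smul_tmul]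

end MultiplierHopfStarAlgebra

end Bicross
end

noncomputable section

namespace Bicross

section Action

variable {A : Type*} [NonUnitalRing A] [Module ℂ A] [IsScalarTower ℂ A A] [SMulCommClass ℂ A A]
  [StarRing A] [StarModule ℂ A]
  {B : Type*} [NonUnitalRing B] [Module ℂ B] [IsScalarTower ℂ B B] [SMulCommClass ℂ B B]
  {H : MultiplierHopfStarAlgebra A} {act : B →ₗ[ℂ] A →ₗ[ℂ] B}

/-- Additive statements about `b` need only be checked at `b = c ◁ e`, where `e` covers the
coproduct. -/
theorem IsModuleAlgebra.induction (hact : IsModuleAlgebra H act) {p : B → Prop} (zero : p 0)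
    (add : ∀ x y, p x → p y → p (x + y)) (act' : ∀ c e, p (act c e)) (b : B) : p b := by
  have hb : b ∈ Submodule.span ℂ {x : B | ∃ b a, x = act b a} := by
    rw [hact.unital]; trivial
  have h : ∀ c : ℂ, p (c • b) := by
    induction hb using Submodule.span_induction with
    | mem x hx =>
      obtain ⟨b, a, rfl⟩ := hx
      intro c
      have := act' (c • b) a
      rwa [map_smul, LinearMap.smul_apply] at this
    | zero => intro c; rwa [smul_zero]
    | add x y _ _ hx hy => intro c; rw [smul_add]; exact add _ _ (hx c) (hy c)
    | smul d x _ hx => intro c; rw [smul_smul]; exact hx _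
  simpa using h 1

/-! ### The twist maps -/

theorem IsModuleAlgebra.act_comp_mulLeft (hact : IsModuleAlgebra H act) (c : B) (e : A) :
    act c ∘ₗ LinearMap.mulLeft ℂ e = act (act c e) :=
  LinearMap.ext fun a => hact.act_mul c e a

/-- For `b = c ◁ e` the value is `∑ a₍₁₎ ⊗ (c ◁ ea₍₂₎)`, which makes sense because `(1 ⊗ e)Δ(a)`
lies in `A ⊗ A`. Non-degeneracy makes the value unique, hence independent of the representation of
`b` and linear. -/
theorem IsModuleAlgebra.exists_isTwist (hact : IsModuleAlgebra H act) :
    ∃ R, IsTwist H act R := by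
  let Φ : A ⊗[ℂ] B →ₗ[ℂ] A →ₗ[ℂ] A ⊗[ℂ] B := (LinearMap.rTensorHom B ∘ₗ LinearMap.mul ℂ A).flip
  let Ψ : B ⊗[ℂ] A →ₗ[ℂ] A →ₗ[ℂ] A ⊗[ℂ] B := TensorProduct.lift
    ((LinearMap.llcomp ℂ A (A ⊗[ℂ] A) (A ⊗[ℂ] B)).compl₁₂ (LinearMap.lTensorHom A ∘ₗ act) H.l₁.flip)
  have hΦ : ∀ w a, Φ w a = (LinearMap.mulLeft ℂ a).rTensor B w := fun w a => rfl
  have hΨ : ∀ b a a', Ψ (b ⊗ₜ a) a' = (act b).lTensor A (H.l₁ a' a) := fun b a a' => rfl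
  obtain ⟨R, hR⟩ := exists_linearMap_of_injective Φ Ψ
    ((injective_iff_map_eq_zero _).2 fun w hw => H.ext_mulLeft_rTensor fun a => by
      rw [← hΦ, hw, map_zero, LinearMap.zero_apply])
    (fun v => by
      induction v with
      | zero => exact ⟨0, by simp⟩
      | add x y hx hy =>
        obtain ⟨u, hu⟩ := hx
        obtain ⟨v, hv⟩ := hy
        exact ⟨u + v, by simp [hu, hv]⟩
      | tmul b a =>
        refine hact.induction (p := fun b => ∃ w, Φ w = Ψ (b ⊗ₜ a)) ⟨0, by simp⟩ ?_ ?_ b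
        · rintro x y ⟨u, hu⟩ ⟨v, hv⟩
          exact ⟨u + v, by simp [TensorProduct.add_tmul, hu, hv]⟩
        · intro c e
          refine ⟨(act c).lTensor A (H.l₂ e a), LinearMap.ext fun a' => ?_⟩
          rw [hΦ, hΨ, rTensor_lTensor, ← H.mulLeft_l₁, ← LinearMap.lTensor_comp_apply,
            hact.act_comp_mulLeft])
  exact ⟨R, fun b a a' => by rw [← hΦ, hR, hΨ]; rfl⟩

/-- As for `R`, with `(e ⊗ 1)Δ(a)` as the covered coproduct. -/
theorem IsModuleAlgebra.exists_isTwistOp (hact : IsModuleAlgebra H act) :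
    ∃ R, IsTwistOp H act R := by
  let Φ : A ⊗[ℂ] B →ₗ[ℂ] A →ₗ[ℂ] A ⊗[ℂ] B :=
    (LinearMap.rTensorHom B ∘ₗ (LinearMap.mul ℂ A).flip).flip
  let Ψ : B ⊗[ℂ] A →ₗ[ℂ] A →ₗ[ℂ] A ⊗[ℂ] B := TensorProduct.lift
    ((LinearMap.llcomp ℂ A (A ⊗[ℂ] A) (A ⊗[ℂ] B)).compl₁₂
      (LinearMap.llcomp ℂ _ _ _ (TensorProduct.comm ℂ B A).toLinearMap ∘ₗ
        LinearMap.rTensorHom A ∘ₗ act) H.r₂.flip)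
  have hΦ : ∀ w a, Φ w a = (LinearMap.mulRight ℂ a).rTensor B w := fun w a => rfl
  have hΨ : ∀ b a a', Ψ (b ⊗ₜ a) a' =
    TensorProduct.comm ℂ B A ((act b).rTensor A (H.r₂ a' a)) := fun b a a' => rfl
  have hc : ∀ (f : A →ₗ[ℂ] A) (z : B ⊗[ℂ] A), f.rTensor B (TensorProduct.comm ℂ B A z) =
      TensorProduct.comm ℂ B A (f.lTensor B z) := by
    intro f z
    induction z with
    | zero => simp
    | tmul x y => simp
    | add x y hx hy => simp only [map_add, hx, hy]
  obtain ⟨R, hR⟩ := exists_linearMap_of_injective Φ Ψ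
    ((injective_iff_map_eq_zero _).2 fun w hw => H.ext_mulRight_rTensor fun a => by
      rw [← hΦ, hw, map_zero, LinearMap.zero_apply])
    (fun v => by
      induction v with
      | zero => exact ⟨0, by simp⟩
      | add x y hx hy =>
        obtain ⟨u, hu⟩ := hx
        obtain ⟨v, hv⟩ := hy
        exact ⟨u + v, by simp [hu, hv]⟩
      | tmul b a =>
        refine hact.induction (p := fun b => ∃ w, Φ w = Ψ (b ⊗ₜ a)) ⟨0, by simp⟩ ?_ ?_ b
        · rintro x y ⟨u, hu⟩ ⟨v, hv⟩
          exact ⟨u + v, by simp [TensorProduct.add_tmul, hu, hv]⟩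
        · intro c e
          refine ⟨TensorProduct.comm ℂ B A ((act c).rTensor A (H.l₁ e a)),
            LinearMap.ext fun a' => ?_⟩
          rw [hΦ, hΨ, hc, ← rTensor_lTensor, ← H.mulLeft_r₂, ← LinearMap.rTensor_comp_apply,
            hact.act_comp_mulLeft])
  exact ⟨R, fun b a a' => by rw [← hΦ, hR, hΨ]; rfl⟩

variable (H act) in
/-- `rt b a = R(b ⊗ a) = ∑ a₍₁₎ ⊗ (b ◁ a₍₂₎)` -/
def rt : B →ₗ[ℂ] A →ₗ[ℂ] A ⊗[ℂ] B := TensorProduct.curry (twist H act)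

variable (H act) in
/-- `ro b a = ∑ (b ◁ a₍₁₎) ⊗ a₍₂₎` -/
def ro : B →ₗ[ℂ] A →ₗ[ℂ] B ⊗[ℂ] A :=
  TensorProduct.curry ((TensorProduct.comm ℂ A B).toLinearMap ∘ₗ twistOp H act)

theorem rt_apply (b : B) (a : A) : rt H act b a = twist H act (b ⊗ₜ a) := rfl

theorem ro_apply (b : B) (a : A) :
    ro H act b a = TensorProduct.comm ℂ A B (twistOp H act (b ⊗ₜ a)) := rfl

theorem twistOp_tmul (b : B) (a : A) :
    twistOp H act (b ⊗ₜ a) = TensorProduct.comm ℂ B A (ro H act b a) := by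
  rw [ro_apply]
  simp

section

variable {X Y V W : Type*} [AddCommGroup X] [Module ℂ X] [AddCommGroup Y] [Module ℂ Y]
  [AddCommGroup V] [Module ℂ V] [AddCommGroup W] [Module ℂ W]

theorem comm_lTensor (f : Y →ₗ[ℂ] W) (z : X ⊗[ℂ] Y) :
    TensorProduct.comm ℂ X W (f.lTensor X z) = f.rTensor X (TensorProduct.comm ℂ X Y z) := by
  induction z with
  | zero => simp
  | tmul x y => simp
  | add x y hx hy => simp only [map_add, hx, hy]

theorem comm_rTensor (f : X →ₗ[ℂ] W) (z : X ⊗[ℂ] Y) :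
    TensorProduct.comm ℂ W Y (f.rTensor Y z) = f.lTensor Y (TensorProduct.comm ℂ X Y z) := by
  induction z with
  | zero => simp
  | tmul x y => simp
  | add x y hx hy => simp only [map_add, hx, hy]

end

variable (H act) in
/-- `rA a X = X a` for `X ∈ A ⊗ B`: `rA a (s ⊗ t) = ∑ s a₍₁₎ ⊗ (t ◁ a₍₂₎)`. -/
def rA : A →ₗ[ℂ] A ⊗[ℂ] B →ₗ[ℂ] A ⊗[ℂ] B :=
  LinearMap.llcomp ℂ _ _ _ ((LinearMap.mul' ℂ A).rTensor B ∘ₗ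
    (TensorProduct.assoc ℂ A A B).symm.toLinearMap) ∘ₗ LinearMap.lTensorHom A ∘ₗ (rt H act).flip

theorem rA_tmul (a s : A) (t : B) :
    rA H act a (s ⊗ₜ t) = (LinearMap.mulLeft ℂ s).rTensor B (rt H act t a) := by
  have h : ∀ z : A ⊗[ℂ] B, (LinearMap.mul' ℂ A).rTensor B
      ((TensorProduct.assoc ℂ A A B).symm (s ⊗ₜ z)) = (LinearMap.mulLeft ℂ s).rTensor B z := by
    intro z
    induction z with
    | zero => simp
    | tmul x y => simp
    | add x y hx hy => simp only [map_add, TensorProduct.tmul_add, hx, hy]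
  exact h _

variable (H act) in
/-- `lB b X = b X` for `X ∈ A ⊗ B`: `lB b (a ⊗ b') = ∑ a₍₁₎ ⊗ (b ◁ a₍₂₎)b'`. -/
def lB : B →ₗ[ℂ] A ⊗[ℂ] B →ₗ[ℂ] A ⊗[ℂ] B :=
  LinearMap.llcomp ℂ _ _ _ ((LinearMap.mul' ℂ B).lTensor A ∘ₗ
    (TensorProduct.assoc ℂ A B B).toLinearMap) ∘ₗ LinearMap.rTensorHom B ∘ₗ rt H act

theorem lB_tmul (b : B) (a : A) (b' : B) :
    lB H act b (a ⊗ₜ b') = (LinearMap.mulRight ℂ b').lTensor A (rt H act b a) := by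
  have h : ∀ z : A ⊗[ℂ] B, (LinearMap.mul' ℂ B).lTensor A
      (TensorProduct.assoc ℂ A B B (z ⊗ₜ b')) = (LinearMap.mulRight ℂ b').lTensor A z := by
    intro z
    induction z with
    | zero => simp
    | tmul x y => simp
    | add x y hx hy => simp only [map_add, TensorProduct.add_tmul, hx, hy]
  exact h _

theorem rA_mulLeft (a s : A) (z : A ⊗[ℂ] B) :
    rA H act a ((LinearMap.mulLeft ℂ s).rTensor B z) =
      (LinearMap.mulLeft ℂ s).rTensor B (rA H act a z) := by
  induction z with
  | zero => simp
  | add x y hx hy => simp only [map_add, hx, hy]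
  | tmul x y =>
    rw [LinearMap.rTensor_tmul, rA_tmul, rA_tmul, ← LinearMap.rTensor_comp_apply]
    congr 2
    ext z
    simp

variable (H act) in
/-- `s ⊗ t ↦ ∑ s a₍₁₎ ⊗ (t ◁ a₍₂₎) ⊗ a₍₃₎` -/
def rAΔ (a : A) : A ⊗[ℂ] B →ₗ[ℂ] A ⊗[ℂ] (B ⊗[ℂ] A) :=
  TensorProduct.lift ((LinearMap.lTensorHom A ∘ₗ ro H act).flip ∘ₗ H.l₁.flip a)

theorem rAΔ_tmul (a s : A) (t : B) :
    rAΔ H act a (s ⊗ₜ t) = (ro H act t).lTensor A (H.l₁ s a) := rfl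

namespace IsModuleAlgebra

theorem mulLeft_rt (hact : IsModuleAlgebra H act) (a' : A) (b : B) (a : A) :
    (LinearMap.mulLeft ℂ a').rTensor B (rt H act b a) = (act b).lTensor A (H.l₁ a' a) :=
  Classical.epsilon_spec hact.exists_isTwist b a a'

theorem mulRight_ro (hact : IsModuleAlgebra H act) (a' : A) (b : B) (a : A) :
    (LinearMap.mulRight ℂ a').lTensor B (ro H act b a) = (act b).rTensor A (H.r₂ a' a) := by
  have h := Classical.epsilon_spec hact.exists_isTwistOp b a a'
  apply (TensorProduct.comm ℂ B A).injective
  rw [comm_lTensor, ← twistOp_tmul]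
  exact h

theorem rt_act (hact : IsModuleAlgebra H act) (c : B) (e a : A) :
    rt H act (act c e) a = (act c).lTensor A (H.l₂ e a) :=
  H.ext_mulLeft_rTensor fun a' => by
    rw [hact.mulLeft_rt, rTensor_lTensor, ← H.mulLeft_l₁, ← LinearMap.lTensor_comp_apply,
      hact.act_comp_mulLeft]

theorem ro_act (hact : IsModuleAlgebra H act) (c : B) (e a : A) :
    ro H act (act c e) a = (act c).rTensor A (H.l₁ e a) :=
  H.ext_mulRight_lTensor fun a' => by
    rw [hact.mulRight_ro, ← rTensor_lTensor, ← H.mulLeft_r₂, ← LinearMap.rTensor_comp_apply,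
      hact.act_comp_mulLeft]

theorem rt_act_eq (hact : IsModuleAlgebra H act) (c : B) (e : A) :
    rt H act (act c e) = (act c).lTensor A ∘ₗ H.l₂ e :=
  LinearMap.ext fun a => hact.rt_act c e a

theorem ro_act_eq (hact : IsModuleAlgebra H act) (c : B) (e : A) :
    ro H act (act c e) = (act c).rTensor A ∘ₗ H.l₁ e :=
  LinearMap.ext fun a => hact.ro_act c e a

/-- `∑ (x a₍₁₎) ⊗ a₍₂₎ ⊗ (b ◁ a₍₃₎)` -/
theorem l₁_rt (hact : IsModuleAlgebra H act) (x a : A) (b : B) :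
    TensorProduct.assoc ℂ A A B ((H.l₁ x).rTensor B (rt H act b a)) =
      (rt H act b).lTensor A (H.l₁ x a) := by
  refine hact.induction (p := fun b => TensorProduct.assoc ℂ A A B
    ((H.l₁ x).rTensor B (rt H act b a)) = (rt H act b).lTensor A (H.l₁ x a)) ?_ ?_ ?_ b
  · simp
  · intro b b' h h'
    simp only [map_add, LinearMap.add_apply, LinearMap.lTensor_add, h, h']
  · intro c e
    rw [hact.rt_act, rTensor_lTensor, ← lTensor_lTensor_assoc, H.coassoc_l₁_l₂,
      ← LinearMap.lTensor_comp_apply, hact.rt_act_eq]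

/-- `∑ (b ◁ a₍₁₎) ⊗ a₍₂₎ ⊗ k a₍₃₎` -/
theorem ro_l₂ (hact : IsModuleAlgebra H act) (k a : A) (b : B) :
    TensorProduct.assoc ℂ B A A ((ro H act b).rTensor A (H.l₂ k a)) =
      (H.l₂ k).lTensor B (ro H act b a) := by
  refine hact.induction (p := fun b => TensorProduct.assoc ℂ B A A
    ((ro H act b).rTensor A (H.l₂ k a)) = (H.l₂ k).lTensor B (ro H act b a)) ?_ ?_ ?_ b
  · simp
  · intro b b' h h'
    simp only [map_add, LinearMap.add_apply, LinearMap.rTensor_add, h, h']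
  · intro c e
    rw [hact.ro_act_eq, LinearMap.rTensor_comp_apply, ← rTensor_assoc, H.coassoc_l₁_l₂,
      rTensor_lTensor]
    rfl

/-- `∑ (b ◁ a₍₁₎) ⊗ a₍₂₎ ⊗ (b' ◁ a₍₃₎)` -/
theorem ro_rt (hact : IsModuleAlgebra H act) (b b' : B) (a : A) :
    TensorProduct.assoc ℂ B A B ((ro H act b).rTensor B (rt H act b' a)) =
      (rt H act b').lTensor B (ro H act b a) := by
  refine hact.induction (p := fun b' => TensorProduct.assoc ℂ B A B
    ((ro H act b).rTensor B (rt H act b' a)) = (rt H act b').lTensor B (ro H act b a)) ?_ ?_ ?_ b'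
  · simp
  · intro b b' h h'
    simp only [map_add, LinearMap.add_apply, LinearMap.lTensor_add, h, h']
  · intro c e
    rw [hact.rt_act, rTensor_lTensor, ← lTensor_lTensor_assoc, hact.ro_l₂,
      ← LinearMap.lTensor_comp_apply, hact.rt_act_eq]

theorem act_mul_ro (hact : IsModuleAlgebra H act) (t b' : B) (a : A) :
    act (t * b') a = LinearMap.mul' ℂ B ((act b').lTensor B (ro H act t a)) := by
  refine hact.induction (p := fun t => act (t * b') a =
    LinearMap.mul' ℂ B ((act b').lTensor B (ro H act t a))) ?_ ?_ ?_ t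
  · simp
  · intro b b' h h'
    simp only [map_add, add_mul, LinearMap.add_apply, h, h']
  · intro c e
    rw [hact.mul_act, hact.ro_act, H.l₁_apply, ← LinearMap.lTensor_comp_rTensor]
    rfl

/-- For `b = c ◁ e` this is multiplicativity of `Δ`, in the form `(1 ⊗ e)Δ(aa') = ((1 ⊗
e)Δ(a))Δ(a')`. -/
theorem rt_mul_right (hact : IsModuleAlgebra H act) (b : B) (a a' : A) :
    rt H act b (a * a') = rA H act a' (rt H act b a) := by
  have key : ∀ (c : B) (z : A ⊗[ℂ] A), rA H act a' ((act c).lTensor A z) =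
      (act c).lTensor A ((H.Δ a').R z) := by
    intro c z
    induction z with
    | zero => simp
    | add x y hx hy => simp only [map_add, hx, hy]
    | tmul p q =>
      rw [LinearMap.lTensor_tmul, rA_tmul, hact.rt_act, H.Δ_R_tmul', rTensor_lTensor]
  refine hact.induction (p := fun b => rt H act b (a * a') = rA H act a' (rt H act b a)) ?_ ?_ ?_ b
  · simp
  · intro b b' h h'
    simp only [map_add, LinearMap.add_apply, h, h']
  · intro c e
    rw [hact.rt_act, hact.rt_act, key, H.l₂_mul]

theorem rA_mul (hact : IsModuleAlgebra H act) (a a' : A) (z : A ⊗[ℂ] B) :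
    rA H act (a * a') z = rA H act a' (rA H act a z) := by
  induction z with
  | zero => simp
  | add x y hx hy => simp only [map_add, hx, hy]
  | tmul s t => rw [rA_tmul, rA_tmul, hact.rt_mul_right, rA_mulLeft]

theorem rt_comp_mulLeft (hact : IsModuleAlgebra H act) (b : B) (f : A) :
    rt H act b ∘ₗ LinearMap.mulLeft ℂ f = (rA H act).flip (rt H act b f) :=
  LinearMap.ext fun a => hact.rt_mul_right b f a

/-- For `w = s ⊗ t` both sides are `∑ sa₍₁₎ ⊗ (t ◁ a₍₂₎) ⊗ a₍₃₎c`; the factors `s` and `c` cover the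
two coproducts. -/
theorem assoc_rA_r₂ (hact : IsModuleAlgebra H act) (c a : A) (w : A ⊗[ℂ] B) :
    TensorProduct.assoc ℂ A B A (((rA H act).flip w).rTensor A (H.r₂ c a)) =
      ((LinearMap.mulRight ℂ c).lTensor B).lTensor A (rAΔ H act a w) := by
  induction w with
  | zero => simp
  | add x y hx hy => simp only [map_add, LinearMap.rTensor_add, LinearMap.add_apply, hx, hy]
  | tmul s t =>
    have h1 : (rA H act).flip (s ⊗ₜ t) = (act t).lTensor A ∘ₗ H.l₁ s :=
      LinearMap.ext fun a => by
        rw [LinearMap.flip_apply, rA_tmul, hact.mulLeft_rt, LinearMap.comp_apply]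
    have h2 : (LinearMap.mulRight ℂ c).lTensor B ∘ₗ ro H act t =
        (act t).rTensor A ∘ₗ H.r₂ c := LinearMap.ext fun a => hact.mulRight_ro c t a
    rw [h1, LinearMap.rTensor_comp_apply, ← rTensor_lTensor_assoc, H.coassoc_l₁_r₂, rAΔ_tmul,
      ← LinearMap.lTensor_comp_apply, ← LinearMap.lTensor_comp_apply, h2]

/-- `∑ R(b' ⊗ a'a₍₁₎) ⊗ a₍₂₎ = ∑ s a₍₁₎ ⊗ (t ◁ a₍₂₎) ⊗ a₍₃₎` for `∑ s ⊗ t = R(b' ⊗ a')` -/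
theorem assoc_rt_l₁ (hact : IsModuleAlgebra H act) (b' : B) (a' a : A) :
    TensorProduct.assoc ℂ A B A ((rt H act b').rTensor A (H.l₁ a' a)) =
      rAΔ H act a (rt H act b' a') := by
  refine H.ext_mulRight_lTensor_lTensor fun c => ?_
  rw [lTensor_lTensor_assoc, ← rTensor_lTensor, ← H.mulLeft_r₂, ← LinearMap.rTensor_comp_apply,
    hact.rt_comp_mulLeft, hact.assoc_rA_r₂]

end IsModuleAlgebra

/-! ### The involution on `A ⊗ B` -/

variable [StarRing B] [StarModule ℂ B]

namespace IsModuleAlgebra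

/-- `∑ R(y^* ⊗ x^*) = a^* ⊗ b^*` for `∑ x ⊗ y = R(b ⊗ a)` -/
theorem twist_star_twist (hact : IsModuleAlgebra H act)
    (hs : ∀ (a : A) (b : B), star (act b a) = act (star b) (star (H.antipode a))) (v : B ⊗[ℂ] A) :
    twist H act (TensorProduct.comm ℂ A B (star (twist H act v))) =
      TensorProduct.comm ℂ B A (star v) := by
  -- Here `z` stands for `(1 ⊗ e)Δ(a)`, so that the inner `R` has already been applied to `(c ◁ e) ⊗
  -- a`. The involution turns `c ◁ q` into `c^* ◁ S(q)^*`, and the outer `R` then produces the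
  -- adjoint of `∑ Δ(p)(1 ⊗ S(q))`, which `T₁_antipode_l₂` collapses to `a ⊗ S(e)`.
  have key : ∀ (c : B) (z : A ⊗[ℂ] A),
      twist H act (TensorProduct.comm ℂ A B (star ((act c).lTensor A z))) =
        (act (star c)).lTensor A (star (H.T₁ (H.antipode.lTensor A z))) := by
    intro c z
    induction z with
    | zero => simp
    | add x y hx hy => simp only [map_add, star_add, hx, hy]
    | tmul p q =>
      rw [LinearMap.lTensor_tmul, TensorProduct.star_tmul, hs, TensorProduct.comm_tmul,
        ← rt_apply, hact.rt_act, LinearMap.lTensor_tmul, ← H.r₂_apply, H.star_r₂]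
  induction v with
  | zero => simp
  | add x y hx hy => simp only [map_add, star_add, hx, hy]
  | tmul b a =>
    refine hact.induction (p := fun b =>
      twist H act (TensorProduct.comm ℂ A B (star (twist H act (b ⊗ₜ a)))) =
        TensorProduct.comm ℂ B A (star (b ⊗ₜ a))) ?_ ?_ ?_ b
    · simp
    · intro b b' h h'
      simp only [TensorProduct.add_tmul, map_add, star_add, h, h']
    · intro c e
      rw [← rt_apply, hact.rt_act, key, H.T₁_antipode_l₂]
      simp [hs]

/-- By `twist_star_twist`, `R` composed with flip, involution, `R`, flip and involution is the
identity; the preimage is read off from this. -/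
theorem twist_surjective (hact : IsModuleAlgebra H act)
    (hs : ∀ (a : A) (b : B), star (act b a) = act (star b) (star (H.antipode a))) :
    Function.Surjective (twist H act) := fun z =>
  ⟨TensorProduct.comm ℂ A B (star (twist H act (star (TensorProduct.comm ℂ A B z)))), by
    rw [hact.twist_star_twist hs, star_star]
    simp⟩

theorem twist_injective (hact : IsModuleAlgebra H act)
    (hs : ∀ (a : A) (b : B), star (act b a) = act (star b) (star (H.antipode a))) :
    Function.Injective (twist H act) :=
  (injective_iff_map_eq_zero _).2 fun v hv => by
    have h := hact.twist_star_twist hs v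
    rw [hv] at h
    simp only [star_zero, map_zero] at h
    exact star_eq_zero.1 ((TensorProduct.comm ℂ B A).map_eq_zero_iff.1 h.symm)

theorem rt_mul_left (hact : IsModuleAlgebra H act)
    (hs : ∀ (a : A) (b : B), star (act b a) = act (star b) (star (H.antipode a)))
    (b b' : B) (a : A) : rt H act (b * b') a = lB H act b (rt H act b' a) := by
  let κ : B ⊗[ℂ] A →ₗ[ℂ] B := LinearMap.mul' ℂ B ∘ₗ (act b').lTensor B
  let μ : (A ⊗[ℂ] B) ⊗[ℂ] B →ₗ[ℂ] A ⊗[ℂ] B :=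
    (LinearMap.mul' ℂ B).lTensor A ∘ₗ (TensorProduct.assoc ℂ A B B).toLinearMap
  have hμ : ∀ (s : A) z, (LinearMap.mulLeft ℂ s).rTensor B (μ z) =
      μ (((LinearMap.mulLeft ℂ s).rTensor B).rTensor B z) := by
    intro s z
    simp only [μ, LinearMap.comp_apply, LinearEquiv.coe_coe]
    rw [rTensor_lTensor, rTensor_assoc]
  -- For `R(v) = s ⊗ t` both sides are `∑ sa₍₁₎ ⊗ (t ◁ a₍₂₎)(b' ◁ a₍₃₎)`, bracketed differently. On
  -- the range of `R` right multiplication by `a` is `R(b ⊗ fa)`, so the factor `f` covers the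
  -- coproduct. Surjectivity of `R` then gives the identity at `s ⊗ b`.
  have h1 : ∀ v : B ⊗[ℂ] A, κ.lTensor A (rAΔ H act a (twist H act v)) =
      μ (((rA H act).flip (twist H act v)).rTensor B (rt H act b' a)) := by
    intro v
    induction v with
    | zero => simp
    | add x y hx hy => simp only [map_add, LinearMap.rTensor_add, LinearMap.add_apply, hx, hy]
    | tmul b f =>
      rw [← rt_apply, ← hact.rt_comp_mulLeft, LinearMap.rTensor_comp_apply, hact.mulLeft_rt,
        ← hact.assoc_rt_l₁, rTensor_lTensor]
      simp only [μ, κ, LinearMap.comp_apply, LinearEquiv.coe_coe, LinearMap.lTensor_comp_apply]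
      rw [lTensor_lTensor_assoc]
  refine H.ext_mulLeft_rTensor fun s => ?_
  obtain ⟨v, hv⟩ := hact.twist_surjective hs (s ⊗ₜ b)
  have h2 := h1 v
  rw [hv, rAΔ_tmul, ← LinearMap.lTensor_comp_apply] at h2
  have h3 : κ ∘ₗ ro H act b = act (b * b') := LinearMap.ext fun x => (hact.act_mul_ro b b' x).symm
  have h4 : (rA H act).flip (s ⊗ₜ b) = (LinearMap.mulLeft ℂ s).rTensor B ∘ₗ rt H act b :=
    LinearMap.ext fun x => by rw [LinearMap.flip_apply, rA_tmul]; rfl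
  rw [h3, h4, LinearMap.rTensor_comp_apply, ← hμ] at h2
  rw [hact.mulLeft_rt, h2]
  rfl

/-- `∑ R((b ◁ a₍₁₎) ⊗ S(a₍₂₎)) = S(a) ⊗ b` -/
theorem twist_antipode_ro (hact : IsModuleAlgebra H act)
    (hs : ∀ (a : A) (b : B), star (act b a) = act (star b) (star (H.antipode a)))
    (b : B) (a : A) :
    twist H act (H.antipode.lTensor B (ro H act b a)) = H.antipode a ⊗ₜ b := by
  let lact : A ⊗[ℂ] (A ⊗[ℂ] B) →ₗ[ℂ] A ⊗[ℂ] B := (LinearMap.mul' ℂ A).rTensor B ∘ₗ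
    (TensorProduct.assoc ℂ A A B).symm.toLinearMap
  have hl : ∀ s z, lact (s ⊗ₜ z) = (LinearMap.mulLeft ℂ s).rTensor B z := by
    intro s z
    induction z with
    | zero => simp
    | tmul x y => simp [lact]
    | add x y hx hy => simp only [map_add, TensorProduct.tmul_add, hx, hy]
  let F : A →ₗ[ℂ] A ⊗[ℂ] B := twist H act ∘ₗ H.antipode.lTensor B ∘ₗ ro H act b
  let G : A →ₗ[ℂ] A ⊗[ℂ] B := (TensorProduct.mk ℂ A B).flip b ∘ₗ H.antipode
  -- `χ` sends `z ⊗ q` to `zS(q)`. Hence on `∑ wa₍₁₎ ⊗ a₍₂₎` it gives `∑ wa₍₁₎S(a₍₂₎) = ε(a)w`,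
  -- which is the content of `h1`.
  let χ : A ⊗[ℂ] (B ⊗[ℂ] A) →ₗ[ℂ] A ⊗[ℂ] B :=
    lact ∘ₗ (twist H act ∘ₗ H.antipode.lTensor B).lTensor A
  have hχ : ∀ (z : A ⊗[ℂ] B) (q : A), χ (TensorProduct.assoc ℂ A B A (z ⊗ₜ q)) =
      rA H act (H.antipode q) z := by
    intro z q
    induction z with
    | zero => simp
    | add x y hx hy => simp only [map_add, TensorProduct.add_tmul, hx, hy]
    | tmul s t =>
      rw [rA_tmul, TensorProduct.assoc_tmul]
      simp only [χ, LinearMap.comp_apply, LinearMap.lTensor_tmul, hl]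
      rfl
  have h1 : ∀ (a : A) (v : B ⊗[ℂ] A), χ (rAΔ H act a (twist H act v)) =
      H.counit a • twist H act v := by
    intro a v
    induction v with
    | zero => simp
    | add x y hx hy => simp only [map_add, smul_add, hx, hy]
    | tmul b f =>
      rw [← rt_apply, ← hact.assoc_rt_l₁]
      have h2 : ∀ z : A ⊗[ℂ] A, χ (TensorProduct.assoc ℂ A B A ((rt H act b).rTensor A z)) =
          rt H act b (LinearMap.mul' ℂ A (H.antipode.lTensor A z)) := by
        intro z
        induction z with
        | zero => simp
        | add x y hx hy => simp only [map_add, hx, hy]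
        | tmul x y => simp [hχ, hact.rt_mul_right]
      rw [h2, H.antipode_l₁, map_smul]
  -- For `z = (s ⊗ 1)Δ(a)` both sides are `ε(a)(s ⊗ b)`. As `T₂` is onto, `z` may then be any `s ⊗
  -- a`, and `s` is cancelled at the end.
  have h3 : ∀ z : A ⊗[ℂ] A, lact (F.lTensor A z) = lact (G.lTensor A z) := by
    intro z
    obtain ⟨u, rfl⟩ := H.T₂.surjective z
    induction u with
    | zero => simp
    | add x y hx hy => simp only [map_add, hx, hy]
    | tmul s a =>
      obtain ⟨v, hv⟩ := hact.twist_surjective hs (s ⊗ₜ b)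
      have h4 := h1 a v
      rw [hv, rAΔ_tmul] at h4
      simp only [χ, LinearMap.comp_apply] at h4
      rw [← LinearMap.lTensor_comp_apply, LinearMap.comp_assoc] at h4
      have h5 : ∀ z : A ⊗[ℂ] A, lact (G.lTensor A z) =
          LinearMap.mul' ℂ A (H.antipode.lTensor A z) ⊗ₜ b := by
        intro z
        induction z with
        | zero => simp
        | add x y hx hy => simp only [map_add, TensorProduct.add_tmul, hx, hy]
        | tmul x y => simp [G, hl]
      rw [h5, ← H.l₁_apply, H.antipode_l₁, ← TensorProduct.smul_tmul']
      exact h4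
  refine H.ext_mulLeft_rTensor fun s => ?_
  have h6 := h3 (s ⊗ₜ a)
  rw [LinearMap.lTensor_tmul, LinearMap.lTensor_tmul, hl, hl] at h6
  exact h6

/-- `R(b^* ⊗ S(a)^*) = ∑ S(a₍₂₎)^* ⊗ (b ◁ a₍₁₎)^*` -/
theorem twist_star_antipode (hact : IsModuleAlgebra H act)
    (hs : ∀ (a : A) (b : B), star (act b a) = act (star b) (star (H.antipode a)))
    (b : B) (a : A) :
    twist H act (star b ⊗ₜ star (H.antipode a)) =
      star (H.antipode.rTensor B (TensorProduct.comm ℂ B A (ro H act b a))) := by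
  have h := hact.twist_star_twist hs (H.antipode.lTensor B (ro H act b a))
  rw [hact.twist_antipode_ro hs, TensorProduct.star_tmul, TensorProduct.comm_tmul] at h
  rw [h, ← comm_lTensor]
  generalize H.antipode.lTensor B (ro H act b a) = w
  induction w with
  | zero => simp
  | add x y hx hy => simp only [map_add, star_add, hx, hy]
  | tmul x y => simp

end IsModuleAlgebra

end Action

end Bicross
end

noncomputable section

namespace Bicross

namespace Smash

variable {A : Type*} [NonUnitalRing A] [Module ℂ A] [IsScalarTower ℂ A A] [SMulCommClass ℂ A A]
  [StarRing A] [StarModule ℂ A]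
  {B : Type*} [NonUnitalRing B] [Module ℂ B] [IsScalarTower ℂ B B] [SMulCommClass ℂ B B]
  (H : MultiplierHopfStarAlgebra A) (act : B →ₗ[ℂ] A →ₗ[ℂ] B)

/-! ### `AB` as a bimodule over `A` and `B` -/

/-- `leftA a x = a x` -/
def leftA : A →ₗ[ℂ] Smash H act →ₗ[ℂ] Smash H act :=
  (LinearMap.rTensorHom B ∘ₗ LinearMap.mul ℂ A : A →ₗ[ℂ] A ⊗[ℂ] B →ₗ[ℂ] A ⊗[ℂ] B)

/-- `rightA a x = x a` -/
def rightA : A →ₗ[ℂ] Smash H act →ₗ[ℂ] Smash H act := rA H act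

/-- `leftB b x = b x` -/
def leftB : B →ₗ[ℂ] Smash H act →ₗ[ℂ] Smash H act := lB H act

/-- `rightB b x = x b` -/
def rightB : B →ₗ[ℂ] Smash H act →ₗ[ℂ] Smash H act :=
  (LinearMap.lTensorHom A ∘ₗ (LinearMap.mul ℂ B).flip : B →ₗ[ℂ] A ⊗[ℂ] B →ₗ[ℂ] A ⊗[ℂ] B)

variable {H act}

theorem induction {p : Smash H act → Prop} (zero : p 0) (add : ∀ x y, p x → p y → p (x + y))
    (tmul : ∀ a b, p (ab H act a b)) (x : Smash H act) : p x :=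
  TensorProduct.induction_on (motive := p) x zero tmul add

theorem ba_eq (b : B) (a : A) : ba H act b a = equiv H act (rt H act b a) := rfl

theorem ab_eq (a : A) (b : B) : ab H act a b = equiv H act (a ⊗ₜ b) := rfl

@[simp] theorem leftA_ab (a a' : A) (b : B) :
    leftA H act a (ab H act a' b) = ab H act (a * a') b := rfl

@[simp] theorem rightB_ab (a : A) (b b' : B) :
    rightB H act b (ab H act a b') = ab H act a (b' * b) := rfl

theorem rightA_ab (a a' : A) (b : B) :
    rightA H act a (ab H act a' b) = leftA H act a' (ba H act b a) :=
  rA_tmul a a' b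

theorem leftB_ab (a : A) (b b' : B) :
    leftB H act b (ab H act a b') = rightB H act b' (ba H act b a) :=
  lB_tmul b a b'

theorem leftA_rightB (a : A) (b : B) (x : Smash H act) :
    leftA H act a (rightB H act b x) = rightB H act b (leftA H act a x) :=
  rTensor_lTensor (LinearMap.mulLeft ℂ a) (LinearMap.mulRight ℂ b) x

theorem rightB_mul (b b' : B) (x : Smash H act) :
    rightB H act (b * b') x = rightB H act b' (rightB H act b x) := by
  induction x using induction with
  | zero => simp
  | add x y hx hy => simp only [map_add, hx, hy]
  | tmul a c => simp [mul_assoc]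

theorem rightA_mul (hact : IsModuleAlgebra H act) (a a' : A) (x : Smash H act) :
    rightA H act (a * a') x = rightA H act a' (rightA H act a x) :=
  hact.rA_mul a a' x

/-- This reduces the product of `AB` to the one-sided actions of `A` and `B`. -/
theorem mul_ab (x : Smash H act) (a : A) (b : B) :
    x * ab H act a b = rightB H act b (rightA H act a x) := by
  have h : ∀ z : A ⊗[ℂ] B, mulAux H act (z ⊗ₜ (a ⊗ₜ b)) =
      (LinearMap.mulRight ℂ b).lTensor A (rA H act a z) := by
    intro z
    induction z with
    | zero => simp
    | add x y hx hy => simp only [map_add, TensorProduct.add_tmul, hx, hy]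
    | tmul s t =>
      rw [rA_tmul, rt_apply]
      simp only [mulAux, LinearMap.comp_apply, LinearEquiv.coe_coe, TensorProduct.assoc_tmul,
        LinearMap.lTensor_tmul, leg12_tmul]
      generalize twist H act (t ⊗ₜ a) = w
      induction w with
      | zero => simp
      | add x y hx hy => simp only [map_add, TensorProduct.add_tmul, TensorProduct.tmul_add, hx, hy]
      | tmul x y => simp
  exact h x

theorem mul_rightB (x y : Smash H act) (b : B) :
    x * rightB H act b y = rightB H act b (x * y) := by
  induction y using induction with
  | zero => simp
  | add y y' hx hy => simp only [map_add, mul_add, hx, hy]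
  | tmul a c => rw [rightB_ab, mul_ab, mul_ab, rightB_mul]

theorem rightA_mul_eq (hact : IsModuleAlgebra H act) (x y : Smash H act) (a : A) :
    rightA H act a x * y = x * leftA H act a y := by
  induction y using induction with
  | zero => simp
  | add y y' hx hy => simp only [map_add, mul_add, hx, hy]
  | tmul a c => rw [leftA_ab, mul_ab, mul_ab, rightA_mul hact]

theorem ab_mul (a : A) (b : B) (y : Smash H act) :
    ab H act a b * y = leftA H act a (leftB H act b y) := by
  induction y using induction with
  | zero => simp
  | add y y' hx hy => simp only [map_add, mul_add, hx, hy]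
  | tmul a' c => rw [mul_ab, rightA_ab, leftB_ab, leftA_rightB]

theorem mul_ba_eq (hact : IsModuleAlgebra H act) (b : B) (a : A) (y : Smash H act) :
    ba H act b a * y = leftB H act b (leftA H act a y) := by
  induction y using induction with
  | zero => simp
  | add y y' hx hy => simp only [map_add, mul_add, hx, hy]
  | tmul a' c =>
    rw [mul_ab, leftA_ab, leftB_ab]
    congr 1
    exact (hact.rt_mul_right b a a').symm

variable [StarRing B] [StarModule ℂ B]

/-- On `x = st` both sides are `s` times `R(tb ⊗ a)`, respectively `tR(b ⊗ a)`; this is where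
`rt_mul_left` enters. -/
theorem mul_ba (hact : IsModuleAlgebra H act)
    (hs : ∀ (a : A) (b : B), star (act b a) = act (star b) (star (H.antipode a)))
    (x : Smash H act) (b : B) (a : A) :
    x * ba H act b a = rightA H act a (rightB H act b x) := by
  induction x using induction with
  | zero => simp
  | add y y' hx hy => simp only [map_add, add_mul, hx, hy]
  | tmul s t =>
    rw [ab_mul, rightB_ab, rightA_ab]
    congr 1
    exact (hact.rt_mul_left hs t b a).symm

theorem rightB_mul_eq (hact : IsModuleAlgebra H act)
    (hs : ∀ (a : A) (b : B), star (act b a) = act (star b) (star (H.antipode a)))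
    (x y : Smash H act) (b : B) :
    rightB H act b x * y = x * leftB H act b y := by
  induction y using induction with
  | zero => simp
  | add y y' hx hy => simp only [map_add, mul_add, hx, hy]
  | tmul a c => rw [leftB_ab, mul_rightB, mul_ba hact hs, mul_ab]

theorem mul_rightA (hact : IsModuleAlgebra H act)
    (hs : ∀ (a : A) (b : B), star (act b a) = act (star b) (star (H.antipode a)))
    (x y : Smash H act) (a : A) :
    x * rightA H act a y = rightA H act a (x * y) := by
  induction y using induction with
  | zero => simp
  | add y y' hx hy => simp only [map_add, mul_add, hx, hy]
  | tmul a' c => rw [rightA_ab, ← rightA_mul_eq hact, mul_ba hact hs, mul_ab]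

/-- Right multiplication by `ac` is right multiplication by `a` followed by that by `c`, and each
commutes with left multiplication by `x`. -/
theorem mul_assoc' (hact : IsModuleAlgebra H act)
    (hs : ∀ (a : A) (b : B), star (act b a) = act (star b) (star (H.antipode a)))
    (x y z : Smash H act) : x * y * z = x * (y * z) := by
  induction z using induction with
  | zero => simp
  | add y y' hx hy => simp only [mul_add, hx, hy]
  | tmul a c => rw [mul_ab, mul_ab, mul_rightB, mul_rightA hact hs]

/-- Write `x = R(v)`. Cancelling `b` in `x(ab) = 0` gives `0 = xa = R(v(1 ⊗ a))`, and `R` is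
injective. -/
theorem eq_zero_of_mul (HB : MultiplierHopfStarAlgebra B) (hact : IsModuleAlgebra H act)
    (hs : ∀ (a : A) (b : B), star (act b a) = act (star b) (star (H.antipode a)))
    (x : Smash H act) (hx : ∀ y, x * y = 0) : x = 0 := by
  obtain ⟨v, hv⟩ := hact.twist_surjective hs ((equiv H act).symm x)
  have h1 : ∀ a, rA H act a (twist H act v) = 0 := fun a => by
    refine HB.ext_mulRight_lTensor fun b => ?_
    rw [hv, map_zero]
    exact (mul_ab x a b).symm.trans (hx _)
  have h2 : ∀ (a : A) (v : B ⊗[ℂ] A), rA H act a (twist H act v) =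
      twist H act ((LinearMap.mulRight ℂ a).lTensor B v) := by
    intro a v
    induction v with
    | zero => simp
    | add x y hx hy => simp only [map_add, hx, hy]
    | tmul b a' => exact (hact.rt_mul_right b a' a).symm
  have h3 : v = 0 := H.ext_mulRight_lTensor fun a => hact.twist_injective hs (by
    rw [← h2, h1, map_zero, map_zero])
  rw [h3, map_zero] at hv
  exact (equiv H act).symm.map_eq_zero_iff.1 hv.symm

/-! ### The involution -/

theorem involution_equiv (z : A ⊗[ℂ] B) : involution H act (equiv H act z) =
    equiv H act (twist H act (TensorProduct.comm ℂ A B (star z))) := rfl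

theorem involution_involution (hact : IsModuleAlgebra H act)
    (hs : ∀ (a : A) (b : B), star (act b a) = act (star b) (star (H.antipode a)))
    (x : Smash H act) : involution H act (involution H act x) = x := by
  obtain ⟨z, rfl⟩ := (equiv H act).surjective x
  rw [involution_equiv, involution_equiv, hact.twist_star_twist hs]
  congr 1
  generalize hw : star z = w
  rw [star_eq_iff_star_eq] at hw
  rw [← hw]
  clear hw
  induction w with
  | zero => simp
  | add x y hx hy => simp only [map_add, star_add, hx, hy]
  | tmul x y => simp

theorem involution_rightB (hact : IsModuleAlgebra H act)
    (hs : ∀ (a : A) (b : B), star (act b a) = act (star b) (star (H.antipode a)))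
    (b : B) (x : Smash H act) :
    involution H act (rightB H act b x) = leftB H act (star b) (involution H act x) := by
  induction x using induction with
  | zero => simp
  | add y y' hx hy => simp only [map_add, hx, hy]
  | tmul a c =>
    rw [rightB_ab, involution_ab, involution_ab, star_mul]
    exact hact.rt_mul_left hs _ _ _

theorem involution_leftA (hact : IsModuleAlgebra H act)
    (a : A) (x : Smash H act) :
    involution H act (leftA H act a x) = rightA H act (star a) (involution H act x) := by
  induction x using induction with
  | zero => simp
  | add y y' hx hy => simp only [map_add, hx, hy]
  | tmul a c =>
    rw [leftA_ab, involution_ab, involution_ab, star_mul]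
    exact hact.rt_mul_right _ _ _

theorem involution_rightA (hact : IsModuleAlgebra H act)
    (hs : ∀ (a : A) (b : B), star (act b a) = act (star b) (star (H.antipode a)))
    (a : A) (x : Smash H act) :
    involution H act (rightA H act a x) = leftA H act (star a) (involution H act x) := by
  rw [← involution_involution hact hs (leftA H act (star a) (involution H act x)),
    involution_leftA hact, star_star, involution_involution hact hs]

theorem involution_mul (hact : IsModuleAlgebra H act)
    (hs : ∀ (a : A) (b : B), star (act b a) = act (star b) (star (H.antipode a)))
    (x y : Smash H act) :
    involution H act (x * y) = involution H act y * involution H act x := by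
  induction y using induction with
  | zero => simp
  | add y y' hx hy => simp only [map_add, mul_add, add_mul, hx, hy]
  | tmul a c =>
    rw [mul_ab, involution_rightB hact hs, involution_rightA hact hs, involution_ab,
      mul_ba_eq hact]

theorem eq_zero_of_mul_left (HB : MultiplierHopfStarAlgebra B) (hact : IsModuleAlgebra H act)
    (hs : ∀ (a : A) (b : B), star (act b a) = act (star b) (star (H.antipode a)))
    (x : Smash H act) (hx : ∀ y, y * x = 0) : x = 0 := by
  have h : involution H act x = 0 := eq_zero_of_mul HB hact hs _ fun y => by
    rw [← involution_involution hact hs y, ← involution_mul hact hs, hx, map_zero]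
  rw [← involution_involution hact hs x, h, map_zero]

end Smash

end Bicross
end

noncomputable section

namespace Bicross

/-! ### Left coactions: counit identity, injectivity of the cotwist map. -/

section Coaction

variable {A : Type*} [NonUnitalRing A] [Module ℂ A]
  {B : Type*} [NonUnitalRing B] [Module ℂ B] [IsScalarTower ℂ B B] [SMulCommClass ℂ B B]
  [StarRing B] [StarModule ℂ B]
  {HB : MultiplierHopfStarAlgebra B} {Γ : A →ₗ[ℂ] M₀ B A}

theorem mulLeft_cotwist (a : A) (b b' : B) :
    (LinearMap.mulLeft ℂ b').rTensor A (cotwist Γ (a ⊗ₜ b)) =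
      (LinearMap.mulRight ℂ b).rTensor A (cotwistOp Γ (a ⊗ₜ b')) :=
  (Γ a).2 b b'

theorem mulRight_rTensor_mul (x y : B) (z : B ⊗[ℂ] A) :
    (LinearMap.mulRight ℂ (x * y)).rTensor A z =
      (LinearMap.mulRight ℂ y).rTensor A ((LinearMap.mulRight ℂ x).rTensor A z) := by
  rw [← LinearMap.rTensor_comp_apply]
  congr 2
  ext w
  simp

theorem mulLeft_rTensor_mul (x y : B) (z : B ⊗[ℂ] A) :
    (LinearMap.mulLeft ℂ (x * y)).rTensor A z =
      (LinearMap.mulLeft ℂ x).rTensor A ((LinearMap.mulLeft ℂ y).rTensor A z) := by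
  rw [← LinearMap.rTensor_comp_apply]
  congr 2
  ext w
  simp

theorem mulLeft_mulRight_rTensor (x y : B) (z : B ⊗[ℂ] A) :
    (LinearMap.mulLeft ℂ x).rTensor A ((LinearMap.mulRight ℂ y).rTensor A z) =
      (LinearMap.mulRight ℂ y).rTensor A ((LinearMap.mulLeft ℂ x).rTensor A z) := by
  rw [← LinearMap.rTensor_comp_apply, ← LinearMap.rTensor_comp_apply]
  congr 2
  ext w
  simp [mul_assoc]

/-- `B`-linearity of `b ↦ y(b ⊗ 1)` is not part of `M₀`; it follows from the compatibility of the
two covered products and non-degeneracy. -/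
theorem cotwist_mul (HB : MultiplierHopfStarAlgebra B) (a : A) (b c : B) :
    cotwist Γ (a ⊗ₜ (b * c)) = (LinearMap.mulRight ℂ c).rTensor A (cotwist Γ (a ⊗ₜ b)) :=
  HB.ext_mulLeft_rTensor fun b' => by
    rw [mulLeft_cotwist, mulRight_rTensor_mul, ← mulLeft_cotwist, mulLeft_mulRight_rTensor]

theorem cotwistOp_mul (HB : MultiplierHopfStarAlgebra B) (a : A) (b c : B) :
    cotwistOp Γ (a ⊗ₜ (c * b)) = (LinearMap.mulLeft ℂ c).rTensor A (cotwistOp Γ (a ⊗ₜ b)) :=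
  HB.ext_mulRight_rTensor fun b' => by
    rw [← mulLeft_cotwist, mulLeft_rTensor_mul, mulLeft_cotwist, mulLeft_mulRight_rTensor]

theorem cotwist_lTensor_mulRight (HB : MultiplierHopfStarAlgebra B) (c : B) (z : A ⊗[ℂ] B) :
    cotwist Γ ((LinearMap.mulRight ℂ c).lTensor A z) =
      (LinearMap.mulRight ℂ c).rTensor A (cotwist Γ z) := by
  induction z with
  | zero => simp
  | add x y hx hy => simp only [map_add, hx, hy]
  | tmul a b => exact cotwist_mul HB a b c

theorem cotwistOp_lTensor_mulLeft (HB : MultiplierHopfStarAlgebra B) (c : B) (z : A ⊗[ℂ] B) :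
    cotwistOp Γ ((LinearMap.mulLeft ℂ c).lTensor A z) =
      (LinearMap.mulLeft ℂ c).rTensor A (cotwistOp Γ z) := by
  induction z with
  | zero => simp
  | add x y hx hy => simp only [map_add, hx, hy]
  | tmul a b => exact cotwistOp_mul HB a b c

theorem MultiplierHopfStarAlgebra.counit₁_mulLeft (HB : MultiplierHopfStarAlgebra B)
    {V : Type*} [AddCommGroup V] [Module ℂ V] (b : B) (z : B ⊗[ℂ] V) :
    HB.counit₁ V ((LinearMap.mulLeft ℂ b).rTensor V z) = HB.counit b • HB.counit₁ V z := by
  induction z with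
  | zero => simp
  | add x y hx hy => simp only [map_add, smul_add, hx, hy]
  | tmul a c => simp [HB.counit_mul, mul_smul]

theorem MultiplierHopfStarAlgebra.counit₁_mulRight (HB : MultiplierHopfStarAlgebra B)
    {V : Type*} [AddCommGroup V] [Module ℂ V] (b : B) (z : B ⊗[ℂ] V) :
    HB.counit₁ V ((LinearMap.mulRight ℂ b).rTensor V z) = HB.counit b • HB.counit₁ V z := by
  induction z with
  | zero => simp
  | add x y hx hy => simp only [map_add, smul_add, hx, hy]
  | tmul a c => simp [HB.counit_mul, smul_smul, mul_comm]

/-- An element of the image of `Γ` is determined by its products with `B` from the right. -/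
theorem coaction_ext (HB : MultiplierHopfStarAlgebra B) {a a' : A}
    (h : ∀ b, cotwist Γ (a ⊗ₜ b) = cotwist Γ (a' ⊗ₜ b)) : Γ a = Γ a' := by
  refine Subtype.ext (Prod.ext (LinearMap.ext h) (LinearMap.ext fun b => ?_))
  change cotwistOp Γ (a ⊗ₜ b) = cotwistOp Γ (a' ⊗ₜ b)
  exact HB.ext_mulRight_rTensor fun c => by
    rw [← mulLeft_cotwist, ← mulLeft_cotwist, h]

namespace IsCoaction

/-- Put `θ = (ε ⊗ ι)((b₀ ⊗ 1)Γ(a))` with `ε(b₀) = 1`. Applying `ε` to the first leg of the coaction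
identity gives `Γ(θ) = Γ(a)`, and injectivity of `Γ` yields `θ = a`. -/
theorem counit₁_cotwist (hΓ : IsCoaction HB Γ) (a : A) (p : B) :
    HB.counit₁ A (cotwist Γ (a ⊗ₜ p)) = HB.counit p • a := by
  by_cases hp : p = 0
  · simp [hp]
  obtain ⟨b₀, hb₀⟩ := HB.exists_counit_eq_one p hp
  have hE : ∀ a b, HB.counit₁ A (cotwist Γ (a ⊗ₜ b)) =
      HB.counit b • HB.counit₁ A (cotwistOp Γ (a ⊗ₜ b₀)) := by
    intro a b
    have h := congrArg (HB.counit₁ A) (mulLeft_cotwist (Γ := Γ) a b b₀)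
    rwa [HB.counit₁_mulLeft, HB.counit₁_mulRight, hb₀, one_smul] at h
  set θ := HB.counit₁ A (cotwistOp Γ (a ⊗ₜ b₀)) with hθ
  have h1 : ∀ p q, cotwist Γ (θ ⊗ₜ (p * q)) = cotwist Γ (a ⊗ₜ (p * q)) := by
    intro p q
    have h := congrArg (HB.counit₁ (B ⊗[ℂ] A)) (hΓ.coassoc a p q)
    have h2 : ∀ z : B ⊗[ℂ] B, HB.counit₁ (B ⊗[ℂ] A)
        (leg23 B (cotwist Γ) (leg12 B (cotwist Γ) (a ⊗ₜ z))) =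
          cotwist Γ (θ ⊗ₜ HB.counit₁ B z) := by
      intro z
      induction z with
      | zero => simp
      | add x y hx hy => simp only [map_add, TensorProduct.tmul_add, hx, hy]
      | tmul g k =>
        have h3 : ∀ w : B ⊗[ℂ] A, HB.counit₁ (A ⊗[ℂ] B) (TensorProduct.assoc ℂ B A B (w ⊗ₜ k)) =
            HB.counit₁ A w ⊗ₜ k := by
          intro w
          induction w with
          | zero => simp
          | add x y hx hy => simp only [map_add, TensorProduct.add_tmul, hx, hy]
          | tmul x y => simp [TensorProduct.smul_tmul']
        rw [leg12_tmul, leg23, HB.counit₁_lTensor, h3, hE, HB.counit₁_tmul,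
          TensorProduct.smul_tmul]
    have h4 : ∀ w : B ⊗[ℂ] A, HB.counit₁ (B ⊗[ℂ] A) (leg12 A HB.T₁.toLinearMap
        ((TensorProduct.mk ℂ B A q).lTensor B w)) = (LinearMap.mulRight ℂ q).rTensor A w := by
      intro w
      induction w with
      | zero => simp
      | add x y hx hy => simp only [map_add, hx, hy]
      | tmul m n =>
        have h5 : ∀ z : B ⊗[ℂ] B, HB.counit₁ (B ⊗[ℂ] A) (TensorProduct.assoc ℂ B B A (z ⊗ₜ n)) =
            HB.counit₁ B z ⊗ₜ n := by
          intro w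
          induction w with
          | zero => simp
          | add x y hx hy => simp only [map_add, TensorProduct.add_tmul, hx, hy]
          | tmul x y => simp [TensorProduct.smul_tmul']
        rw [LinearMap.lTensor_tmul, TensorProduct.mk_apply, leg12_tmul, h5, LinearEquiv.coe_coe,
          HB.counit₁_T₁]
        simp
    rwa [h2, h4, HB.counit₁_T₁, LinearMap.mul'_apply, ← cotwist_mul HB] at h
  have h2 : Γ θ = Γ a := coaction_ext HB fun b => by
    obtain ⟨z, rfl⟩ := HB.mul'_surjective b
    induction z with
    | zero => simp
    | add x y hx hy => simp only [map_add, TensorProduct.tmul_add, hx, hy]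
    | tmul x y => exact h1 x y
  rw [hE, ← hθ, hΓ.injective h2]

/-- The coassociativity of `Γ` in operator form. -/
theorem cotwist_T₁ (hΓ : IsCoaction HB Γ) (w : A ⊗[ℂ] (B ⊗[ℂ] B)) :
    leg23 B (cotwist Γ) (leg12 B (cotwist Γ) (HB.T₁.toLinearMap.lTensor A w)) =
      leg12 A HB.T₁.toLinearMap
        ((TensorProduct.comm ℂ A B).toLinearMap.lTensor B (leg12 B (cotwist Γ) w)) := by
  induction w with
  | zero => simp
  | add x y hx hy => simp only [map_add, hx, hy]
  | tmul a w =>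
    induction w with
    | zero => simp
    | add x y hx hy => simp only [map_add, TensorProduct.tmul_add, hx, hy]
    | tmul p q =>
      rw [LinearMap.lTensor_tmul, LinearEquiv.coe_coe, hΓ.coassoc, leg12_tmul]
      congr 1
      generalize cotwist Γ (a ⊗ₜ p) = w
      induction w with
      | zero => simp
      | add x y hx hy => simp only [map_add, TensorProduct.add_tmul, hx, hy]
      | tmul x y => simp

/-- If `T(z) = 0`, put `w = (ι ⊗ T₁⁻¹)(z ⊗ q)`. The coaction identity and injectivity of `T₁` force
`T₁₂ w = 0`, and the counit identity for `Γ` gives `(ι ⊗ ε ⊗ ι)w = 0`. But `(ε ⊗ ι)T₁⁻¹(p ⊗ q) =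
S(p)q`, so `(ι ⊗ S)(z)` is killed by every `1 ⊗ q`. -/
theorem cotwist_injective (hΓ : IsCoaction HB Γ) : Function.Injective (cotwist Γ) := by
  refine (injective_iff_map_eq_zero _).2 fun z hz => ?_
  have h1 : ∀ q : B, (LinearMap.mulRight ℂ q).lTensor A (HB.antipode.lTensor A z) = 0 := by
    intro q
    set w := HB.T₁.symm.toLinearMap.lTensor A (TensorProduct.assoc ℂ A B B (z ⊗ₜ q)) with hw
    have h2 := hΓ.cotwist_T₁ w
    have h3 : HB.T₁.toLinearMap ∘ₗ HB.T₁.symm.toLinearMap = LinearMap.id := by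
      ext x; simp
    rw [hw, ← LinearMap.lTensor_comp_apply, h3, LinearMap.lTensor_id, LinearMap.id_apply,
      leg12_assoc_tmul, hz, TensorProduct.zero_tmul, map_zero, map_zero, ← hw] at h2
    have h4 := leg12_injective (V := A) (f := HB.T₁.toLinearMap) HB.T₁.injective
      (h2.symm.trans (map_zero _).symm)
    have h5 := Module.Flat.lTensor_preserves_injective_linearMap (M := B)
      (TensorProduct.comm ℂ A B).toLinearMap (TensorProduct.comm ℂ A B).injective
      (h4.trans (map_zero _).symm)
    have h6 : ∀ w : A ⊗[ℂ] (B ⊗[ℂ] B), HB.counit₁ (A ⊗[ℂ] B) (leg12 B (cotwist Γ) w) =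
        (HB.counit₁ B).lTensor A w := by
      intro w
      induction w with
      | zero => simp
      | add x y hx hy => simp only [map_add, hx, hy]
      | tmul a w =>
        induction w with
        | zero => simp
        | add x y hx hy => simp only [map_add, TensorProduct.tmul_add, hx, hy]
        | tmul g k =>
          have h3 : ∀ w : B ⊗[ℂ] A, HB.counit₁ (A ⊗[ℂ] B)
              (TensorProduct.assoc ℂ B A B (w ⊗ₜ k)) = HB.counit₁ A w ⊗ₜ k := by
            intro w
            induction w with
            | zero => simp
            | add x y hx hy => simp only [map_add, TensorProduct.add_tmul, hx, hy]
            | tmul x y => simp [TensorProduct.smul_tmul']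
          rw [leg12_tmul, h3, hΓ.counit₁_cotwist, LinearMap.lTensor_tmul, HB.counit₁_tmul,
            TensorProduct.smul_tmul]
    have h7 := h6 w
    rw [h5, map_zero, hw, ← LinearMap.lTensor_comp_apply] at h7
    rw [h7]
    clear h7 h5 h4 h2 hw w hz
    induction z with
    | zero => simp
    | add x y hx hy => simp only [map_add, TensorProduct.add_tmul, hx, hy]
    | tmul a p =>
      simp only [LinearMap.lTensor_tmul, TensorProduct.assoc_tmul, LinearMap.mulRight_apply,
        HB.antipode_mul_eq]
      rfl
  have h2 : HB.antipode.lTensor A z = 0 := HB.ext_mulRight_lTensor fun q => by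
    rw [h1, map_zero]
  exact Module.Flat.lTensor_preserves_injective_linearMap (M := A) _ HB.antipode_injective
    (h2.trans (map_zero _).symm)

end IsCoaction

variable (HB) (A) in
/-- `m ⊗ n ↦ (m ⊗ n ⊗ 1)Δ₁₃(l)` -/
def insertΔ (l : B) : B ⊗[ℂ] A →ₗ[ℂ] B ⊗[ℂ] (A ⊗[ℂ] B) :=
  (TensorProduct.comm ℂ B A).toLinearMap.lTensor B ∘ₗ leg12 A HB.T₂.toLinearMap ∘ₗ
    (TensorProduct.mk ℂ B A l).lTensor B

theorem insertΔ_tmul (l m : B) (n : A) : insertΔ A HB l (m ⊗ₜ n) =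
    (TensorProduct.comm ℂ B A).toLinearMap.lTensor B
      (TensorProduct.assoc ℂ B B A (HB.l₁ m l ⊗ₜ n)) := by
  simp only [insertΔ, LinearMap.comp_apply, LinearMap.lTensor_tmul, TensorProduct.mk_apply,
    leg12_tmul]
  rfl

namespace IsCoaction

/-- The coaction identity covered by `p` on the left instead of by `q` on the right. Multiplying the
middle leg by `q` leads back to the axiom. -/
theorem cotwist_insertΔ (hΓ : IsCoaction HB Γ) (a : A) (p b : B) :
    leg23 B (cotwist Γ) (insertΔ A HB b (cotwistOp Γ (a ⊗ₜ p))) =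
      leg12 A HB.T₂.toLinearMap (p ⊗ₜ cotwist Γ (a ⊗ₜ b)) := by
  refine HB.ext_mulRight_rTensor_lTensor fun q => ?_
  have h1 : (LinearMap.mulRight ℂ q).rTensor A ∘ₗ cotwist Γ =
      cotwist Γ ∘ₗ (LinearMap.mulRight ℂ q).lTensor A :=
    LinearMap.ext fun z => (cotwist_lTensor_mulRight HB q z).symm
  rw [leg23, ← LinearMap.lTensor_comp_apply, h1, LinearMap.lTensor_comp_apply]
  let G : B ⊗[ℂ] A → B →ₗ[ℂ] B ⊗[ℂ] A :=
    (LinearMap.rTensorHom A ∘ₗ (LinearMap.mul ℂ B).flip).flip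
  have hG : ∀ W g, G W g = (LinearMap.mulRight ℂ g).rTensor A W := fun _ _ => rfl
  have h2 : ∀ W : B ⊗[ℂ] A, ((LinearMap.mulRight ℂ q).lTensor A).lTensor B (insertΔ A HB b W) =
      TensorProduct.assoc ℂ B A B ((G W).rTensor B (HB.r₂ q b)) := by
    intro W
    induction W with
    | zero => simp [G]
    | add x y hx hy =>
      have h3 : G (x + y) = G x + G y := by
        ext g; simp [hG]
      rw [h3, LinearMap.rTensor_add, LinearMap.add_apply, map_add, map_add, map_add, hx, hy]
    | tmul m n =>
      rw [insertΔ_tmul]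
      have h3 : ∀ z : B ⊗[ℂ] B, ((LinearMap.mulRight ℂ q).lTensor A).lTensor B
          ((TensorProduct.comm ℂ B A).toLinearMap.lTensor B
            (TensorProduct.assoc ℂ B B A (z ⊗ₜ n))) =
          (TensorProduct.comm ℂ B A).toLinearMap.lTensor B
            (TensorProduct.assoc ℂ B B A ((LinearMap.mulRight ℂ q).lTensor B z ⊗ₜ n)) := by
        intro z
        induction z with
        | zero => simp
        | add x y hx hy => simp only [map_add, TensorProduct.add_tmul, hx, hy]
        | tmul x y => simp
      rw [h3, ← HB.mulLeft_r₂]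
      generalize HB.r₂ q b = z
      induction z with
      | zero => simp
      | add x y hx hy => simp only [map_add, TensorProduct.add_tmul, hx, hy]
      | tmul x y => simp [hG]
  have h3 : G (cotwistOp Γ (a ⊗ₜ p)) =
      (LinearMap.mulLeft ℂ p).rTensor A ∘ₗ TensorProduct.curry (cotwist Γ) a :=
    LinearMap.ext fun g => (mulLeft_cotwist a g p).symm
  have h4 : ∀ w : B ⊗[ℂ] A, (LinearMap.mulLeft ℂ p).rTensor (B ⊗[ℂ] A)
      (leg12 A HB.T₁.toLinearMap ((TensorProduct.mk ℂ B A q).lTensor B w)) =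
      ((LinearMap.mulRight ℂ q).rTensor A).lTensor B (leg12 A HB.T₂.toLinearMap (p ⊗ₜ w)) := by
    intro w
    induction w with
    | zero => simp
    | add x y hx hy => simp only [map_add, TensorProduct.tmul_add, hx, hy]
    | tmul m n =>
      rw [LinearMap.lTensor_tmul, TensorProduct.mk_apply, leg12_tmul, leg12_tmul, rTensor_assoc,
        rTensor_lTensor_assoc, LinearMap.rTensor_tmul, LinearMap.rTensor_tmul]
      exact congrArg (fun z => TensorProduct.assoc ℂ B B A (z ⊗ₜ n)) (HB.mulLeft_r₂ p q m)
  rw [h2, h3, LinearMap.rTensor_comp_apply, ← rTensor_assoc, ← leg12_tmul', ← rTensor_lTensor,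
    ← h4, HB.r₂_apply]
  exact congrArg _ (hΓ.coassoc a b q)

end IsCoaction

end Coaction

end Bicross
end

noncomputable section

namespace Bicross

/-! ### Bijectivity of the cotwist map and the exchange relation between `R` and `P`. -/

section

variable {X Y Z V W : Type*}
  [AddCommGroup X] [Module ℂ X] [AddCommGroup Y] [Module ℂ Y] [AddCommGroup Z] [Module ℂ Z]
  [AddCommGroup V] [Module ℂ V] [AddCommGroup W] [Module ℂ W]

theorem leg13_tmul (f : X ⊗[ℂ] Y →ₗ[ℂ] Z ⊗[ℂ] W) (x : X) (v : V) (y : Y) :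
    leg13 V f (x ⊗ₜ (v ⊗ₜ y)) = (TensorProduct.mk ℂ V W v).lTensor Z (f (x ⊗ₜ y)) := by
  simp only [leg13, LinearMap.comp_apply, LinearMap.lTensor_tmul, LinearEquiv.coe_coe,
    TensorProduct.comm_tmul, leg12_tmul]
  generalize f (x ⊗ₜ y) = w
  induction w with
  | zero => simp
  | add x y hx hy => simp only [map_add, TensorProduct.add_tmul, hx, hy]
  | tmul x y => simp

end

section LeftMul

variable {A : Type*} [NonUnitalRing A] [Module ℂ A] [IsScalarTower ℂ A A] [SMulCommClass ℂ A A]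
  {V W : Type*} [AddCommGroup V] [Module ℂ V] [AddCommGroup W] [Module ℂ W]

variable (A V) in
/-- `a ⊗ z ↦ (a ⊗ 1)z` -/
def lmul : A ⊗[ℂ] (A ⊗[ℂ] V) →ₗ[ℂ] A ⊗[ℂ] V :=
  (LinearMap.mul' ℂ A).rTensor V ∘ₗ (TensorProduct.assoc ℂ A A V).symm.toLinearMap

theorem lmul_tmul (a : A) (z : A ⊗[ℂ] V) :
    lmul A V (a ⊗ₜ z) = (LinearMap.mulLeft ℂ a).rTensor V z := by
  induction z with
  | zero => simp
  | tmul x y => simp [lmul]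
  | add x y hx hy => simp only [map_add, TensorProduct.tmul_add, hx, hy]

theorem lmul_lTensor_lTensor (f : V →ₗ[ℂ] W) (z : A ⊗[ℂ] (A ⊗[ℂ] V)) :
    lmul A W ((f.lTensor A).lTensor A z) = f.lTensor A (lmul A V z) := by
  induction z with
  | zero => simp
  | add x y hx hy => simp only [map_add, hx, hy]
  | tmul a z => rw [LinearMap.lTensor_tmul, lmul_tmul, lmul_tmul, rTensor_lTensor]

end LeftMul

section

variable {A : Type*} [NonUnitalRing A] [Module ℂ A]
  {B : Type*} [NonUnitalRing B] [Module ℂ B] [IsScalarTower ℂ B B] [SMulCommClass ℂ B B]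
  [StarRing B] [StarModule ℂ B]
  {HB : MultiplierHopfStarAlgebra B} {Γ : A →ₗ[ℂ] M₀ B A}

/-- `starConj HB.antipode` is the inverse antipode, and this is the adjoint of `antipode_r₁`: `∑
b₍₂₎S⁻¹(pb₍₁₎) = ε(b)S⁻¹(p)`. -/
theorem MultiplierHopfStarAlgebra.mul_starConj_antipode_l₁ (HB : MultiplierHopfStarAlgebra B)
    (p b : B) : LinearMap.mul' ℂ B ((starConj HB.antipode).lTensor B
      (TensorProduct.comm ℂ B B (HB.l₁ p b))) = HB.counit b • starConj HB.antipode p := by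
  have h := congrArg star (HB.antipode_r₁ (star p) (star b))
  have key : ∀ z : B ⊗[ℂ] B, star (LinearMap.mul' ℂ B (HB.antipode.rTensor B z)) =
      LinearMap.mul' ℂ B ((starConj HB.antipode).lTensor B
      (TensorProduct.comm ℂ B B (star z))) := by
    intro z
    induction z with
    | zero => simp
    | add x y hx hy => simp only [map_add, star_add, hx, hy]
    | tmul x y => simp [starConj_apply]
  rw [key, HB.star_r₁, star_star, star_star, star_smul, HB.counit_star] at h
  simpa only [starConj_apply, star_star, Complex.star_def, Complex.conj_conj, RingHomCompTriple.comp_apply, RingHom.id_apply, starRingEnd_self_apply] using h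

/-- Apply `θ(m ⊗ n) = nS⁻¹(m)` to the first two legs of `cotwist_insertΔ`, with `ε(b₀) = 1`. One
side becomes `S⁻¹(p) ⊗ a`; the other stays in the range of `T`, which is stable under right
multiplication by `B`. -/
theorem IsCoaction.cotwist_surjective (hΓ : IsCoaction HB Γ) :
    Function.Surjective (cotwist Γ) := by
  let θ : B ⊗[ℂ] B →ₗ[ℂ] B := LinearMap.mul' ℂ B ∘ₗ (starConj HB.antipode).lTensor B ∘ₗ
    (TensorProduct.comm ℂ B B).toLinearMap
  let θ₁₂ : B ⊗[ℂ] (B ⊗[ℂ] A) →ₗ[ℂ] B ⊗[ℂ] A :=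
    θ.rTensor A ∘ₗ (TensorProduct.assoc ℂ B B A).symm.toLinearMap
  have h1 : ∀ X : B ⊗[ℂ] (A ⊗[ℂ] B),
      θ₁₂ (leg23 B (cotwist Γ) X) ∈ LinearMap.range (cotwist Γ) := by
    intro X
    induction X with
    | zero => simp
    | add x y hx hy => rw [map_add, map_add]; exact add_mem hx hy
    | tmul x z =>
      refine ⟨(LinearMap.mulRight ℂ (starConj HB.antipode x)).lTensor A z, ?_⟩
      rw [cotwist_lTensor_mulRight HB, leg23_tmul]
      generalize cotwist Γ z = w
      induction w with
      | zero => simp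
      | add x y hx hy => simp only [map_add, TensorProduct.tmul_add, hx, hy]
      | tmul m n => simp [θ₁₂, θ]
  have h2 : ∀ p (w : B ⊗[ℂ] A), θ₁₂ (leg12 A HB.T₂.toLinearMap (p ⊗ₜ w)) =
      starConj HB.antipode p ⊗ₜ HB.counit₁ A w := by
    intro p w
    induction w with
    | zero => simp
    | add x y hx hy => simp only [map_add, TensorProduct.tmul_add, hx, hy]
    | tmul m n =>
      rw [leg12_tmul]
      simp only [θ₁₂, LinearMap.comp_apply, LinearEquiv.coe_coe, LinearEquiv.symm_apply_apply,
        LinearMap.rTensor_tmul, θ, ← HB.l₁_apply, HB.mul_starConj_antipode_l₁, HB.counit₁_tmul,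
        TensorProduct.smul_tmul]
  rw [← LinearMap.range_eq_top, eq_top_iff]
  intro z _
  induction z with
  | zero => exact zero_mem _
  | add x y hx hy => exact add_mem (hx trivial) (hy trivial)
  | tmul b a =>
    by_cases hb : b = 0
    · simp [hb]
    obtain ⟨b₀, hb₀⟩ := HB.exists_counit_eq_one b hb
    obtain ⟨c, hc⟩ := HB.antipode_surjective (star b)
    have h := h2 (star c) (cotwist Γ (a ⊗ₜ b₀))
    rw [← hΓ.cotwist_insertΔ, hΓ.counit₁_cotwist, hb₀, one_smul, starConj_apply, star_star, hc,
      star_star] at h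
    rw [← h]
    exact h1 _

theorem IsCoaction.cotwist_leg13 (hΓ : IsCoaction HB Γ) (a : A) (p b : B) :
    leg23 B (cotwist Γ) (leg13 A HB.T₂.toLinearMap
      (TensorProduct.assoc ℂ B A B (cotwistOp Γ (a ⊗ₜ p) ⊗ₜ b))) =
      leg12 A HB.T₂.toLinearMap (p ⊗ₜ cotwist Γ (a ⊗ₜ b)) := by
  rw [← hΓ.cotwist_insertΔ]
  congr 1
  generalize cotwistOp Γ (a ⊗ₜ p) = w
  induction w with
  | zero => simp
  | add x y hx hy => simp only [map_add, TensorProduct.add_tmul, hx, hy]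
  | tmul m n => simp [insertΔ, leg13]

end

variable {A : Type*} [NonUnitalRing A] [Module ℂ A] [IsScalarTower ℂ A A] [SMulCommClass ℂ A A]
  [StarRing A] [StarModule ℂ A]
  {B : Type*} [NonUnitalRing B] [Module ℂ B] [IsScalarTower ℂ B B] [SMulCommClass ℂ B B]
  [StarRing B] [StarModule ℂ B]
  {HA : MultiplierHopfStarAlgebra A} {HB : MultiplierHopfStarAlgebra B}
  {act : B →ₗ[ℂ] A →ₗ[ℂ] B} {Γ : A →ₗ[ℂ] M₀ B A}

/-- `∑ (pg ◁ t₍₁₎) ⊗ t₍₂₎ = ∑ (p ◁ t₍₁₎)(g ◁ t₍₂₎) ⊗ t₍₃₎` -/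
theorem IsModuleAlgebra.ro_mul (hact : IsModuleAlgebra HA act) (p g : B) (t : A) :
    ro HA act (p * g) t = lmul B A ((ro HA act g).lTensor B (ro HA act p t)) := by
  refine HA.ext_mulRight_lTensor fun a' => ?_
  rw [hact.mulRight_ro, ← lmul_lTensor_lTensor, ← LinearMap.lTensor_comp_apply]
  have h1 : (LinearMap.mulRight ℂ a').lTensor B ∘ₗ ro HA act g =
      (act g).rTensor A ∘ₗ HA.r₂ a' := LinearMap.ext fun a => hact.mulRight_ro a' g a
  rw [h1]
  refine hact.induction (p := fun p => (act (p * g)).rTensor A (HA.r₂ a' t) =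
    lmul B A (((act g).rTensor A ∘ₗ HA.r₂ a').lTensor B (ro HA act p t))) ?_ ?_ ?_ p
  · simp
  · intro b b' h h'
    simp only [map_add, add_mul, LinearMap.add_apply, LinearMap.rTensor_add, h, h']
  · intro c e
    have h2 : act (act c e * g) =
        (LinearMap.mul' ℂ B ∘ₗ TensorProduct.map (act c) (act g)) ∘ₗ HA.l₁ e :=
      LinearMap.ext fun a => hact.mul_act c e g a
    rw [h2, LinearMap.rTensor_comp_apply, hact.ro_act, LinearMap.lTensor_comp_apply,
      ← rTensor_lTensor, ← HA.coassoc_l₁_r₂]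
    generalize (HA.l₁ e).rTensor A (HA.r₂ a' t) = z
    induction z with
    | zero => simp
    | add x y hx hy => simp only [map_add, hx, hy]
    | tmul z v =>
      induction z with
      | zero => simp
      | add x y hx hy => simp only [map_add, TensorProduct.add_tmul, hx, hy]
      | tmul x y => simp [lmul]

theorem mapP_tmul (b : B) (a : A) : mapP HA act Γ (b ⊗ₜ a) =
    cotwistOp Γ (TensorProduct.comm ℂ B A (ro HA act b a)) := by
  rw [mapP, LinearMap.comp_apply, twistOp_tmul]

variable (HA act Γ) in
/-- `P` as a bilinear map. -/
def bP : B →ₗ[ℂ] A →ₗ[ℂ] B ⊗[ℂ] A := TensorProduct.curry (mapP HA act Γ)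

theorem bP_apply (b : B) (a : A) : bP HA act Γ b a = mapP HA act Γ (b ⊗ₜ a) := rfl

theorem bP_eq_comp (b : B) : bP HA act Γ b =
    (cotwistOp Γ ∘ₗ (TensorProduct.comm ℂ B A).toLinearMap) ∘ₗ ro HA act b :=
  LinearMap.ext fun a => mapP_tmul b a

theorem IsCompatible.cotwist_rt (hP : IsCompatible HA HB act Γ) (b : B) (a : A) :
    cotwist Γ (rt HA act b a) = bP HA act Γ b a :=
  LinearMap.congr_fun hP.twist_cotwist (b ⊗ₜ a)

/-- Combine `ro_mul` with the left `B`-linearity of `T^op`. -/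
theorem bP_mul_left (HB : MultiplierHopfStarAlgebra B) (hact : IsModuleAlgebra HA act)
    (p g : B) (t : A) : bP HA act Γ (p * g) t =
      lmul B A ((bP HA act Γ g).lTensor B (ro HA act p t)) := by
  rw [bP_eq_comp, LinearMap.comp_apply, hact.ro_mul, bP_eq_comp, LinearMap.lTensor_comp_apply]
  generalize (ro HA act g).lTensor B (ro HA act p t) = z
  induction z with
  | zero => simp
  | add x y hx hy => simp only [map_add, hx, hy]
  | tmul b z =>
    rw [lmul_tmul, LinearMap.lTensor_tmul, lmul_tmul, LinearMap.comp_apply, LinearMap.comp_apply,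
      ← cotwistOp_lTensor_mulLeft HB]
    exact congrArg _ (comm_rTensor _ _)

theorem IsCompatible.mapP_surjective (hP : IsCompatible HA HB act Γ) (hΓ : IsCoaction HB Γ)
    (hact : IsModuleAlgebra HA act)
    (hs : ∀ (a : A) (b : B), star (act b a) = act (star b) (star (HA.antipode a))) :
    Function.Surjective (mapP HA act Γ) := by
  have h : mapP HA act Γ = cotwist Γ ∘ₗ twist HA act := hP.twist_cotwist.symm
  rw [h]
  exact hΓ.cotwist_surjective.comp (hact.twist_surjective hs)

/-- `R₂₃P₁₃(T₂)₁₂ = (T₂)₁₃P₁₂R₂₃` -/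
theorem IsCompatible.leg23_twist (hP : IsCompatible HA HB act Γ) (hΓ : IsCoaction HB Γ)
    (hact : IsModuleAlgebra HA act) (p b : B) (t : A) :
    leg23 B (twist HA act) (leg13 B (mapP HA act Γ) (TensorProduct.assoc ℂ B B A
      (HB.l₁ p b ⊗ₜ t))) =
      leg13 A HB.T₂.toLinearMap (leg12 B (mapP HA act Γ) (p ⊗ₜ rt HA act b t)) := by
  let P := mapP HA act Γ
  let F : B ⊗[ℂ] B → A →ₗ[ℂ] B ⊗[ℂ] (B ⊗[ℂ] A) := fun z =>
    leg13 B P ∘ₗ (TensorProduct.assoc ℂ B B A).toLinearMap ∘ₗ TensorProduct.mk ℂ _ _ z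
  -- The second compatibility condition with the covering factor and the element of `A` replaced by
  -- a general tensor `Z`. It is used for `Z = ∑ (p ◁ t₍₁₎) ⊗ t₍₂₎`, where `bP_mul_left` identifies
  -- `w` as `P₁₃((p ⊗ 1)Δ(b) ⊗ t)`.
  have hA : ∀ Z : B ⊗[ℂ] A, ∃ w : B ⊗[ℂ] (B ⊗[ℂ] A),
      (∀ c, ((LinearMap.mulRight ℂ c).rTensor A).lTensor B w =
        lmul B (B ⊗[ℂ] A) ((F (HB.r₂ c b)).lTensor B Z)) ∧
      leg12 A HB.T₂.toLinearMap ((bP HA act Γ b).lTensor B Z) = leg23 B P w := by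
    intro Z
    induction Z with
    | zero => exact ⟨0, by simp⟩
    | add x y hx hy =>
      obtain ⟨w, hw, hw'⟩ := hx
      obtain ⟨v, hv, hv'⟩ := hy
      exact ⟨w + v, fun c => by simp only [map_add, hw, hv], by simp only [map_add, hw', hv']⟩
    | tmul m j =>
      obtain ⟨w, hw, hw'⟩ := hP.comul m b j
      exact ⟨w, fun c => by rw [hw, LinearMap.lTensor_tmul, lmul_tmul]; rfl,
        by rw [LinearMap.lTensor_tmul, bP_apply, hw']⟩
  obtain ⟨w, hw, hw'⟩ := hA (ro HA act p t)
  have hX : leg13 B P (TensorProduct.assoc ℂ B B A (HB.l₁ p b ⊗ₜ t)) = w := by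
    refine HB.ext_mulRight_rTensor_lTensor fun c => ?_
    have h1 : ∀ z : B ⊗[ℂ] B, ((LinearMap.mulRight ℂ c).rTensor A).lTensor B
        (leg13 B P (TensorProduct.assoc ℂ B B A (z ⊗ₜ t))) =
        leg13 B P (TensorProduct.assoc ℂ B B A ((LinearMap.mulRight ℂ c).lTensor B z ⊗ₜ t)) := by
      intro z
      induction z with
      | zero => simp
      | add x y hx hy => simp only [map_add, TensorProduct.add_tmul, hx, hy]
      | tmul g h =>
        rw [LinearMap.lTensor_tmul, TensorProduct.assoc_tmul, TensorProduct.assoc_tmul, leg13_tmul,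
          leg13_tmul, ← LinearMap.lTensor_comp_apply]
        congr 2
    rw [h1, ← HB.mulLeft_r₂, hw]
    generalize HB.r₂ c b = z
    induction z with
    | zero => simp [F]
    | add x y hx hy =>
      have : F (x + y) = F x + F y := by
        simp only [F, map_add, LinearMap.comp_add]
      rw [this, LinearMap.lTensor_add, LinearMap.add_apply, map_add, map_add,
        TensorProduct.add_tmul, map_add, map_add, hx, hy]
    | tmul g h =>
      have : F (g ⊗ₜ h) = (TensorProduct.mk ℂ B A h).lTensor B ∘ₗ bP HA act Γ g :=
        LinearMap.ext fun j => leg13_tmul P g h j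
      rw [this, LinearMap.lTensor_comp_apply, lmul_lTensor_lTensor, ← bP_mul_left HB hact]
      exact leg13_tmul P (p * g) h t
  have hB : ∀ Z : B ⊗[ℂ] A, leg23 B (cotwist Γ) (leg13 A HB.T₂.toLinearMap
      (leg12 B (cotwistOp Γ ∘ₗ (TensorProduct.comm ℂ B A).toLinearMap)
        ((rt HA act b).lTensor B Z))) =
      leg12 A HB.T₂.toLinearMap ((bP HA act Γ b).lTensor B Z) := by
    intro Z
    induction Z with
    | zero => simp
    | add x y hx hy => simp only [map_add, hx, hy]
    | tmul m j =>
      rw [LinearMap.lTensor_tmul, LinearMap.lTensor_tmul, ← hP.cotwist_rt]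
      generalize rt HA act b j = v
      induction v with
      | zero => simp
      | add x y hx hy => simp only [map_add, TensorProduct.tmul_add, hx, hy]
      | tmul n y =>
        rw [leg12_tmul]
        exact hΓ.cotwist_leg13 n m y
  -- After applying `T` to legs 2 and 3, `T ∘ R = P` turns the left side into `P₂₃P₁₃`, and
  -- `cotwist_leg13` turns the right side into `(Δ ⊗ ι)P`.
  refine leg23_injective (f := cotwist Γ) hΓ.cotwist_injective ?_
  have h2 : leg12 B (mapP HA act Γ) (p ⊗ₜ rt HA act b t) =
      leg12 B (cotwistOp Γ ∘ₗ (TensorProduct.comm ℂ B A).toLinearMap)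
        ((rt HA act b).lTensor B (ro HA act p t)) := by
    rw [leg12_tmul', ← hact.ro_rt, leg12]
    have h3 : TensorProduct.curry (mapP HA act Γ) p = _ := bP_eq_comp p
    rw [h3, LinearMap.rTensor_comp_apply]
    simp
  rw [h2, hB, hw', hX, leg23, leg23, leg23, ← LinearMap.lTensor_comp_apply, hP.twist_cotwist]
  rfl

end Bicross
end

noncomputable section

namespace Bicross

/-! ### Consequences of the comodule coalgebra axiom for `P`: counit and antipode formulas. -/

variable {A : Type*} [NonUnitalRing A] [Module ℂ A] [IsScalarTower ℂ A A] [SMulCommClass ℂ A A]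
  [StarRing A] [StarModule ℂ A]
  {B : Type*} [NonUnitalRing B] [Module ℂ B] [IsScalarTower ℂ B B] [SMulCommClass ℂ B B]
  [StarRing B] [StarModule ℂ B]
  {HA : MultiplierHopfStarAlgebra A} {HB : MultiplierHopfStarAlgebra B}
  {act : B →ₗ[ℂ] A →ₗ[ℂ] B} {Γ : A →ₗ[ℂ] M₀ B A}

variable (HA act Γ) in
/-- `nP (b ⊗ k) a = (1 ⊗ k)P(b ⊗ a)` -/
def nP : B ⊗[ℂ] A →ₗ[ℂ] A →ₗ[ℂ] B ⊗[ℂ] A :=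
  TensorProduct.curry ((LinearMap.mul' ℂ A).lTensor B ∘ₗ leg13 A (mapP HA act Γ) ∘ₗ
    (TensorProduct.assoc ℂ B A A).toLinearMap)

theorem nP_tmul (b : B) (k a : A) :
    nP HA act Γ (b ⊗ₜ k) a = (LinearMap.mulLeft ℂ k).lTensor B (bP HA act Γ b a) := by
  simp only [nP, TensorProduct.curry_apply, LinearMap.comp_apply, LinearEquiv.coe_coe,
    TensorProduct.assoc_tmul, leg13_tmul, ← LinearMap.lTensor_comp_apply]
  rfl

theorem IsCompatible.bP_mul (hP : IsCompatible HA HB act Γ) (b : B) (k a : A) :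
    bP HA act Γ b (k * a) = nP HA act Γ (bP HA act Γ b k) a := by
  have h := LinearMap.congr_fun hP.mul (b ⊗ₜ (k ⊗ₜ a))
  simp only [LinearMap.comp_apply, leg12_tmul] at h
  exact h

variable (HA act Γ) in
/-- `l₂P a (b ⊗ k) = (1 ⊗ 1 ⊗ k)(ι ⊗ Δ)P(b ⊗ a)` -/
def l₂P (a : A) : B ⊗[ℂ] A →ₗ[ℂ] B ⊗[ℂ] (A ⊗[ℂ] A) :=
  TensorProduct.lift ((LinearMap.lTensorHom B ∘ₗ HA.l₂).flip ∘ₗ (bP HA act Γ).flip a)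

theorem l₂P_tmul (a : A) (b : B) (k : A) :
    l₂P HA act Γ a (b ⊗ₜ k) = (HA.l₂ k).lTensor B (bP HA act Γ b a) := rfl

theorem leg12_lTensor {X Y Z W V V' : Type*}
    [AddCommGroup X] [Module ℂ X] [AddCommGroup Y] [Module ℂ Y] [AddCommGroup Z] [Module ℂ Z]
    [AddCommGroup V] [Module ℂ V] [AddCommGroup W] [Module ℂ W] [AddCommGroup V'] [Module ℂ V']
    (f : X ⊗[ℂ] Y →ₗ[ℂ] Z ⊗[ℂ] W) (g : V →ₗ[ℂ] V') (z : X ⊗[ℂ] (Y ⊗[ℂ] V)) :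
    leg12 V' f ((g.lTensor Y).lTensor X z) = (g.lTensor W).lTensor Z (leg12 V f z) := by
  obtain ⟨z, rfl⟩ := (TensorProduct.assoc ℂ X Y V).surjective z
  induction z with
  | zero => simp
  | add x y hx hy => simp only [map_add, hx, hy]
  | tmul z v =>
    rw [lTensor_lTensor_assoc, LinearMap.lTensor_tmul, leg12_assoc_tmul, leg12_assoc_tmul,
      lTensor_lTensor_assoc, LinearMap.lTensor_tmul]

/-- `(T ⊗ ι)((1 ⊗ 1 ⊗ k)(ι ⊗ T)(Δ(a) ⊗ b)) = (1 ⊗ 1 ⊗ k)(ι ⊗ Δ)T(a ⊗ b)` -/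
theorem IsComoduleCoalgebra.leg12_of_isCotwistLeft (hΓ : IsComoduleCoalgebra HA HB Γ)
    {a : A} {b : B} {k : A} {w : A ⊗[ℂ] (B ⊗[ℂ] A)} (hw : IsCotwistLeft HA Γ a b k w) :
    leg12 A (cotwist Γ) w = (HA.l₂ k).lTensor B (cotwist Γ (a ⊗ₜ b)) := by
  refine HA.ext_mulRight_lTensor_lTensor fun a' => ?_
  obtain ⟨v, hv⟩ := hΓ.covered_right a b a'
  have h1 : ((LinearMap.mulRight ℂ a').lTensor B).lTensor A w =
      ((LinearMap.mulLeft ℂ k).lTensor B).lTensor A v := by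
    refine HA.ext_mulLeft_rTensor fun c => ?_
    rw [rTensor_lTensor, rTensor_lTensor, hw, hv, ← LinearMap.lTensor_comp_apply,
      ← LinearMap.lTensor_comp_apply, ← LinearMap.lTensor_comp, ← LinearMap.lTensor_comp]
    congr 3
    ext x
    simp [mul_assoc]
  rw [← leg12_lTensor, h1, leg12_lTensor, hΓ.comul a b a' v hv]
  generalize cotwist Γ (a ⊗ₜ b) = z
  induction z with
  | zero => simp
  | add x y hx hy => simp only [map_add, TensorProduct.add_tmul, hx, hy]
  | tmul m n =>
    rw [TensorProduct.assoc_tmul, leg23_tmul, LinearMap.lTensor_tmul, LinearMap.lTensor_tmul,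
      LinearMap.lTensor_tmul, ← HA.mulLeft_r₂']
    rfl

theorem IsComoduleCoalgebra.exists_isCotwistLeft (hΓ : IsComoduleCoalgebra HA HB Γ) (k : A)
    (X : A ⊗[ℂ] B) : ∃ w : A ⊗[ℂ] (B ⊗[ℂ] A),
      (∀ c, (LinearMap.mulLeft ℂ c).rTensor (B ⊗[ℂ] A) w =
        ((LinearMap.mulLeft ℂ k).lTensor B).lTensor A
          (leg23 A (cotwist Γ) (TensorProduct.assoc ℂ A A B ((HA.l₁ c).rTensor B X)))) ∧
      leg12 A (cotwist Γ) w = (HA.l₂ k).lTensor B (cotwist Γ X) := by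
  induction X with
  | zero => exact ⟨0, by simp⟩
  | add x y hx hy =>
    obtain ⟨w, hw, hw'⟩ := hx
    obtain ⟨v, hv, hv'⟩ := hy
    exact ⟨w + v, fun c => by simp only [map_add, hw, hv], by simp only [map_add, hw', hv']⟩
  | tmul a b =>
    obtain ⟨w, hw⟩ := hΓ.covered_left a b k
    exact ⟨w, hw, hΓ.leg12_of_isCotwistLeft hw⟩

/-- `(T ⊗ ι)(ι ⊗ P_b)((1 ⊗ k)Δ(a)) = (1 ⊗ 1 ⊗ k_j)(ι ⊗ Δ)P(b_j ⊗ a)`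
for `P(b ⊗ k) = b_j ⊗ k_j` -/
theorem IsCompatible.leg12_cotwist_bP (hP : IsCompatible HA HB act Γ)
    (hΓ : IsComoduleCoalgebra HA HB Γ) (hact : IsModuleAlgebra HA act) (b : B) (k a : A) :
    leg12 A (cotwist Γ) ((bP HA act Γ b).lTensor A (HA.l₂ k a)) =
      l₂P HA act Γ a (bP HA act Γ b k) := by
  -- For `Z = β ⊗ κ` the comodule coalgebra axiom is applied to `R(β ⊗ a)`, and `T ∘ R = P` replaces
  -- `T` by `P`. For `Z = P(b ⊗ k)` the first compatibility condition says that `∑ (1 ⊗ k_j)P(b_j ⊗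
  -- t) = P(b ⊗ kt)`, which identifies `w` with the left-hand argument.
  have h1 : ∀ Z : B ⊗[ℂ] A, ∃ w : A ⊗[ℂ] (B ⊗[ℂ] A),
      (∀ c, (LinearMap.mulLeft ℂ c).rTensor (B ⊗[ℂ] A) w =
        (nP HA act Γ Z).lTensor A (HA.l₁ c a)) ∧
      leg12 A (cotwist Γ) w = l₂P HA act Γ a Z := by
    intro Z
    induction Z with
    | zero => exact ⟨0, by simp⟩
    | add x y hx hy =>
      obtain ⟨w, hw, hw'⟩ := hx
      obtain ⟨v, hv, hv'⟩ := hy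
      exact ⟨w + v, fun c => by
        simp only [map_add, hw, hv, LinearMap.lTensor_add, LinearMap.add_apply],
        by simp only [map_add, hw', hv']⟩
    | tmul β κ =>
      obtain ⟨w, hw, hw'⟩ := hΓ.exists_isCotwistLeft κ (rt HA act β a)
      refine ⟨w, fun c => ?_, ?_⟩
      · have h2 : nP HA act Γ (β ⊗ₜ κ) =
            (LinearMap.mulLeft ℂ κ).lTensor B ∘ₗ cotwist Γ ∘ₗ rt HA act β :=
          LinearMap.ext fun t => by
            rw [nP_tmul, LinearMap.comp_apply, LinearMap.comp_apply, hP.cotwist_rt]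
        rw [hw, hact.l₁_rt, h2, LinearMap.lTensor_comp_apply, LinearMap.lTensor_comp_apply]
        rfl
      · rw [hw', hP.cotwist_rt, l₂P_tmul]
  obtain ⟨w, hw, hw'⟩ := h1 (bP HA act Γ b k)
  rw [← hw']
  congr 1
  refine HA.ext_mulLeft_rTensor fun c => ?_
  have h2 : nP HA act Γ (bP HA act Γ b k) = bP HA act Γ b ∘ₗ LinearMap.mulLeft ℂ k :=
    LinearMap.ext fun t => (hP.bP_mul b k t).symm
  rw [hw, h2, LinearMap.lTensor_comp_apply, HA.mulLeft_l₁, rTensor_lTensor]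

/-- `(ι ⊗ ε)T(x ⊗ b) = ε(x)b` -/
theorem IsCompatible.counit₂_cotwist (hP : IsCompatible HA HB act Γ)
    (hΓ : IsComoduleCoalgebra HA HB Γ) (hact : IsModuleAlgebra HA act)
    (hs : ∀ (a : A) (b : B), star (act b a) = act (star b) (star (HA.antipode a)))
    (z : A ⊗[ℂ] B) :
    HA.counit₂ B (cotwist Γ z) = HA.counit₁ B z := by
  let E : A ⊗[ℂ] (B ⊗[ℂ] A) →ₗ[ℂ] B ⊗[ℂ] A :=
    (HA.counit₂ B ∘ₗ cotwist Γ).rTensor A ∘ₗ (TensorProduct.assoc ℂ A B A).symm.toLinearMap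
  have h1 : ∀ w, E w = (HA.counit₁ A).lTensor B (leg12 A (cotwist Γ) w) := by
    intro w
    obtain ⟨w, rfl⟩ := (TensorProduct.assoc ℂ A B A).surjective w
    induction w with
    | zero => simp
    | add x y hx hy => simp only [map_add, hx, hy]
    | tmul z n =>
      rw [leg12_assoc_tmul]
      simp only [E, LinearMap.comp_apply, LinearEquiv.coe_coe, LinearEquiv.symm_apply_apply,
        LinearMap.rTensor_tmul]
      generalize cotwist Γ z = v
      induction v with
      | zero => simp
      | add x y hx hy => simp only [map_add, TensorProduct.add_tmul, hx, hy]
      | tmul x y => simp [TensorProduct.smul_tmul]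
  have h2 : ∀ a Z, (HA.counit₁ A).lTensor B (l₂P HA act Γ a Z) = nP HA act Γ Z a := by
    intro a Z
    induction Z with
    | zero => simp
    | add x y hx hy => simp only [map_add, LinearMap.add_apply, hx, hy]
    | tmul β κ =>
      rw [l₂P_tmul, nP_tmul, ← LinearMap.lTensor_comp_apply]
      congr 2
      ext x
      exact HA.counit₁_l₂ κ x
  -- Applying `ε` to the middle leg of `leg12_cotwist_bP` gives `P(b ⊗ ka)`, which is also the
  -- result of applying `ε` to the first leg of `(ι ⊗ P_b)((1 ⊗ k)Δ(a))`. As `P` is onto, `(ι ⊗ ε)T`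
  -- and `ε ⊗ ι` agree everywhere.
  have h3 : ∀ b k a, E ((bP HA act Γ b).lTensor A (HA.l₂ k a)) =
      HA.counit₁ (B ⊗[ℂ] A) ((bP HA act Γ b).lTensor A (HA.l₂ k a)) := by
    intro b k a
    rw [h1, hP.leg12_cotwist_bP hΓ hact, h2, HA.counit₁_lTensor, HA.counit₁_l₂, hP.bP_mul]
  have h4 : ∀ b (w : A ⊗[ℂ] A), E ((bP HA act Γ b).lTensor A w) =
      HA.counit₁ (B ⊗[ℂ] A) ((bP HA act Γ b).lTensor A w) := by
    intro b w
    obtain ⟨u, rfl⟩ := HA.starConj_T₁_surjective w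
    induction u with
    | zero => simp
    | add x y hx hy => simp only [map_add, hx, hy]
    | tmul a k => exact h3 b k a
  have h5 : ∀ (x : A) (v : B ⊗[ℂ] A), E (x ⊗ₜ v) = HA.counit x • v := by
    intro x v
    obtain ⟨u, rfl⟩ := hP.mapP_surjective hΓ.coaction hact hs v
    induction u with
    | zero => simp
    | add x y hx hy => simp only [map_add, TensorProduct.tmul_add, smul_add, hx, hy]
    | tmul b z =>
      have h := h4 b (x ⊗ₜ z)
      rw [LinearMap.lTensor_tmul, HA.counit₁_tmul] at h
      exact h
  induction z with
  | zero => simp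
  | add x y hx hy => simp only [map_add, hx, hy]
  | tmul x b =>
    by_cases hx : x = 0
    · simp [hx]
    refine tmul_right_cancel (v := x) hx ?_
    have h := h5 x (b ⊗ₜ x)
    simpa [E, TensorProduct.smul_tmul'] using h

/-- `(ι ⊗ ε)P(b ⊗ a) = b ◁ a` -/
theorem IsCompatible.counit₂_bP (hP : IsCompatible HA HB act Γ)
    (hΓ : IsComoduleCoalgebra HA HB Γ) (hact : IsModuleAlgebra HA act)
    (hs : ∀ (a : A) (b : B), star (act b a) = act (star b) (star (HA.antipode a)))
    (b : B) (a : A) : HA.counit₂ B (bP HA act Γ b a) = act b a := by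
  rw [← hP.cotwist_rt, hP.counit₂_cotwist hΓ hact hs]
  refine hact.induction (p := fun b => HA.counit₁ B (rt HA act b a) = act b a) ?_ ?_ ?_ b
  · simp
  · intro b b' h h'
    simp only [map_add, LinearMap.add_apply, h, h']
  · intro c e
    rw [hact.rt_act, HA.counit₁_lTensor, HA.counit₁_l₂, hact.act_mul]

/-- Applying `ι ⊗ m(ι ⊗ S)` to `IsCompatible.leg12_cotwist_bP`. -/
theorem IsCompatible.cotwist_antipode_bP (hP : IsCompatible HA HB act Γ)
    (hΓ : IsComoduleCoalgebra HA HB Γ) (hact : IsModuleAlgebra HA act)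
    (hs : ∀ (a : A) (b : B), star (act b a) = act (star b) (star (HA.antipode a)))
    (b : B) (k a : A) :
    (LinearMap.mul' ℂ A ∘ₗ HA.antipode.lTensor A).lTensor B
      (leg12 A (cotwist Γ) ((bP HA act Γ b).lTensor A (HA.l₂ k a))) =
      TensorProduct.map (act.flip a) HA.antipode (bP HA act Γ b k) := by
  rw [hP.leg12_cotwist_bP hΓ hact]
  generalize bP HA act Γ b k = Z
  induction Z with
  | zero => simp
  | add x y hx hy => simp only [map_add, hx, hy]
  | tmul β κ =>
    rw [l₂P_tmul, ← LinearMap.lTensor_comp_apply, TensorProduct.map_tmul, LinearMap.flip_apply,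
      ← hP.counit₂_bP hΓ hact hs]
    generalize bP HA act Γ β a = w
    induction w with
    | zero => simp
    | add x y hx hy => simp only [map_add, TensorProduct.add_tmul, hx, hy]
    | tmul x y =>
      rw [LinearMap.lTensor_tmul, LinearMap.comp_apply, LinearMap.comp_apply, HA.antipode_l₂,
        HA.counit₂_tmul, TensorProduct.smul_tmul]

/-- `∑ P(b' ⊗ x)(ι ⊗ S)P(b ⊗ z) = ∑ ((b' q) ◁ a) ⊗ S(n)` for `x ⊗ z = (1 ⊗ k)Δ(a)` and
`q ⊗ n = P(b ⊗ k)` -/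
theorem IsCompatible.bP_mul_antipode_bP (hP : IsCompatible HA HB act Γ)
    (hΓ : IsComoduleCoalgebra HA HB Γ) (hact : IsModuleAlgebra HA act)
    (hs : ∀ (a : A) (b : B), star (act b a) = act (star b) (star (HA.antipode a)))
    (b' b : B) (k a : A) :
    LinearMap.mul' ℂ (B ⊗[ℂ] A) (TensorProduct.map (bP HA act Γ b')
      (HA.antipode.lTensor B ∘ₗ bP HA act Γ b) (HA.l₂ k a)) =
      TensorProduct.map (act.flip a ∘ₗ LinearMap.mulLeft ℂ b') HA.antipode
        (bP HA act Γ b k) := by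
  let Φ : A →ₗ[ℂ] B ⊗[ℂ] A := (LinearMap.mul' ℂ A ∘ₗ HA.antipode.lTensor A).lTensor B ∘ₗ
    leg12 A (cotwist Γ) ∘ₗ (bP HA act Γ b).lTensor A ∘ₗ HA.l₂ k
  have h0 : ∀ (d : B) (e : A) (u : B ⊗[ℂ] A),
      cotwistOp Γ (e ⊗ₜ d) * HA.antipode.lTensor B u =
      (LinearMap.mulLeft ℂ d).rTensor A
        ((LinearMap.mul' ℂ A ∘ₗ HA.antipode.lTensor A).lTensor B
          (leg12 A (cotwist Γ) (e ⊗ₜ u))) := by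
    intro d e u
    induction u with
    | zero => simp
    | add x y hx hy => simp only [map_add, mul_add, TensorProduct.tmul_add, hx, hy]
    | tmul q n =>
      rw [leg12_tmul]
      have h1 : ∀ w : B ⊗[ℂ] A, (LinearMap.mul' ℂ A ∘ₗ HA.antipode.lTensor A).lTensor B
          (TensorProduct.assoc ℂ B A A (w ⊗ₜ n)) =
          (LinearMap.mulRight ℂ (HA.antipode n)).lTensor B w := by
        intro w
        induction w with
        | zero => simp
        | add x y hx hy => simp only [map_add, TensorProduct.add_tmul, hx, hy]
        | tmul x y => simp
      rw [h1, rTensor_lTensor, mulLeft_cotwist, LinearMap.lTensor_tmul]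
      generalize cotwistOp Γ (e ⊗ₜ d) = w
      induction w with
      | zero => simp
      | add x y hx hy => simp only [map_add, add_mul, hx, hy]
      | tmul x y => simp
  -- Expanding `P(b' ⊗ x) = ∑ ((b' ◁ x₍₁₎) ⊗ 1)Γ(x₍₂₎)` leaves the factor `b' ◁ a₍₁₎` outside, and
  -- `Φ(a₍₂₎)` is evaluated by `cotwist_antipode_bP`. The module algebra rule finally recombines `∑
  -- (b' ◁ a₍₁₎)(q ◁ a₍₂₎) = (b'q) ◁ a`.
  have h1 : LinearMap.mul' ℂ (B ⊗[ℂ] A) (TensorProduct.map (bP HA act Γ b')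
      (HA.antipode.lTensor B ∘ₗ bP HA act Γ b) (HA.l₂ k a)) =
      lmul B A (Φ.lTensor B (ro HA act b' a)) := by
    rw [LinearMap.lTensor_comp_apply, LinearMap.lTensor_comp_apply, LinearMap.lTensor_comp_apply,
      ← hact.ro_l₂]
    generalize HA.l₂ k a = z
    induction z with
    | zero => simp
    | add x y hx hy => simp only [map_add, hx, hy]
    | tmul x y =>
      rw [TensorProduct.map_tmul, LinearMap.mul'_apply, bP_apply, mapP_tmul,
        LinearMap.rTensor_tmul]
      generalize ro HA act b' x = w
      induction w with
      | zero => simp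
      | add x y hx hy => simp only [map_add, add_mul, TensorProduct.add_tmul, hx, hy]
      | tmul d e =>
        rw [TensorProduct.comm_tmul, LinearMap.comp_apply, h0, TensorProduct.assoc_tmul,
          LinearMap.lTensor_tmul, LinearMap.lTensor_tmul, LinearMap.lTensor_tmul,
          LinearMap.lTensor_tmul, lmul_tmul]
  have h2 : ∀ t, Φ t = TensorProduct.map (act.flip t) HA.antipode (bP HA act Γ b k) :=
    fun t => hP.cotwist_antipode_bP hΓ hact hs b k t
  rw [h1]
  obtain ⟨G, hG⟩ : ∃ G : B ⊗[ℂ] A →ₗ[ℂ] A →ₗ[ℂ] B ⊗[ℂ] A, ∀ Z t,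
      G Z t = TensorProduct.map (act.flip t) HA.antipode Z :=
    ⟨(LinearMap.rTensorHom A ∘ₗ act.flip).flip ∘ₗ HA.antipode.lTensor B, fun Z t => by
      rw [← LinearMap.rTensor_comp_lTensor]; rfl⟩
  have h4 : Φ = G (bP HA act Γ b k) := LinearMap.ext fun t => by rw [h2, hG]
  rw [h4]
  generalize bP HA act Γ b k = Z
  induction Z with
  | zero => simp
  | add x y hx hy => simp only [map_add, LinearMap.lTensor_add, LinearMap.add_apply, hx, hy]
  | tmul q n =>
    rw [TensorProduct.map_tmul, LinearMap.comp_apply, LinearMap.flip_apply,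
      LinearMap.mulLeft_apply, hact.act_mul_ro]
    have h5 : G (q ⊗ₜ n) = (TensorProduct.mk ℂ B A).flip (HA.antipode n) ∘ₗ act q :=
      LinearMap.ext fun t => by rw [hG]; rfl
    rw [h5, LinearMap.lTensor_comp_apply]
    generalize (act q).lTensor B (ro HA act b' a) = w
    induction w with
    | zero => simp
    | add x y hx hy => simp only [map_add, TensorProduct.add_tmul, hx, hy]
    | tmul x y => simp [lmul]

end Bicross
end

noncomputable section

namespace Bicross

/-! ### The map `P` and the involution. -/

variable {A : Type*} [NonUnitalRing A] [Module ℂ A] [IsScalarTower ℂ A A] [SMulCommClass ℂ A A]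
  [StarRing A] [StarModule ℂ A]
  {B : Type*} [NonUnitalRing B] [Module ℂ B] [IsScalarTower ℂ B B] [SMulCommClass ℂ B B]
  [StarRing B] [StarModule ℂ B]
  {HA : MultiplierHopfStarAlgebra A} {HB : MultiplierHopfStarAlgebra B}
  {act : B →ₗ[ℂ] A →ₗ[ℂ] B} {Γ : A →ₗ[ℂ] M₀ B A}

variable (HA act Γ) in
/-- `bPt b a = P(b^* ⊗ a^*)^*` -/
def bPt : B →ₗ[ℂ] A →ₗ[ℂ] B ⊗[ℂ] A := TensorProduct.curry (starConj (mapP HA act Γ))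

theorem bPt_apply (b : B) (a : A) :
    bPt HA act Γ b a = star (bP HA act Γ (star b) (star a)) := by
  rw [bP_apply, ← TensorProduct.star_tmul]
  rfl

variable (HA act Γ) in
/-- `nPt (b ⊗ k) a = P(b^* ⊗ a^*)^*(1 ⊗ k)` -/
def nPt : B ⊗[ℂ] A →ₗ[ℂ] A →ₗ[ℂ] B ⊗[ℂ] A :=
  TensorProduct.lift (((LinearMap.llcomp ℂ A (B ⊗[ℂ] A) (B ⊗[ℂ] A)).flip ∘ₗ
    bPt HA act Γ).compl₂ (LinearMap.lTensorHom B ∘ₗ (LinearMap.mul ℂ A).flip))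

theorem nPt_tmul (b : B) (k a : A) :
    nPt HA act Γ (b ⊗ₜ k) a = (LinearMap.mulRight ℂ k).lTensor B (bPt HA act Γ b a) := rfl

theorem IsCompatible.bPt_mul (hP : IsCompatible HA HB act Γ) (b : B) (a k : A) :
    bPt HA act Γ b (a * k) = nPt HA act Γ (bPt HA act Γ b k) a := by
  have h : ∀ Z : B ⊗[ℂ] A, star (nP HA act Γ Z (star a)) = nPt HA act Γ (star Z) a := by
    intro Z
    induction Z with
    | zero => simp
    | add x y hx hy => simp only [map_add, star_add, LinearMap.add_apply, hx, hy]
    | tmul β κ =>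
      rw [nP_tmul, TensorProduct.star_tmul, nPt_tmul, star_lTensor, starConj_mulLeft, bPt_apply,
        star_star]
  rw [bPt_apply, star_mul, hP.bP_mul, h, bPt_apply]

/-- `P(b^* ⊗ S(c)^*)^* = (ι ⊗ S)P(b ⊗ c)` -/
theorem IsCompatible.bPt_antipode (hP : IsCompatible HA HB act Γ)
    (hact : IsModuleAlgebra HA act)
    (hs : ∀ (a : A) (b : B), star (act b a) = act (star b) (star (HA.antipode a)))
    (hΓs : ∀ a : A, Γ (star (HA.antipode a)) = ((Γ a).map HA.antipode).adjoint)
    (b : B) (c : A) :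
    bPt HA act Γ b (HA.antipode c) = HA.antipode.lTensor B (bP HA act Γ b c) := by
  rw [bPt_apply, ← hP.cotwist_rt, rt_apply, hact.twist_star_antipode hs, bP_apply, mapP_tmul]
  generalize ro HA act b c = w
  induction w with
  | zero => simp
  | add x y hx hy => simp only [map_add, star_add, hx, hy]
  | tmul d e =>
    rw [TensorProduct.comm_tmul, LinearMap.rTensor_tmul, TensorProduct.star_tmul, cotwist_tmul,
      hΓs, cotwistOp_tmul]
    change star (star (HA.antipode.lTensor B ((Γ e).left (star (star d))))) = _
    rw [star_star, star_star]

variable (act) in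
/-- `actMul act b' Z i`: the element `((b' q) ◁ i) ⊗ n` for `Z = q ⊗ n`. -/
def actMul (b' : B) : B ⊗[ℂ] A →ₗ[ℂ] A →ₗ[ℂ] B ⊗[ℂ] A :=
  (LinearMap.rTensorHom A ∘ₗ act.flip).flip ∘ₗ (LinearMap.mulLeft ℂ b').rTensor A

theorem actMul_tmul (b' q : B) (n i : A) :
    actMul act b' (q ⊗ₜ n) i = act (b' * q) i ⊗ₜ n := by
  simp [actMul]

/-- `P(b' ⊗ g)P(b^* ⊗ h^*)^* = ∑ ((b' q) ◁ i) ⊗ n` for `i ⊗ f = Δ(g)(1 ⊗ h)` and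
`q ⊗ n = P(b^* ⊗ f^*)^*` -/
theorem IsCompatible.bP_mul_bPt (hP : IsCompatible HA HB act Γ)
    (hΓ : IsComoduleCoalgebra HA HB Γ) (hact : IsModuleAlgebra HA act)
    (hs : ∀ (a : A) (b : B), star (act b a) = act (star b) (star (HA.antipode a)))
    (hΓs : ∀ a : A, Γ (star (HA.antipode a)) = ((Γ a).map HA.antipode).adjoint)
    (b' b : B) (g h : A) :
    bP HA act Γ b' g * bPt HA act Γ b h =
      TensorProduct.lift (actMul act b' ∘ₗ bPt HA act Γ b)
        (TensorProduct.comm ℂ A A (HA.r₂ h g)) := by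
  let Φ : A ⊗[ℂ] A →ₗ[ℂ] B ⊗[ℂ] A := LinearMap.mul' ℂ (B ⊗[ℂ] A) ∘ₗ
    TensorProduct.map (bP HA act Γ b') (bPt HA act Γ b)
  let Ψ : A ⊗[ℂ] A →ₗ[ℂ] B ⊗[ℂ] A := TensorProduct.lift (actMul act b' ∘ₗ bPt HA act Γ b) ∘ₗ
    (TensorProduct.comm ℂ A A).toLinearMap
  -- It suffices to take `v = a ⊗ S(k)`. Then `T₁⁻¹ v = (ι ⊗ S)((1 ⊗ k)Δ(a))`, and since `b ↦ P(b^*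
  -- ⊗ ·^*)^*` intertwines `S`, the claim becomes `bP_mul_antipode_bP`.
  have key : ∀ v : A ⊗[ℂ] A, Φ (HA.T₁.symm v) = Ψ v := by
    intro v
    induction v with
    | zero => simp
    | add x y hx hy => simp only [map_add, hx, hy]
    | tmul a s =>
      obtain ⟨k, rfl⟩ := HA.antipode_surjective s
      rw [← HA.T₁_antipode_l₂, LinearEquiv.symm_apply_apply, HA.T₁_antipode_l₂]
      have h1 : bPt HA act Γ b ∘ₗ HA.antipode = HA.antipode.lTensor B ∘ₗ bP HA act Γ b :=
        LinearMap.ext fun c => hP.bPt_antipode hact hs hΓs b c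
      have h2 : TensorProduct.map (bP HA act Γ b') (bPt HA act Γ b)
          (HA.antipode.lTensor A (HA.l₂ k a)) =
          TensorProduct.map (bP HA act Γ b') (HA.antipode.lTensor B ∘ₗ bP HA act Γ b)
          (HA.l₂ k a) := by
        rw [← h1, LinearMap.lTensor, ← LinearMap.comp_apply, ← TensorProduct.map_comp,
          LinearMap.comp_id]
      simp only [Φ, Ψ, LinearMap.comp_apply, LinearEquiv.coe_coe, TensorProduct.comm_tmul,
        TensorProduct.lift.tmul]
      rw [h2, hP.bP_mul_antipode_bP hΓ hact hs, hP.bPt_antipode hact hs hΓs]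
      generalize bP HA act Γ b k = Z
      induction Z with
      | zero => simp
      | add x y hx hy => simp only [map_add, LinearMap.add_apply, hx, hy]
      | tmul q n =>
        rw [LinearMap.lTensor_tmul, actMul_tmul, TensorProduct.map_tmul]
        rfl
  have h3 := key (HA.T₁ (g ⊗ₜ h))
  rw [LinearEquiv.symm_apply_apply] at h3
  exact h3

/-- `smashMul HA act x b' Z p`: the element `(x ⊗ b' q)p ⊗ n` for `Z = q ⊗ n`, where `(x ⊗ b' q)p` is a product in
the smash product. -/
def smashMul (HA : MultiplierHopfStarAlgebra A) (act : B →ₗ[ℂ] A →ₗ[ℂ] B) (x : A) (b' : B) :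
    B ⊗[ℂ] A →ₗ[ℂ] A →ₗ[ℂ] (A ⊗[ℂ] B) ⊗[ℂ] A :=
  (LinearMap.rTensorHom A ∘ₗ rA HA act).flip ∘ₗ
    (TensorProduct.mk ℂ A B x ∘ₗ LinearMap.mulLeft ℂ b').rTensor A

theorem smashMul_tmul (x : A) (b' q : B) (n p : A) :
    smashMul HA act x b' (q ⊗ₜ n) p = rA HA act p (x ⊗ₜ (b' * q)) ⊗ₜ n := by
  simp [smashMul]

theorem smashMul_mul (hact : IsModuleAlgebra HA act) (x : A) (b' : B) (Z : B ⊗[ℂ] A) (p p' : A) :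
    smashMul HA act x b' Z (p * p') =
      (rA HA act p').rTensor A (smashMul HA act x b' Z p) := by
  induction Z with
  | zero => simp
  | add x y hx hy => simp only [map_add, LinearMap.add_apply, hx, hy]
  | tmul q n => rw [smashMul_tmul, smashMul_tmul, LinearMap.rTensor_tmul, hact.rA_mul]

theorem smashMul_mulRight (x : A) (b' : B) (Z : B ⊗[ℂ] A) (p k : A) :
    smashMul HA act x b' ((LinearMap.mulRight ℂ k).lTensor B Z) p =
      (LinearMap.mulRight ℂ k).lTensor (A ⊗[ℂ] B) (smashMul HA act x b' Z p) := by
  induction Z with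
  | zero => simp
  | add x y hx hy => simp only [map_add, LinearMap.add_apply, hx, hy]
  | tmul q n => simp only [LinearMap.lTensor_tmul, smashMul_tmul]

variable (HA act Γ) in
/-- `∑ (s ⊗ m b) ζ ⊗ n` for `s ⊗ t = (x ⊗ 1)Δ(a)` and `m ⊗ n = P(b' ⊗ t)` -/
def smashLeft (x a ζ : A) (b' : B) : B ⊗[ℂ] A →ₗ[ℂ] (A ⊗[ℂ] B) ⊗[ℂ] A :=
  ((rA HA act ζ).rTensor A ∘ₗ (TensorProduct.assoc ℂ A B A).symm.toLinearMap) ∘ₗ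
    (LinearMap.lTensorHom A ∘ₗ (LinearMap.mul ℂ (B ⊗[ℂ] A)).flip).flip
      ((bP HA act Γ b').lTensor A (HA.l₁ x a))

/-- The identity behind `((ab ⊗ y)Δ_#(a'))v = (ab ⊗ y)(Δ_#(a')v)`. -/
theorem IsCompatible.smashLeft_tmul (hP : IsCompatible HA HB act Γ)
    (hΓ : IsComoduleCoalgebra HA HB Γ) (hact : IsModuleAlgebra HA act)
    (hs : ∀ (a : A) (b : B), star (act b a) = act (star b) (star (HA.antipode a)))
    (hΓs : ∀ a : A, Γ (star (HA.antipode a)) = ((Γ a).map HA.antipode).adjoint)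
    (x a ζ : A) (b' b : B) (y : A) :
    smashLeft HA act Γ x a ζ b' (b ⊗ₜ y) =
      (LinearMap.mulRight ℂ y).lTensor (A ⊗[ℂ] B)
        (TensorProduct.lift (smashMul HA act x b' ∘ₗ bPt HA act Γ b)
          (TensorProduct.comm ℂ A A (HA.r₁ ζ a))) := by
  have add : ∀ (f g : A →ₗ[ℂ] A →ₗ[ℂ] (A ⊗[ℂ] B) ⊗[ℂ] A) z, TensorProduct.lift (f + g) z =
      TensorProduct.lift f z + TensorProduct.lift g z := fun f g z =>
    LinearMap.congr_fun (map_add (TensorProduct.lift.equiv (.id ℂ) A A _) f g) z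
  -- Covering the last leg by `y` lets `b ⊗ y` be any tensor `V`, in particular `P(β^* ⊗ h^*)^*`,
  -- and such elements span. There `bP_mul_bPt` evaluates the product with `P(b' ⊗ t)`, and
  -- coassociativity regroups the result.
  have h1 : ∀ V : B ⊗[ℂ] A, smashLeft HA act Γ x a ζ b' V =
      TensorProduct.lift (smashMul HA act x b' ∘ₗ nPt HA act Γ V)
        (TensorProduct.comm ℂ A A (HA.r₁ ζ a)) := by
    intro V
    obtain ⟨u, hu⟩ := hP.mapP_surjective hΓ.coaction hact hs (star V)
    have hV : V = starConj (mapP HA act Γ) (star u) := by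
      rw [starConj_apply, star_star, hu, star_star]
    rw [hV]
    generalize star u = u
    clear hV hu V
    induction u with
    | zero =>
      simp only [map_zero, LinearMap.comp_zero]
      exact (LinearMap.congr_fun (map_zero (TensorProduct.lift.equiv (.id ℂ) A A _)) _).symm
    | add x y hx hy => simp only [map_add, LinearMap.comp_add, add, hx, hy]
    | tmul β h =>
      change smashLeft HA act Γ x a ζ b' (bPt HA act Γ β h) = TensorProduct.lift
        (smashMul HA act x b' ∘ₗ nPt HA act Γ (bPt HA act Γ β h)) _
      have h2 : nPt HA act Γ (bPt HA act Γ β h) = bPt HA act Γ β ∘ₗ LinearMap.mulRight ℂ h :=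
        LinearMap.ext fun o => (hP.bPt_mul β o h).symm
      have h3 : TensorProduct.lift
          (smashMul HA act x b' ∘ₗ bPt HA act Γ β ∘ₗ LinearMap.mulRight ℂ h)
          (TensorProduct.comm ℂ A A (HA.r₁ ζ a)) =
          TensorProduct.lift (smashMul HA act x b' ∘ₗ bPt HA act Γ β)
          (TensorProduct.comm ℂ A A ((LinearMap.mulRight ℂ ζ).rTensor A (HA.r₂ h a))) := by
        rw [← HA.mulRight_r₁]
        generalize HA.r₁ ζ a = z
        induction z with
        | zero => simp
        | add x y hx hy => simp only [map_add, hx, hy]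
        | tmul p o => rfl
      rw [h2, h3]
      have h4 : ∀ z : A ⊗[ℂ] A, TensorProduct.lift (smashMul HA act x b' ∘ₗ bPt HA act Γ β)
          (TensorProduct.comm ℂ A A ((LinearMap.mulRight ℂ ζ).rTensor A z)) =
          (rA HA act ζ).rTensor A (TensorProduct.lift (smashMul HA act x b' ∘ₗ bPt HA act Γ β)
          (TensorProduct.comm ℂ A A z)) := by
        intro z
        induction z with
        | zero => simp
        | add x y hx hy => simp only [map_add, hx, hy]
        | tmul p o =>
          rw [LinearMap.rTensor_tmul, TensorProduct.comm_tmul, TensorProduct.comm_tmul,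
            TensorProduct.lift.tmul, TensorProduct.lift.tmul]
          exact smashMul_mul hact x b' _ p ζ
      rw [h4, smashLeft, LinearMap.comp_apply, LinearMap.comp_apply]
      congr 1
      have h5 : ∀ z : A ⊗[ℂ] A, (LinearMap.lTensorHom A ∘ₗ
          (LinearMap.mul ℂ (B ⊗[ℂ] A)).flip).flip ((bP HA act Γ b').lTensor A z)
          (bPt HA act Γ β h) =
          (TensorProduct.lift (actMul act b' ∘ₗ bPt HA act Γ β) ∘ₗ
            (TensorProduct.comm ℂ A A).toLinearMap).lTensor A ((HA.r₂ h).lTensor A z) := by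
        intro z
        induction z with
        | zero => simp
        | add x y hx hy => simp only [map_add, LinearMap.add_apply, hx, hy]
        | tmul s t =>
          rw [LinearMap.lTensor_tmul, LinearMap.lTensor_tmul, LinearMap.lTensor_tmul,
            LinearMap.comp_apply, LinearEquiv.coe_coe, ← hP.bP_mul_bPt hΓ hact hs hΓs]
          rfl
      rw [h5, ← HA.coassoc_l₁_r₂]
      generalize HA.r₂ h a = z
      induction z with
      | zero => simp
      | add x y hx hy => simp only [map_add, hx, hy]
      | tmul e f =>
        rw [LinearMap.rTensor_tmul, TensorProduct.comm_tmul, TensorProduct.lift.tmul,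
          LinearMap.comp_apply]
        have h6 : ∀ w : A ⊗[ℂ] A, (TensorProduct.lift (actMul act b' ∘ₗ bPt HA act Γ β) ∘ₗ
            (TensorProduct.comm ℂ A A).toLinearMap).lTensor A
              (TensorProduct.assoc ℂ A A A (w ⊗ₜ f)) =
            (actMul act b' (bPt HA act Γ β f)).lTensor A w := by
          intro w
          induction w with
          | zero => simp
          | add x y hx hy => simp only [map_add, TensorProduct.add_tmul, hx, hy]
          | tmul s i => rfl
        rw [h6]
        generalize bPt HA act Γ β f = Z
        induction Z with
        | zero => simp
        | add x y hx hy => simp only [map_add, LinearMap.lTensor_add, LinearMap.add_apply, hx, hy]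
        | tmul q n =>
          rw [smashMul_tmul, rA_tmul, hact.mulLeft_rt]
          generalize HA.l₁ x e = w
          induction w with
          | zero => simp
          | add x y hx hy => simp only [map_add, TensorProduct.add_tmul, hx, hy]
          | tmul s i =>
            rw [LinearMap.lTensor_tmul, LinearMap.lTensor_tmul, actMul_tmul]
            rfl
  rw [h1]
  generalize HA.r₁ ζ a = z
  induction z with
  | zero => simp
  | add x y hx hy => simp only [map_add, hx, hy]
  | tmul p o =>
    rw [TensorProduct.comm_tmul, TensorProduct.lift.tmul, TensorProduct.lift.tmul,
      LinearMap.comp_apply, LinearMap.comp_apply, nPt_tmul, smashMul_mulRight]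

/-- `∑ (s ⊗ m b) ζ ⊗ n = ∑ (x ⊗ b' q) p ⊗ r` for `s ⊗ t = (x ⊗ 1)Δ(a)`, `m ⊗ n = P(b' ⊗ t)`,
`p ⊗ o = Δ(a)(ζ ⊗ 1)` and `q ⊗ r = P(b^* ⊗ o^*)^*` -/
theorem IsCompatible.rA_mulRight_bP (hP : IsCompatible HA HB act Γ)
    (hΓ : IsComoduleCoalgebra HA HB Γ) (hact : IsModuleAlgebra HA act)
    (hs : ∀ (a : A) (b : B), star (act b a) = act (star b) (star (HA.antipode a)))
    (hΓs : ∀ a : A, Γ (star (HA.antipode a)) = ((Γ a).map HA.antipode).adjoint)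
    (x a ζ : A) (b' b : B) :
    (rA HA act ζ).rTensor A ((TensorProduct.assoc ℂ A B A).symm
      (((LinearMap.mulRight ℂ b).rTensor A).lTensor A ((bP HA act Γ b').lTensor A (HA.l₁ x a)))) =
      TensorProduct.lift (smashMul HA act x b' ∘ₗ bPt HA act Γ b)
        (TensorProduct.comm ℂ A A (HA.r₁ ζ a)) := by
  refine HA.ext_mulRight_lTensor fun y => ?_
  rw [← hP.smashLeft_tmul hΓ hact hs hΓs, smashLeft, LinearMap.comp_apply, LinearMap.comp_apply,
    ← rTensor_lTensor]
  congr 1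
  generalize (bP HA act Γ b').lTensor A (HA.l₁ x a) = w
  induction w with
  | zero => simp
  | add x y hx hy => simp only [map_add, LinearMap.add_apply, hx, hy]
  | tmul s w =>
    induction w with
    | zero => simp
    | add x y hx hy => simp only [map_add, TensorProduct.tmul_add, LinearMap.add_apply, hx, hy]
    | tmul m n => simp

end Bicross
end

noncomputable section

namespace Bicross

/-! ### Right multiplication by `Δ_#` on `AB ⊗ AB`. -/

namespace Smash

variable {A : Type*} [NonUnitalRing A] [Module ℂ A] [IsScalarTower ℂ A A] [SMulCommClass ℂ A A]
  [StarRing A] [StarModule ℂ A]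
  {B : Type*} [NonUnitalRing B] [Module ℂ B] [IsScalarTower ℂ B B] [SMulCommClass ℂ B B]
  [StarRing B] [StarModule ℂ B]
  {HA : MultiplierHopfStarAlgebra A} {HB : MultiplierHopfStarAlgebra B}
  {act : B →ₗ[ℂ] A →ₗ[ℂ] B} {Γ : A →ₗ[ℂ] M₀ B A}
  {N N' : Type*} [AddCommGroup N] [Module ℂ N] [AddCommGroup N'] [Module ℂ N']

variable (HA act) in
/-- `s ⊗ m ⊗ n` and `y` are mapped to `sm ⊗ O n y`. -/
def applyLast (O : N →ₗ[ℂ] Smash HA act →ₗ[ℂ] Smash HA act) :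
    A ⊗[ℂ] (B ⊗[ℂ] N) →ₗ[ℂ] Smash HA act →ₗ[ℂ] Smash HA act ⊗[ℂ] Smash HA act :=
  TensorProduct.curry (TensorProduct.map (equiv HA act).toLinearMap (TensorProduct.lift O) ∘ₗ
    (TensorProduct.assoc ℂ (A ⊗[ℂ] B) N (Smash HA act)).toLinearMap ∘ₗ
    ((TensorProduct.assoc ℂ A B N).symm.toLinearMap).rTensor (Smash HA act))

@[simp] theorem applyLast_tmul (O : N →ₗ[ℂ] Smash HA act →ₗ[ℂ] Smash HA act) (s : A) (m : B) (n : N)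
    (y : Smash HA act) :
    applyLast HA act O (s ⊗ₜ (m ⊗ₜ n)) y = ab HA act s m ⊗ₜ O n y := by
  simp [applyLast, ab]

variable (HA act) in
/-- `ab ⊗ y ↦ applyLast O (k n (a ⊗ b)) y` -/
def rhoOf (O : N →ₗ[ℂ] Smash HA act →ₗ[ℂ] Smash HA act)
    (k : N' →ₗ[ℂ] A ⊗[ℂ] B →ₗ[ℂ] A ⊗[ℂ] (B ⊗[ℂ] N)) :
    N' →ₗ[ℂ] Smash HA act ⊗[ℂ] Smash HA act →ₗ[ℂ] Smash HA act ⊗[ℂ] Smash HA act :=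
  (TensorProduct.lift.equiv (.id ℂ) (Smash HA act) (Smash HA act) _).toLinearMap ∘ₗ
    LinearMap.lcomp ℂ _ (equiv HA act).symm.toLinearMap ∘ₗ
    LinearMap.llcomp ℂ (A ⊗[ℂ] B) _ _ (applyLast HA act O) ∘ₗ k

theorem rhoOf_tmul (O : N →ₗ[ℂ] Smash HA act →ₗ[ℂ] Smash HA act)
    (k : N' →ₗ[ℂ] A ⊗[ℂ] B →ₗ[ℂ] A ⊗[ℂ] (B ⊗[ℂ] N)) (n : N') (a : A) (b : B) (y : Smash HA act) :
    rhoOf HA act O k n (ab HA act a b ⊗ₜ y) = applyLast HA act O (k n (a ⊗ₜ b)) y := rfl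

variable (HA act Γ) in
/-- `rhoA a` is right multiplication by `Δ_#(a)` on `AB ⊗ AB`:
`xb ⊗ y ↦ ∑ sm ⊗ yn` with `s ⊗ t = (x ⊗ 1)Δ(a)` and `m ⊗ n = P(b ⊗ t)`. -/
def rhoA : A →ₗ[ℂ] Smash HA act ⊗[ℂ] Smash HA act →ₗ[ℂ] Smash HA act ⊗[ℂ] Smash HA act :=
  rhoOf HA act (rightA HA act) (TensorProduct.curry (leg23 A (mapP HA act Γ) ∘ₗ
    leg13 B HA.T₂.toLinearMap ∘ₗ (TensorProduct.assoc ℂ A B A).toLinearMap)).flip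

variable (HA HB act) in
/-- `rhoB b` is right multiplication by `Δ_#(b)` on `AB ⊗ AB`:
`xp ⊗ y ↦ ∑ xg ⊗ yh` with `g ⊗ h = (p ⊗ 1)Δ(b)`. -/
def rhoB : B →ₗ[ℂ] Smash HA act ⊗[ℂ] Smash HA act →ₗ[ℂ] Smash HA act ⊗[ℂ] Smash HA act :=
  rhoOf HA act (rightB HA act) (TensorProduct.curry (leg23 A HB.T₂.toLinearMap ∘ₗ
    (TensorProduct.assoc ℂ A B B).toLinearMap)).flip

theorem rhoA_tmul (a x : A) (b : B) (y : Smash HA act) :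
    rhoA HA act Γ a (ab HA act x b ⊗ₜ y) =
      applyLast HA act (rightA HA act) ((bP HA act Γ b).lTensor A (HA.l₁ x a)) y := by
  rw [rhoA, rhoOf_tmul]
  congr 2
  simp only [LinearMap.flip_apply, TensorProduct.curry_apply, LinearMap.comp_apply,
    LinearEquiv.coe_coe, TensorProduct.assoc_tmul, leg13_tmul, leg23,
    ← LinearMap.lTensor_comp_apply]
  rfl

theorem rhoB_tmul (b p : B) (x : A) (y : Smash HA act) :
    rhoB HA HB act b (ab HA act x p ⊗ₜ y) =
      applyLast HA act (rightB HA act) (x ⊗ₜ HB.l₁ p b) y := by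
  rw [rhoB, rhoOf_tmul]
  rfl

/-- Linear maps on `AB ⊗ AB` are determined by their values on the elements `ab ⊗ y`. -/
theorem ext_tmul {V : Type*} [AddCommGroup V] [Module ℂ V]
    {f g : Smash HA act ⊗[ℂ] Smash HA act →ₗ[ℂ] V}
    (h : ∀ a b y, f (ab HA act a b ⊗ₜ y) = g (ab HA act a b ⊗ₜ y)) : f = g := by
  refine TensorProduct.ext' fun x y => ?_
  induction x using induction with
  | zero => simp
  | add x y hx hy => simp only [TensorProduct.add_tmul, map_add, hx, hy]
  | tmul a b => exact h a b y

theorem rhoB_mul (b b' : B) :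
    rhoB HA HB act (b * b') = rhoB HA HB act b' ∘ₗ rhoB HA HB act b := by
  refine ext_tmul fun x p y => ?_
  rw [LinearMap.comp_apply, rhoB_tmul, rhoB_tmul, HB.l₁_mul]
  generalize HB.l₁ p b = z
  induction z with
  | zero => simp
  | add x y hx hy => simp only [map_add, TensorProduct.tmul_add, LinearMap.add_apply, hx, hy]
  | tmul g h =>
    rw [applyLast_tmul, rhoB_tmul, HB.Δ_R_tmul]
    generalize HB.l₁ g b' = z
    induction z with
    | zero => simp
    | add x y hx hy => simp only [map_add, TensorProduct.tmul_add, LinearMap.add_apply, hx, hy]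
    | tmul g h' =>
      rw [LinearMap.lTensor_tmul, applyLast_tmul, applyLast_tmul, LinearMap.mulLeft_apply,
        rightB_mul]

theorem applyLast_rightA (hact : IsModuleAlgebra HA act) (n : A) (w : A ⊗[ℂ] (B ⊗[ℂ] A))
    (y : Smash HA act) :
    applyLast HA act (rightA HA act) w (rightA HA act n y) =
      applyLast HA act (rightA HA act) (((LinearMap.mulLeft ℂ n).lTensor B).lTensor A w) y := by
  induction w with
  | zero => simp
  | add x y hx hy => simp only [map_add, LinearMap.add_apply, hx, hy]
  | tmul s w =>
    induction w with
    | zero => simp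
    | add x y hx hy => simp only [map_add, TensorProduct.tmul_add, LinearMap.add_apply, hx, hy]
    | tmul m k =>
      rw [LinearMap.lTensor_tmul, LinearMap.lTensor_tmul, applyLast_tmul, applyLast_tmul,
        LinearMap.mulLeft_apply, rightA_mul hact]

/-- Multiplicativity of `Δ_A` handles the first leg and the first compatibility condition handles
`P`. -/
theorem rhoA_mul (hact : IsModuleAlgebra HA act) (hP : IsCompatible HA HB act Γ) (a a' : A) :
    rhoA HA act Γ (a * a') = rhoA HA act Γ a' ∘ₗ rhoA HA act Γ a := by
  refine ext_tmul fun x b y => ?_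
  rw [LinearMap.comp_apply, rhoA_tmul, rhoA_tmul, HA.l₁_mul]
  generalize HA.l₁ x a = z
  induction z with
  | zero => simp
  | add x y hx hy => simp only [map_add, LinearMap.add_apply, hx, hy]
  | tmul s t =>
    rw [HA.Δ_R_tmul, ← LinearMap.lTensor_comp_apply, LinearMap.lTensor_tmul]
    have h1 : bP HA act Γ b ∘ₗ LinearMap.mulLeft ℂ t = nP HA act Γ (bP HA act Γ b t) :=
      LinearMap.ext fun t' => hP.bP_mul b t t'
    rw [h1]
    generalize bP HA act Γ b t = Z
    induction Z with
    | zero => simp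
    | add x y hx hy =>
      simp only [map_add, TensorProduct.tmul_add, LinearMap.lTensor_add, LinearMap.add_apply,
        hx, hy]
    | tmul m n =>
      have h2 : nP HA act Γ (m ⊗ₜ n) = (LinearMap.mulLeft ℂ n).lTensor B ∘ₗ bP HA act Γ m :=
        LinearMap.ext fun t => nP_tmul m n t
      rw [h2, applyLast_tmul, rhoA_tmul, applyLast_rightA hact, LinearMap.lTensor_comp_apply]

variable (HA HB act Γ) in
/-- `rho x` is right multiplication by `Δ_#(x)` on `AB ⊗ AB`. -/
def rho : Smash HA act →ₗ[ℂ]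
    Smash HA act ⊗[ℂ] Smash HA act →ₗ[ℂ] Smash HA act ⊗[ℂ] Smash HA act :=
  TensorProduct.lift ((LinearMap.llcomp ℂ _ _ _).flip.compl₁₂ (rhoA HA act Γ) (rhoB HA HB act)) ∘ₗ
    (equiv HA act).symm.toLinearMap

theorem rho_ab (a : A) (b : B) : rho HA HB act Γ (ab HA act a b) =
    rhoB HA HB act b ∘ₗ rhoA HA act Γ a := rfl

/-- The exchange rule that makes `Δ_#` respect the relations between `B` and `A` in `AB`. After
evaluation on `xp ⊗ y` both sides are the same functional of the two sides of `leg23_twist`. -/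
theorem rho_ba (hact : IsModuleAlgebra HA act)
    (hs : ∀ (a : A) (b : B), star (act b a) = act (star b) (star (HA.antipode a)))
    (hP : IsCompatible HA HB act Γ) (hΓ : IsCoaction HB Γ) (b : B) (a : A) :
    rho HA HB act Γ (ba HA act b a) = rhoA HA act Γ a ∘ₗ rhoB HA HB act b := by
  refine ext_tmul fun x p y => ?_
  -- `G` lets the last two legs act on `y` from the right. By `x(ba) = (xb)a` it absorbs an `R` in
  -- those legs, which produces the `R₂₃` of `leg23_twist`.
  let G : B ⊗[ℂ] (A ⊗[ℂ] B) →ₗ[ℂ] B ⊗[ℂ] Smash HA act :=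
    (LinearMap.applyₗ y ∘ₗ TensorProduct.lift ((LinearMap.llcomp ℂ _ _ _).flip.compl₁₂
      (rightA HA act) (rightB HA act))).lTensor B
  have hG : ∀ m k l, G (m ⊗ₜ (k ⊗ₜ l)) = m ⊗ₜ rightB HA act l (rightA HA act k y) :=
    fun _ _ _ => rfl
  have hG' : ∀ m h n, G (m ⊗ₜ rt HA act h n) = m ⊗ₜ rightA HA act n (rightB HA act h y) := by
    intro m h n
    rw [← mul_ba hact hs, ba_eq]
    generalize rt HA act h n = z
    induction z with
    | zero => simp
    | add x y hx hy => simp only [map_add, mul_add, TensorProduct.tmul_add, hx, hy]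
    | tmul k l => rw [hG, ← ab_eq, mul_ab]
  let F : A →ₗ[ℂ] B ⊗[ℂ] Smash HA act →ₗ[ℂ] Smash HA act ⊗[ℂ] Smash HA act :=
    LinearMap.rTensorHom (Smash HA act) ∘ₗ TensorProduct.curry (equiv HA act).toLinearMap
  have hF : ∀ s m v, F s (m ⊗ₜ v) = ab HA act s m ⊗ₜ v := fun _ _ _ => rfl
  let W : A ⊗[ℂ] (B ⊗[ℂ] (A ⊗[ℂ] B)) →ₗ[ℂ] Smash HA act ⊗[ℂ] Smash HA act :=
    TensorProduct.lift (LinearMap.lcomp ℂ _ G ∘ₗ F)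
  have hW : ∀ s X, W (s ⊗ₜ X) = F s (G X) := fun _ _ => rfl
  have h1 : ∀ z : B ⊗[ℂ] B, rhoA HA act Γ a (applyLast HA act (rightB HA act) (x ⊗ₜ z) y) =
      W ((leg23 B (twist HA act) ∘ₗ leg13 B (mapP HA act Γ) ∘ₗ
        (TensorProduct.assoc ℂ B B A).toLinearMap ∘ₗ TensorProduct.mk ℂ _ _ z).lTensor A
          (HA.l₁ x a)) := by
    intro z
    induction z with
    | zero => simp
    | add z z' hz hz' =>
      simp only [map_add, TensorProduct.tmul_add, LinearMap.add_apply, LinearMap.comp_add,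
        LinearMap.lTensor_add, hz, hz']
    | tmul g h =>
      rw [applyLast_tmul, rhoA_tmul]
      generalize HA.l₁ x a = w
      induction w with
      | zero => simp
      | add w w' hw hw' => simp only [map_add, LinearMap.add_apply, hw, hw']
      | tmul s t =>
        rw [LinearMap.lTensor_tmul, LinearMap.lTensor_tmul, hW]
        simp only [LinearMap.comp_apply, TensorProduct.mk_apply, LinearEquiv.coe_coe,
          TensorProduct.assoc_tmul, leg13_tmul, ← bP_apply]
        generalize bP HA act Γ g t = v
        induction v with
        | zero => simp
        | add v v' hv hv' =>
          simp only [map_add, TensorProduct.tmul_add, LinearMap.add_apply, hv, hv']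
        | tmul m n =>
          rw [LinearMap.lTensor_tmul, TensorProduct.mk_apply, leg23_tmul, ← rt_apply, hG', hF,
            applyLast_tmul]
  have h2 : ∀ Z : A ⊗[ℂ] B, rho HA HB act Γ (equiv HA act Z) (ab HA act x p ⊗ₜ y) =
      W ((leg13 A HB.T₂.toLinearMap ∘ₗ leg12 B (mapP HA act Γ) ∘ₗ TensorProduct.mk ℂ _ _ p).lTensor
        A (TensorProduct.assoc ℂ A A B ((HA.l₁ x).rTensor B Z))) := by
    intro Z
    induction Z with
    | zero => simp
    | add z z' hz hz' => simp only [map_add, LinearMap.add_apply, hz, hz']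
    | tmul k l =>
      rw [← ab_eq, rho_ab, LinearMap.comp_apply, rhoA_tmul, LinearMap.rTensor_tmul]
      generalize HA.l₁ x k = w
      induction w with
      | zero => simp
      | add w w' hw hw' =>
        simp only [map_add, TensorProduct.add_tmul, LinearMap.add_apply, hw, hw']
      | tmul s t =>
        rw [LinearMap.lTensor_tmul, TensorProduct.assoc_tmul, LinearMap.lTensor_tmul, hW]
        simp only [LinearMap.comp_apply, TensorProduct.mk_apply, leg12_tmul, ← bP_apply]
        generalize bP HA act Γ p t = v
        induction v with
        | zero => simp
        | add v v' hv hv' =>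
          simp only [map_add, TensorProduct.tmul_add, TensorProduct.add_tmul,
            LinearMap.add_apply, hv, hv']
        | tmul m n =>
          rw [applyLast_tmul, rhoB_tmul, TensorProduct.assoc_tmul, leg13_tmul,
            LinearEquiv.coe_coe, ← HB.l₁_apply]
          generalize HB.l₁ m l = v
          induction v with
          | zero => simp
          | add v v' hv hv' =>
            simp only [map_add, TensorProduct.tmul_add, LinearMap.add_apply, hv, hv']
          | tmul g h =>
            rw [LinearMap.lTensor_tmul, TensorProduct.mk_apply, hG, hF, applyLast_tmul]
  have h3 : leg23 B (twist HA act) ∘ₗ leg13 B (mapP HA act Γ) ∘ₗ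
      (TensorProduct.assoc ℂ B B A).toLinearMap ∘ₗ TensorProduct.mk ℂ _ _ (HB.l₁ p b) =
      (leg13 A HB.T₂.toLinearMap ∘ₗ leg12 B (mapP HA act Γ) ∘ₗ TensorProduct.mk ℂ _ _ p) ∘ₗ
        rt HA act b := LinearMap.ext fun t => hP.leg23_twist hΓ hact p b t
  rw [LinearMap.comp_apply, rhoB_tmul, h1, ba_eq, h2, hact.l₁_rt, h3,
    ← LinearMap.lTensor_comp_apply]

/-- Expanding `(a'b')(ab) = a'(b'a)b`, the outer factors split off by multiplicativity of `rhoA` and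
`rhoB`, and the inner `b'a` by `rho_ba`. -/
theorem rho_mul (hact : IsModuleAlgebra HA act)
    (hs : ∀ (a : A) (b : B), star (act b a) = act (star b) (star (HA.antipode a)))
    (hP : IsCompatible HA HB act Γ) (hΓ : IsCoaction HB Γ) (x y : Smash HA act) :
    rho HA HB act Γ (x * y) = rho HA HB act Γ y ∘ₗ rho HA HB act Γ x := by
  have hl : ∀ a z, rho HA HB act Γ (leftA HA act a z) =
      rho HA HB act Γ z ∘ₗ rhoA HA act Γ a := by
    intro a z
    induction z using induction with
    | zero => simp
    | add z z' hz hz' => simp only [map_add, LinearMap.add_comp, hz, hz']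
    | tmul c d => rw [leftA_ab, rho_ab, rho_ab, rhoA_mul hact hP, LinearMap.comp_assoc]
  have hr : ∀ b z, rho HA HB act Γ (rightB HA act b z) =
      rhoB HA HB act b ∘ₗ rho HA HB act Γ z := by
    intro b z
    induction z using induction with
    | zero => simp
    | add z z' hz hz' => simp only [map_add, LinearMap.comp_add, hz, hz']
    | tmul c d => rw [rightB_ab, rho_ab, rho_ab, rhoB_mul, LinearMap.comp_assoc]
  induction y using induction with
  | zero => simp
  | add y y' hy hy' => simp only [map_add, mul_add, LinearMap.add_comp, hy, hy']
  | tmul a b =>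
    induction x using induction with
    | zero => simp
    | add x x' hx hx' => simp only [map_add, add_mul, LinearMap.comp_add, hx, hx']
    | tmul a' b' =>
      rw [mul_ab, hr, rightA_ab, hl, rho_ba hact hs hP hΓ, rho_ab, rho_ab]
      simp only [LinearMap.comp_assoc]

end Smash

end Bicross
end

noncomputable section

namespace Bicross

/-! ### `Δ_#` as a multiplier, its defining formula and its uniqueness. -/

namespace Smash

variable {A : Type*} [NonUnitalRing A] [Module ℂ A] [IsScalarTower ℂ A A] [SMulCommClass ℂ A A]
  [StarRing A] [StarModule ℂ A]
  {B : Type*} [NonUnitalRing B] [Module ℂ B] [IsScalarTower ℂ B B] [SMulCommClass ℂ B B]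
  [StarRing B] [StarModule ℂ B]
  {HA : MultiplierHopfStarAlgebra A} {HB : MultiplierHopfStarAlgebra B}
  {act : B →ₗ[ℂ] A →ₗ[ℂ] B} {Γ : A →ₗ[ℂ] M₀ B A}

theorem induction₂ {p : Smash HA act ⊗[ℂ] Smash HA act → Prop} (zero : p 0)
    (add : ∀ x y, p x → p y → p (x + y)) (tmul : ∀ a b y, p (ab HA act a b ⊗ₜ y))
    (x : Smash HA act ⊗[ℂ] Smash HA act) : p x := by
  induction x with
  | zero => exact zero
  | add x y hx hy => exact add x y hx hy
  | tmul x y =>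
    induction x using induction with
    | zero => rwa [TensorProduct.zero_tmul]
    | add x x' hx hx' => rw [TensorProduct.add_tmul]; exact add _ _ hx hx'
    | tmul a b => exact tmul a b y

theorem involution₂_tmul (x y : Smash HA act) : involution₂ HA act (x ⊗ₜ y) =
    involution HA act x ⊗ₜ involution HA act y := rfl

theorem involution₂_involution₂ (hact : IsModuleAlgebra HA act)
    (hs : ∀ (a : A) (b : B), star (act b a) = act (star b) (star (HA.antipode a)))
    (u : Smash HA act ⊗[ℂ] Smash HA act) :
    involution₂ HA act (involution₂ HA act u) = u := by
  induction u with
  | zero => simp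
  | add x y hx hy => simp only [map_add, hx, hy]
  | tmul x y =>
    rw [involution₂_tmul, involution₂_tmul, involution_involution hact hs,
      involution_involution hact hs]

/-- `(u Δ_#(b))v = u(Δ_#(b)v)` -/
theorem rhoB_mul_eq (hact : IsModuleAlgebra HA act)
    (hs : ∀ (a : A) (b : B), star (act b a) = act (star b) (star (HA.antipode a)))
    (b : B) (u w : Smash HA act ⊗[ℂ] Smash HA act) :
    rhoB HA HB act b u * involution₂ HA act w =
      u * involution₂ HA act (rhoB HA HB act (star b) w) := by
  induction u using induction₂ with
  | zero => simp
  | add u u' hu hu' => simp only [map_add, add_mul, hu, hu']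
  | tmul x p y =>
    induction w using induction₂ with
    | zero => simp
    | add w w' hw hw' => simp only [map_add, mul_add, hw, hw']
    | tmul c q v =>
      -- Both sides take the form `E` of a tensor in `B ⊗ B`: `((p ⊗ 1)Δ(b))(q^* ⊗ 1)` and `(p ⊗
      -- 1)(Δ(b)(q^* ⊗ 1))` respectively.
      let E : B ⊗[ℂ] B →ₗ[ℂ] Smash HA act ⊗[ℂ] Smash HA act := TensorProduct.map
        (rightA HA act (star c) ∘ₗ TensorProduct.curry (equiv HA act).toLinearMap x)
        (LinearMap.mulRight ℂ (involution HA act v) ∘ₗ (rightB HA act).flip y)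
      have hE : ∀ g h, E (g ⊗ₜ h) = rightA HA act (star c) (ab HA act x g) ⊗ₜ
        (rightB HA act h y * involution HA act v) := fun _ _ => rfl
      have h1 : ∀ z : B ⊗[ℂ] B, applyLast HA act (rightB HA act) (x ⊗ₜ z) y *
          involution₂ HA act (ab HA act c q ⊗ₜ v) =
          E ((LinearMap.mulRight ℂ (star q)).rTensor B z) := by
        intro z
        induction z with
        | zero => simp
        | add z z' hz hz' =>
          simp only [map_add, TensorProduct.tmul_add, LinearMap.add_apply, add_mul, hz, hz']
        | tmul g h =>
          rw [applyLast_tmul, involution₂_tmul, involution_ab,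
            Algebra.TensorProduct.tmul_mul_tmul, mul_ba hact hs, rightB_ab, LinearMap.rTensor_tmul,
            hE, LinearMap.mulRight_apply]
      have h2 : ∀ z : B ⊗[ℂ] B, (ab HA act x p ⊗ₜ[ℂ] y) *
          involution₂ HA act (applyLast HA act (rightB HA act) (c ⊗ₜ z) v) =
          E ((LinearMap.mulLeft ℂ p).rTensor B (star z)) := by
        intro z
        induction z with
        | zero => simp
        | add z z' hz hz' =>
          simp only [map_add, TensorProduct.tmul_add, LinearMap.add_apply, mul_add, star_add, hz,
            hz']
        | tmul g h =>
          rw [applyLast_tmul, involution₂_tmul, involution_ab, involution_rightB hact hs,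
            Algebra.TensorProduct.tmul_mul_tmul, mul_ba hact hs, rightB_ab,
            ← rightB_mul_eq hact hs, TensorProduct.star_tmul, LinearMap.rTensor_tmul,
            hE, LinearMap.mulLeft_apply]
      rw [rhoB_tmul, rhoB_tmul, h1, h2, HB.star_l₁, star_star, HB.mulLeft_r₁']

/-- `(u Δ_#(a))v = u(Δ_#(a)v)` -/
theorem rhoA_mul_eq (hact : IsModuleAlgebra HA act)
    (hs : ∀ (a : A) (b : B), star (act b a) = act (star b) (star (HA.antipode a)))
    (hP : IsCompatible HA HB act Γ) (hΓ : IsComoduleCoalgebra HA HB Γ)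
    (hΓs : ∀ a : A, Γ (star (HA.antipode a)) = ((Γ a).map HA.antipode).adjoint)
    (a : A) (u w : Smash HA act ⊗[ℂ] Smash HA act) :
    rhoA HA act Γ a u * involution₂ HA act w =
      u * involution₂ HA act (rhoA HA act Γ (star a) w) := by
  induction u using induction₂ with
  | zero => simp
  | add u u' hu hu' => simp only [map_add, add_mul, hu, hu']
  | tmul x b' y =>
    induction w using induction₂ with
    | zero => simp
    | add w w' hw hw' => simp only [map_add, mul_add, hw, hw']
    | tmul ζ β v =>
      -- Here the two tensors to which `E` is applied are the two sides of `rA_mulRight_bP`.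
      let E : (A ⊗[ℂ] B) ⊗[ℂ] A →ₗ[ℂ] Smash HA act ⊗[ℂ] Smash HA act := TensorProduct.map
        (equiv HA act).toLinearMap
        (LinearMap.mulRight ℂ (involution HA act v) ∘ₗ (rightA HA act).flip y)
      have hE : ∀ X n, E (X ⊗ₜ n) = equiv HA act X ⊗ₜ
        (rightA HA act n y * involution HA act v) := fun _ _ => rfl
      have h1 : ∀ W : A ⊗[ℂ] (B ⊗[ℂ] A), applyLast HA act (rightA HA act) W y *
          involution₂ HA act (ab HA act ζ β ⊗ₜ v) =
          E ((rA HA act (star ζ)).rTensor A ((TensorProduct.assoc ℂ A B A).symm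
            (((LinearMap.mulRight ℂ (star β)).rTensor A).lTensor A W))) := by
        intro W
        induction W with
        | zero => simp
        | add z z' hz hz' => simp only [map_add, LinearMap.add_apply, add_mul, hz, hz']
        | tmul s W =>
          induction W with
          | zero => simp
          | add z z' hz hz' =>
            simp only [map_add, TensorProduct.tmul_add, LinearMap.add_apply, add_mul, hz, hz']
          | tmul m n =>
            rw [applyLast_tmul, involution₂_tmul, involution_ab,
              Algebra.TensorProduct.tmul_mul_tmul, mul_ba hact hs, rightB_ab,
              LinearMap.lTensor_tmul, LinearMap.rTensor_tmul, TensorProduct.assoc_symm_tmul,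
              LinearMap.rTensor_tmul, hE, LinearMap.mulRight_apply]
            rfl
      have h2 : ∀ z : A ⊗[ℂ] A, (ab HA act x b' ⊗ₜ[ℂ] y) *
          involution₂ HA act (applyLast HA act (rightA HA act) ((bP HA act Γ β).lTensor A z) v) =
          E (TensorProduct.lift (smashMul HA act x b' ∘ₗ bPt HA act Γ (star β))
            (TensorProduct.comm ℂ A A (star z))) := by
        intro z
        induction z with
        | zero => simp
        | add z z' hz hz' =>
          simp only [map_add, LinearMap.add_apply, mul_add, star_add, hz, hz']
        | tmul p o =>
          rw [LinearMap.lTensor_tmul, TensorProduct.star_tmul, TensorProduct.comm_tmul,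
            TensorProduct.lift.tmul, LinearMap.comp_apply, bPt_apply, star_star, star_star]
          generalize bP HA act Γ β o = Z
          induction Z with
          | zero => simp
          | add z z' hz hz' =>
            simp only [map_add, TensorProduct.tmul_add, LinearMap.add_apply, mul_add, star_add,
              hz, hz']
          | tmul q r =>
            rw [applyLast_tmul, involution₂_tmul, involution_ab, involution_rightA hact hs,
              Algebra.TensorProduct.tmul_mul_tmul, mul_ba hact hs, rightB_ab,
              ← rightA_mul_eq hact, TensorProduct.star_tmul, smashMul_tmul, hE]
            rfl
      rw [rhoA_tmul, rhoA_tmul, h1, h2, HA.star_l₁, star_star,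
        hP.rA_mulRight_bP hΓ hact hs hΓs]

variable (HA HB act Γ) in
/-- `lam x` is left multiplication by `Δ_#(x)` on `AB ⊗ AB`. -/
def lam : Smash HA act →ₗ[ℂ]
    Smash HA act ⊗[ℂ] Smash HA act →ₗ[ℂ] Smash HA act ⊗[ℂ] Smash HA act where
  toFun x := (involution₂ HA act).comp
    ((rho HA HB act Γ (involution HA act x)).comp (involution₂ HA act))
  map_add' x y := LinearMap.ext fun u => by simp
  map_smul' c x := LinearMap.ext fun u => by simp

theorem lam_apply (x : Smash HA act) (u : Smash HA act ⊗[ℂ] Smash HA act) :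
    lam HA HB act Γ x u =
      involution₂ HA act (rho HA HB act Γ (involution HA act x) (involution₂ HA act u)) := rfl

/-- For `x = ab` the adjoint `x^* = b^*a^*` is a product in the other order, so `rho_ba` makes both
sides composites of the `A`- and `B`-parts; each part is moved across separately. -/
theorem rho_mul_eq (hact : IsModuleAlgebra HA act)
    (hs : ∀ (a : A) (b : B), star (act b a) = act (star b) (star (HA.antipode a)))
    (hP : IsCompatible HA HB act Γ) (hΓ : IsComoduleCoalgebra HA HB Γ)
    (hΓs : ∀ a : A, Γ (star (HA.antipode a)) = ((Γ a).map HA.antipode).adjoint)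
    (x : Smash HA act) (u v : Smash HA act ⊗[ℂ] Smash HA act) :
    rho HA HB act Γ x u * v = u * lam HA HB act Γ x v := by
  induction x using induction with
  | zero => simp
  | add x y hx hy => simp only [map_add, LinearMap.add_apply, add_mul, mul_add, hx, hy]
  | tmul a b =>
    conv_lhs => rw [← involution₂_involution₂ hact hs v]
    rw [lam_apply, involution_ab, rho_ba hact hs hP hΓ.coaction, rho_ab, LinearMap.comp_apply,
      LinearMap.comp_apply, rhoB_mul_eq hact hs, rhoA_mul_eq hact hs hP hΓ hΓs]

variable (HA HB act Γ) in
/-- The smash coproduct `Δ_#`. -/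
def coproduct (hact : IsModuleAlgebra HA act)
    (hs : ∀ (a : A) (b : B), star (act b a) = act (star b) (star (HA.antipode a)))
    (hP : IsCompatible HA HB act Γ) (hΓ : IsComoduleCoalgebra HA HB Γ)
    (hΓs : ∀ a : A, Γ (star (HA.antipode a)) = ((Γ a).map HA.antipode).adjoint) :
    Smash HA act →ₗ[ℂ] Mult (Smash HA act ⊗[ℂ] Smash HA act) :=
  ((lam HA HB act Γ).prod (rho HA HB act Γ)).codRestrict (multiplierSubmodule _)
    fun x u v => rho_mul_eq hact hs hP hΓ hΓs x u v

theorem coproduct_R (hact : IsModuleAlgebra HA act)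
    (hs : ∀ (a : A) (b : B), star (act b a) = act (star b) (star (HA.antipode a)))
    (hP : IsCompatible HA HB act Γ) (hΓ : IsComoduleCoalgebra HA HB Γ)
    (hΓs : ∀ a : A, Γ (star (HA.antipode a)) = ((Γ a).map HA.antipode).adjoint)
    (x : Smash HA act) :
    (coproduct HA HB act Γ hact hs hP hΓ hΓs x).R = rho HA HB act Γ x := rfl

theorem coproduct_L (hact : IsModuleAlgebra HA act)
    (hs : ∀ (a : A) (b : B), star (act b a) = act (star b) (star (HA.antipode a)))
    (hP : IsCompatible HA HB act Γ) (hΓ : IsComoduleCoalgebra HA HB Γ)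
    (hΓs : ∀ a : A, Γ (star (HA.antipode a)) = ((Γ a).map HA.antipode).adjoint)
    (x : Smash HA act) :
    (coproduct HA HB act Γ hact hs hP hΓ hΓs x).L = lam HA HB act Γ x := rfl

/-- Moving `b'` to the right of `a'` by `R` before or after multiplying by `a₍₁₎` gives the same
result (`assoc_rt_l₁`); `P = T^op ∘ R^op` then matches `rhoA` with the covered expression. -/
theorem rho_ba_tmul (hact : IsModuleAlgebra HA act) (a a' : A) (b b' : B) (y : Smash HA act) :
    rho HA HB act Γ (ab HA act a b) (ba HA act b' a' ⊗ₜ y) =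
      (LinearMap.mulLeft ℂ y).lTensor (Smash HA act)
        (mulΔB HA HB act b (coveredΔA HA act Γ b' a' a)) := by
  have h1 : ∀ W : A ⊗[ℂ] (B ⊗[ℂ] A),
      rhoB HA HB act b (applyLast HA act (rightA HA act) W y) =
      (LinearMap.mulLeft ℂ y).lTensor (Smash HA act) (mulΔB HA HB act b W) := by
    intro W
    induction W with
    | zero => simp
    | add z z' hz hz' => simp only [map_add, LinearMap.add_apply, hz, hz']
    | tmul c W =>
      induction W with
      | zero => simp
      | add z z' hz hz' =>
        simp only [map_add, TensorProduct.tmul_add, LinearMap.add_apply, hz, hz']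
      | tmul p d =>
        rw [applyLast_tmul, rhoB_tmul]
        simp only [mulΔB, LinearMap.comp_apply, LinearMap.lTensor_tmul, TensorProduct.mk_apply,
          leg12_tmul, LinearEquiv.coe_coe, ← HB.l₁_apply]
        generalize HB.l₁ p b = z
        induction z with
        | zero => simp
        | add z z' hz hz' =>
          simp only [map_add, TensorProduct.tmul_add, TensorProduct.add_tmul,
            LinearMap.add_apply, hz, hz']
        | tmul g h =>
          simp only [applyLast_tmul, TensorProduct.assoc_tmul, LinearMap.lTensor_tmul,
            LinearEquiv.coe_coe, TensorProduct.comm_tmul, TensorProduct.assoc_symm_tmul,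
            TensorProduct.map_tmul, LinearMap.mulLeft_apply, ← ab_eq, mul_ab]
  have h2 : ∀ Z : A ⊗[ℂ] B, rhoA HA act Γ a (equiv HA act Z ⊗ₜ y) =
      applyLast HA act (rightA HA act)
        (leg23 A (cotwistOp Γ ∘ₗ (TensorProduct.comm ℂ B A).toLinearMap) (rAΔ HA act a Z)) y := by
    intro Z
    induction Z with
    | zero => simp
    | add z z' hz hz' =>
      simp only [map_add, TensorProduct.add_tmul, LinearMap.add_apply, hz, hz']
    | tmul s t =>
      rw [← ab_eq, rhoA_tmul, rAΔ_tmul, bP_eq_comp, LinearMap.lTensor_comp_apply]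
      rfl
  rw [rho_ab, LinearMap.comp_apply, ba_eq, h2, h1, coveredΔA, leg12_tmul', ← hact.assoc_rt_l₁]
  rfl

/-- Surjectivity of `R` says that the elements `ba` span `AB`. -/
theorem ba_induction (hact : IsModuleAlgebra HA act)
    (hs : ∀ (a : A) (b : B), star (act b a) = act (star b) (star (HA.antipode a)))
    {p : Smash HA act → Prop} (zero : p 0) (add : ∀ x y, p x → p y → p (x + y))
    (ba : ∀ b a, p (ba HA act b a)) (x : Smash HA act) : p x := by
  obtain ⟨v, hv⟩ := hact.twist_surjective hs ((equiv HA act).symm x)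
  rw [← (equiv HA act).apply_symm_apply x, ← hv]
  clear hv
  induction v with
  | zero => simpa using zero
  | add v v' h h' => rw [map_add, map_add]; exact add _ _ h h'
  | tmul b a => exact ba b a

theorem eq_zero_of_mul_left₂ (HB : MultiplierHopfStarAlgebra B) (hact : IsModuleAlgebra HA act)
    (hs : ∀ (a : A) (b : B), star (act b a) = act (star b) (star (HA.antipode a)))
    (z : Smash HA act ⊗[ℂ] Smash HA act) (hz : ∀ u, u * z = 0) : z = 0 := by
  refine lTensor_jointly_injective (fun y : Smash HA act => LinearMap.mulLeft ℂ y)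
    (fun x hx => eq_zero_of_mul_left HB hact hs x hx) _ fun y => ?_
  refine rTensor_jointly_injective (fun y : Smash HA act => LinearMap.mulLeft ℂ y)
    (fun x hx => eq_zero_of_mul_left HB hact hs x hx) _ fun x => ?_
  rw [← hz (x ⊗ₜ y)]
  clear hz
  induction z with
  | zero => simp
  | add z z' hz hz' => simp only [map_add, mul_add, hz, hz']
  | tmul a b => simp

/-- By `ρ(u)v = uλ(v)` and non-degeneracy of `AB ⊗ AB`, the map `ρ` determines `λ`. -/
theorem mult_ext (HB : MultiplierHopfStarAlgebra B) (hact : IsModuleAlgebra HA act)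
    (hs : ∀ (a : A) (b : B), star (act b a) = act (star b) (star (HA.antipode a)))
    {m m' : Mult (Smash HA act ⊗[ℂ] Smash HA act)} (h : m.R = m'.R) : m = m' := by
  refine Subtype.ext (Prod.ext (LinearMap.ext fun v => ?_) h)
  refine sub_eq_zero.1 (eq_zero_of_mul_left₂ HB hact hs _ fun u => ?_)
  have h1 : m.R u * v = u * m.1.1 v := m.2 u v
  have h2 : m'.R u * v = u * m'.1.1 v := m'.2 u v
  rw [mul_sub, ← h1, ← h2, h, sub_self]

theorem eq_coproduct (hact : IsModuleAlgebra HA act)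
    (hs : ∀ (a : A) (b : B), star (act b a) = act (star b) (star (HA.antipode a)))
    (hP : IsCompatible HA HB act Γ) (hΓ : IsComoduleCoalgebra HA HB Γ)
    (hΓs : ∀ a : A, Γ (star (HA.antipode a)) = ((Γ a).map HA.antipode).adjoint)
    {D : Smash HA act →ₗ[ℂ] Mult (Smash HA act ⊗[ℂ] Smash HA act)}
    (hD : IsSmashCoproduct HA HB act Γ D) : D = coproduct HA HB act Γ hact hs hP hΓ hΓs := by
  refine LinearMap.ext fun x => ?_
  induction x using induction with
  | zero => simp
  | add x y hx hy => simp only [map_add, hx, hy]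
  | tmul a b =>
    refine mult_ext HB hact hs (TensorProduct.ext' fun x y => ?_)
    induction x using ba_induction hact hs with
    | zero => simp
    | add x x' hx hx' => simp only [TensorProduct.add_tmul, map_add, hx, hx']
    | ba b' a' => rw [hD, coproduct_R, rho_ba_tmul hact]

end Smash

end Bicross
end

theorem theorem3p15
    {A : Type*} [NonUnitalRing A] [Module ℂ A] [IsScalarTower ℂ A A] [SMulCommClass ℂ A A]
    [StarRing A] [StarModule ℂ A]
    {B : Type*} [NonUnitalRing B] [Module ℂ B] [IsScalarTower ℂ B B] [SMulCommClass ℂ B B]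
    [StarRing B] [StarModule ℂ B]
    (HA : Bicross.MultiplierHopfStarAlgebra A) (HB : Bicross.MultiplierHopfStarAlgebra B)
    (act : B →ₗ[ℂ] A →ₗ[ℂ] B) (hact : Bicross.IsModuleAlgebra HA act)
    (hact_star : ∀ (a : A) (b : B), star (act b a) = act (star b) (star (HA.antipode a))) :
    -- `AB` is a `*`-algebra (with non-degenerate product) for `(ab)^* = b^* a^*`
    ((∀ x y z : Bicross.Smash HA act, x * y * z = x * (y * z)) ∧
      (∀ x : Bicross.Smash HA act, (∀ y, x * y = 0) → x = 0) ∧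
      (∀ x : Bicross.Smash HA act, (∀ y, y * x = 0) → x = 0) ∧
      (∀ (a : A) (b : B), Bicross.Smash.involution HA act (Bicross.Smash.ab HA act a b) =
        Bicross.Smash.ba HA act (star b) (star a)) ∧
      (∀ x : Bicross.Smash HA act,
        Bicross.Smash.involution HA act (Bicross.Smash.involution HA act x) = x) ∧
      (∀ x y : Bicross.Smash HA act, Bicross.Smash.involution HA act (x * y) =
        Bicross.Smash.involution HA act y * Bicross.Smash.involution HA act x)) ∧
    -- `Δ_#` is a well-defined `*`-homomorphism on `AB`
    (∀ Γ : A →ₗ[ℂ] Bicross.M₀ B A, Bicross.IsComoduleCoalgebra HA HB Γ →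
      (∀ a : A, Γ (star (HA.antipode a)) = ((Γ a).map HA.antipode).adjoint) →
      Bicross.IsCompatible HA HB act Γ →
      (∃! D : Bicross.Smash HA act →ₗ[ℂ]
          Bicross.Mult (Bicross.Smash HA act ⊗[ℂ] Bicross.Smash HA act),
        Bicross.IsSmashCoproduct HA HB act Γ D) ∧
      (∀ D : Bicross.Smash HA act →ₗ[ℂ]
          Bicross.Mult (Bicross.Smash HA act ⊗[ℂ] Bicross.Smash HA act),
        Bicross.IsSmashCoproduct HA HB act Γ D →
        (∀ x y, D (x * y) = D x * D y) ∧
        (∀ x, Bicross.Mult.IsAdjoint (Bicross.Smash.involution₂ HA act) (D x)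
          (D (Bicross.Smash.involution HA act x))))) := by
  refine ⟨⟨Bicross.Smash.mul_assoc' hact hact_star,
    Bicross.Smash.eq_zero_of_mul HB hact hact_star,
    Bicross.Smash.eq_zero_of_mul_left HB hact hact_star,
    Bicross.Smash.involution_ab HA act,
    Bicross.Smash.involution_involution hact hact_star,
    Bicross.Smash.involution_mul hact hact_star⟩, fun Γ hΓ hΓs hP => ⟨?_, ?_⟩⟩
  · exact ⟨Bicross.Smash.coproduct HA HB act Γ hact hact_star hP hΓ hΓs,
      fun a a' b b' y => Bicross.Smash.rho_ba_tmul hact a a' b b' y,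
      fun D hD => Bicross.Smash.eq_coproduct hact hact_star hP hΓ hΓs hD⟩
  · intro D hD
    rw [Bicross.Smash.eq_coproduct hact hact_star hP hΓ hΓs hD]
    refine ⟨fun x y => Bicross.Smash.mult_ext HB hact hact_star
      (Bicross.Smash.rho_mul hact hact_star hP hΓ.coaction x y), fun x u => ⟨?_, ?_⟩⟩
    -- Both adjoint relations unwind the definition of `lam`, by involutivity of `*` on `AB` and on
    -- `AB ⊗ AB`.
    · rw [Bicross.Smash.coproduct_L, Bicross.Smash.coproduct_R, Bicross.Smash.lam_apply,
        Bicross.Smash.involution_involution hact hact_star]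
    · rw [Bicross.Smash.coproduct_L, Bicross.Smash.coproduct_R, Bicross.Smash.lam_apply,
        Bicross.Smash.involution₂_involution₂ hact hact_star,
        Bicross.Smash.involution₂_involution₂ hact hact_star]
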